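/- Let $n\ge 2$, write $y=(y',y_n)\in\mathbb R^{n-1}\times\mathbb R$, and put $\mathbb B^+_r=\{y\in\mathbb R^n : |y|<r,\ y_n>0\}$ and ${\bf B}_r=\{(y',0) : y'\in\mathbb R^{n-1},\ |y'|<r\}$. For all $\theta,M,K>0$ there exist constants $C>0$, $\beta>0$ and $\kappa\in(0,1)$, depending only on $n,\theta,M,K$, such that the following holds. Let $\alpha,\lambda\in\mathbb R$ with $|\alpha|\ge 1$ or $|\lambda|\ge 1$. Let $a_{ij}\in C^1(\mathbb B^+_{1/2})$ satisfy $\|a_{ij}\|_{C^1(\mathbb B^+_{1/2})}\le M$ and $\sum_{i,j}a_{ij}(y)\xi_i\xi_j\ge\theta|\xi|^2$ for all $y\in\mathbb B^+_{1/2}$ and $\xi\in\mathbb R^n$, and let $b=(b_1,\dots,b_n)$ and $c$ satisfy $$\|b_i\|_{W^{1,\infty}(\mathbb B^+_{1/2})}\le K(|\alpha|+1),\qquad \|c\|_{W^{1,\infty}(\mathbb B^+_{1/2})}\le K(\alpha^2+|\lambda|).$$ Let $u\in L^2(\mathbb B^+_{1/2})$ be a real function that is $C^\infty$ up to the flat boundary,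 i.e. on $\{|y|<1/2,\ y_n\ge 0\}$, and satisfies $$-\sum_{i,j}a_{ij}D_{ij}u+\sum_i b_iD_iu+cu=0\quad\text{a.e. in }\mathbb B^+_{1/2}.$$ Then $$\|u\|_{L^2(\mathbb B^+_{1/256})}\le e^{C(|\alpha|+\sqrt{|\lambda|})}\,\|u\|_{L^2(\mathbb B^+_{1/2})}^{\kappa}\Big(\|u\|_{H^1({\bf B}_{1/3})}+\Big\|\frac{\partial u}{\partial\nu}\Big\|_{L^2({\bf B}_{1/3})}\Big)^{1-\kappa},$$ where $\partial u/\partial\nu=-D_nu$ and $\|u\|_{H^1({\bf B}_{1/3})}^2=\|u\|^2_{L^2({\bf B}_{1/3})}+\|\nabla' u\|^2_{L^2({\bf B}_{1/3})}$ with $\nabla'$ the gradient in $y'$. Moreover, if $\|u\|_{L^2(\mathbb B^+_{1/2})}\le 1$ and $\|u\|_{H^1({\bf B}_{1/3})}+\|\partial u/\partial\nu\|_{L^2({\bf B}_{1/3})}\le\epsilon$ for some $\epsilon>0$, then $$\|u\|_{L^2(\mathbb B^+_{1/256})}\le e^{C(|\alpha|+\sqrt{|\lambda|})}\,\epsilon^{\beta}.$$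 -/

import Mathlib

open MeasureTheory
open scoped ENNReal ContDiff

noncomputable section

/-- Points `y = (y', y_n)` of `ℝⁿ`, `n = d + 1`; the last coordinate is the normal one. -/
abbrev Rn (d : ℕ) : Type := EuclideanSpace ℝ (Fin (d + 1))

/-- Points `y'` of `ℝⁿ⁻¹`, `n = d + 1`. -/
abbrev Rn' (d : ℕ) : Type := EuclideanSpace ℝ (Fin d)

/-- The open half ball `{|y| < r, y_n > 0}`. -/
def halfBall (d : ℕ) (r : ℝ) : Set (Rn d) := {y | ‖y‖ < r ∧ 0 < y (Fin.last d)}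

/-- The half ball together with its flat face, `{|y| < r, y_n ≥ 0}`. -/
def flatHalfBall (d : ℕ) (r : ℝ) : Set (Rn d) := {y | ‖y‖ < r ∧ 0 ≤ y (Fin.last d)}

/-- The point `(y', 0)`. -/
def flatPoint {d : ℕ} (y' : Rn' d) : Rn d :=
  WithLp.toLp 2 (Fin.snoc (α := fun _ => ℝ) (fun i => y' i) 0)

/-- The partial derivative `D_i f`. -/
def partialD {d : ℕ} (i : Fin (d + 1)) (f : Rn d → ℝ) : Rn d → ℝ :=
  fun y => fderiv ℝ f y (EuclideanSpace.single i 1)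

/-- `g` is the weak derivative `D_i f` in the open set `U`. -/
def IsWeakPartialD {d : ℕ} (U : Set (Rn d)) (i : Fin (d + 1)) (f g : Rn d → ℝ) : Prop :=
  ∀ φ : Rn d → ℝ, ContDiff ℝ ∞ φ → HasCompactSupport φ → tsupport φ ⊆ U →
    ∫ y in U, f y * partialD i φ y = - ∫ y in U, g y * φ y

/-- `f ∈ W^{1,∞}(U)` and `‖f‖_{W^{1,∞}(U)} ≤ N`, where the norm is the largest of the
`L^∞(U)` norms of `f` and of its weak first derivatives. -/
def W1InftyNormLE {d : ℕ} (U : Set (Rn d)) (f : Rn d → ℝ) (N : ℝ) : Prop :=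
  MemLp f ∞ (volume.restrict U) ∧ eLpNorm f ∞ (volume.restrict U) ≤ ENNReal.ofReal N ∧
    ∀ i, ∃ g : Rn d → ℝ, IsWeakPartialD U i f g ∧
      MemLp g ∞ (volume.restrict U) ∧ eLpNorm g ∞ (volume.restrict U) ≤ ENNReal.ofReal N

/-- `f ∈ C¹(U)` and `‖f‖_{C¹(U)} ≤ N`, for an open set `U`. -/
def C1NormLE {d : ℕ} (U : Set (Rn d)) (f : Rn d → ℝ) (N : ℝ) : Prop :=
  ContDiffOn ℝ 1 f U ∧ ∀ y ∈ U, |f y| ≤ N ∧ ‖fderiv ℝ f y‖ ≤ N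

/-- Uniform ellipticity in `U` with constant `θ`. The upper bound is part of the bound on the
coefficients. -/
def UniformlyElliptic {d : ℕ} (U : Set (Rn d)) (a : Fin (d + 1) → Fin (d + 1) → Rn d → ℝ)
    (θ : ℝ) : Prop :=
  ∀ y ∈ U, ∀ ξ : Rn d, θ * ‖ξ‖ ^ 2 ≤ ∑ i, ∑ j, a i j y * ξ i * ξ j

/-- The operator `-a_{ij} D_{ij} u + b_i D_i u + c u`. -/
def ellipticOp {d : ℕ} (a : Fin (d + 1) → Fin (d + 1) → Rn d → ℝ)
    (b : Fin (d + 1) → Rn d → ℝ) (c : Rn d → ℝ) (u : Rn d → ℝ) : Rn d → ℝ :=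
  fun y => -(∑ i, ∑ j, a i j y * partialD i (partialD j u) y)
    + ∑ i, b i y * partialD i u y + c y * u y

/-- `‖u‖_{L²(B⁺_r)}`. -/
def halfBallL2 {d : ℕ} (r : ℝ) (u : Rn d → ℝ) : ℝ≥0∞ :=
  eLpNorm u 2 (volume.restrict (halfBall d r))

/-- The `H¹` norm on the `(n-1)`-dimensional ball `|y'| < r` of a function that is `C¹` there:
`(‖g‖² + ‖∇g‖²)^{1/2}` with `L²` norms. -/
def ballH1 {d : ℕ} (r : ℝ) (g : Rn' d → ℝ) : ℝ≥0∞ :=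
  (eLpNorm g 2 (volume.restrict (Metric.ball 0 r)) ^ 2
    + eLpNorm (fderiv ℝ g) 2 (volume.restrict (Metric.ball 0 r)) ^ 2) ^ (1 / 2 : ℝ)

/-- The outer normal derivative `∂u/∂ν = -D_n u` at `(y', 0)`, for `u` differentiable up to the
flat face of the half ball of radius `R`. -/
def normalD {d : ℕ} (R : ℝ) (u : Rn d → ℝ) : Rn' d → ℝ :=
  fun y' => -(fderivWithin ℝ u (flatHalfBall d R) (flatPoint y')
    (EuclideanSpace.single (Fin.last d) 1))

/-- The boundary data `‖u‖_{H¹} + ‖∂u/∂ν‖_{L²}` on `{(y', 0) : |y'| < r}`, for `u` defined in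
the half ball of radius `R > r`. -/
def cauchyData {d : ℕ} (R r : ℝ) (u : Rn d → ℝ) : ℝ≥0∞ :=
  ballH1 r (fun y' : Rn' d => u (flatPoint y'))
    + eLpNorm (normalD R u) 2 (volume.restrict (Metric.ball 0 r))

end

open scoped Gradient InnerProductSpace

/-! The core is a Carleman estimate with weight `e^{τφ}`, `φ = e^{μψ}`, `ψ = -(|y|² + 2 y_n)`, in
the half space. Conjugating the principal part by the weight and testing with a first order
multiplier gives the divergence of an explicit flux plus a quadratic form, which is positive once
`μ` and then `τ` are large; the flux is paid for by the Cauchy data on the flat face. Since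
`τ ≥ C(|α| + √|λ|)` absorbs `b` and `c`, cutting off a solution and bounding its gradient on the
transition region by Caccioppoli's inequality leaves
`‖u‖²_{B⁺_{1/256}} ≤ e^{-gCτ} ‖u‖²_{B⁺_{1/2}} + e^{Cτ} (data)²` up to constants, because `ψ` is
larger on the small half ball than on the transition region; optimizing over `τ` yields the
interpolation inequality.

The coefficients are only controlled inside the open half ball. They are mollified and the problem
is translated by `δ e_n`, so that everything is smooth on a closed half ball, and then `δ → 0`. -/

lemma abs_inner_apply_le {E : Type*} [NormedAddCommGroup E] [InnerProductSpace ℝ E]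
    (L : E →L[ℝ] E) (x z : E) : |⟪L x, z⟫_ℝ| ≤ ‖L‖ * ‖x‖ * ‖z‖ :=
  (abs_real_inner_le_norm _ _).trans (by gcongr; exact L.le_opNorm x)

section hessian

variable {E : Type*} [NormedAddCommGroup E] [InnerProductSpace ℝ E] [CompleteSpace E]

lemma hasFDerivAt_innerSL_gradient {u : E → ℝ} {y : E} (hu : DifferentiableAt ℝ u y) :
    HasFDerivAt u (innerSL ℝ (∇ u y)) y :=
  hu.hasGradientAt.hasFDerivAt

lemma gradient_eq_of_hasFDerivAt {u : E → ℝ} {y v : E} (h : HasFDerivAt u (innerSL ℝ v) y) :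
    ∇ u y = v :=
  (hasGradientAt_iff_hasFDerivAt.2 h).gradient

lemma norm_gradient (u : E → ℝ) (y : E) : ‖∇ u y‖ = ‖fderiv ℝ u y‖ := by
  simp [gradient]

lemma contDiff_gradient {u : E → ℝ} {m n : WithTop ℕ∞} (hu : ContDiff ℝ n u) (hmn : m + 1 ≤ n) :
    ContDiff ℝ m (∇ u) :=
  (InnerProductSpace.toDual ℝ E).symm.contDiff.comp (hu.fderiv_right hmn)

lemma gradient_mul {f g : E → ℝ} {y : E} (hf : DifferentiableAt ℝ f y)
    (hg : DifferentiableAt ℝ g y) :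
    ∇ (fun x => f x * g x) y = f y • ∇ g y + g y • ∇ f y := by
  apply gradient_eq_of_hasFDerivAt
  refine ((hasFDerivAt_innerSL_gradient hf).mul
    (hasFDerivAt_innerSL_gradient hg)).congr_fderiv ?_
  simp only [map_add, map_smul]

/-- The Hessian of `u` at `y`, encoded as the endomorphism `z ↦ D_z ∇u` rather than as a bilinear
form, so that it can be composed with coefficient fields. -/
noncomputable def hess (u : E → ℝ) (y : E) : E →L[ℝ] E := fderiv ℝ (∇ u) y

lemma hasFDerivAt_gradient {u : E → ℝ} (hu : ContDiff ℝ 2 u) (y : E) :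
    HasFDerivAt (∇ u) (hess u y) y :=
  ((contDiff_gradient (m := 1) hu (by norm_num)).differentiable one_ne_zero y).hasFDerivAt

lemma inner_hess (u : E → ℝ) (y x z : E) :
    ⟪hess u y x, z⟫_ℝ = fderiv ℝ (fderiv ℝ u) y x z := by
  have h : ∇ u = (InnerProductSpace.toDual ℝ E).symm ∘ fderiv ℝ u := rfl
  rw [hess, h, LinearIsometryEquiv.comp_fderiv]
  exact InnerProductSpace.toDual_symm_apply

lemma isSymmetric_hess {u : E → ℝ} (hu : ContDiff ℝ 2 u) (y : E) :
    (hess u y : E →ₗ[ℝ] E).IsSymmetric := fun x z => by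
  rw [ContinuousLinearMap.coe_coe, inner_hess, real_inner_comm, inner_hess]
  exact (hu.contDiffAt.isSymmSndFDerivAt (by simp)).eq x z

lemma hess_mul {f g : E → ℝ} (hf : ContDiff ℝ 2 f) (hg : ContDiff ℝ 2 g) (y : E) :
    hess (fun x => f x * g x) y = f y • hess g y + (innerSL ℝ (∇ f y)).smulRight (∇ g y)
      + (g y • hess f y + (innerSL ℝ (∇ g y)).smulRight (∇ f y)) := by
  have hf1 := hf.differentiable two_ne_zero
  have hg1 := hg.differentiable two_ne_zero
  have hgrad : ∇ (fun x => f x * g x) = f • ∇ g + g • ∇ f :=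
    funext fun x => gradient_mul (hf1 x) (hg1 x)
  rw [hess, hgrad]
  exact (((hasFDerivAt_innerSL_gradient (hf1 y)).smul (hasFDerivAt_gradient hg y)).add
    ((hasFDerivAt_innerSL_gradient (hg1 y)).smul (hasFDerivAt_gradient hf y))).fderiv

end hessian

section trace

variable {E : Type*} [NormedAddCommGroup E] [InnerProductSpace ℝ E] [FiniteDimensional ℝ E]

/-- The trace, as a continuous linear functional on the continuous endomorphisms. -/
noncomputable def traceL : (E →L[ℝ] E) →L[ℝ] ℝ :=
  (LinearMap.trace ℝ E ∘ₗ ContinuousLinearMap.coeLM ℝ).toContinuousLinearMap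

lemma traceL_eq_sum {ι : Type*} [Fintype ι] (e : OrthonormalBasis ι ℝ E) (L : E →L[ℝ] E) :
    traceL L = ∑ k, ⟪e k, L (e k)⟫_ℝ :=
  LinearMap.trace_eq_sum_inner (L : E →ₗ[ℝ] E) e

lemma traceL_smulRight (f : E →L[ℝ] ℝ) (v : E) : traceL (f.smulRight v) = f v :=
  LinearMap.trace_smulRight (f : E →ₗ[ℝ] ℝ) v

lemma abs_traceL_le (L : E →L[ℝ] E) : |traceL L| ≤ Module.finrank ℝ E * ‖L‖ := by
  let e := stdOrthonormalBasis ℝ E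
  calc |traceL L| ≤ ∑ k, |⟪e k, L (e k)⟫_ℝ| := by
        rw [traceL_eq_sum e]
        exact Finset.abs_sum_le_sum_abs _ _
    _ ≤ ∑ _k : Fin (Module.finrank ℝ E), ‖L‖ := by
        gcongr with k
        rw [real_inner_comm]
        simpa using abs_inner_apply_le L (e k) (e k)
    _ = Module.finrank ℝ E * ‖L‖ := by simp

lemma traceL_comp_smulRight (A : E →L[ℝ] E) (x z : E) :
    traceL (A.comp ((innerSL ℝ x).smulRight z)) = ⟪x, A z⟫_ℝ := by
  have h : A.comp ((innerSL ℝ x).smulRight z) = (innerSL ℝ x).smulRight (A z) := by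
    ext v
    simp
  rw [h, traceL_smulRight, innerSL_apply_apply]

lemma traceL_comp_hess_mul {f g : E → ℝ} (hf : ContDiff ℝ 2 f) (hg : ContDiff ℝ 2 g) (y : E)
    {A : E →L[ℝ] E} (hA : (A : E →ₗ[ℝ] E).IsSymmetric) :
    traceL (A.comp (hess (fun x => f x * g x) y)) = f y * traceL (A.comp (hess g y))
      + g y * traceL (A.comp (hess f y)) + 2 * ⟪A (∇ f y), ∇ g y⟫_ℝ := by
  rw [hess_mul hf hg]
  simp only [ContinuousLinearMap.comp_add, ContinuousLinearMap.comp_smul, map_add, map_smul,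
    traceL_comp_smulRight, smul_eq_mul]
  rw [← hA.apply_clm (∇ f y), real_inner_comm (A (∇ f y)) (∇ g y)]
  ring

/-- The divergence of a vector field. -/
noncomputable def divergence (F : E → E) (y : E) : ℝ := traceL (fderiv ℝ F y)

lemma divergence_smul {g : E → ℝ} {V : E → E} {y : E} {g' : E →L[ℝ] ℝ} {V' : E →L[ℝ] E}
    (hg : HasFDerivAt g g' y) (hV : HasFDerivAt V V' y) :
    divergence (fun x => g x • V x) y = g y * traceL V' + g' (V y) := by
  rw [divergence, (show HasFDerivAt (fun x => g x • V x) _ y from hg.smul hV).fderiv, map_add,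
    map_smul, traceL_smulRight, smul_eq_mul]

/-- The operator `-tr (A D²u) + b · ∇u + c u` in non-divergence form, where the field `A` of
coefficient matrices is a field of endomorphisms. -/
noncomputable def nondivOp (A : E → E →L[ℝ] E) (b : E → E) (c u : E → ℝ) : E → ℝ :=
  fun y => -traceL ((A y).comp (hess u y)) + ⟪b y, ∇ u y⟫_ℝ + c y * u y

/-- The Rellich-type multiplier flux: for `-tr (A D²w) + ⟨X, ∇w⟩ - Q w = g`, testing against
`2 (⟨X, ∇w⟩ + ρ w)` leaves the divergence of this field plus lower order terms. -/
noncomputable def flux (A : E → E →L[ℝ] E) (X : E → E) (Q ρ w : E → ℝ) (p : E → E) : E → E :=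
  fun x => (2 * ⟪X x, p x⟫_ℝ + 2 * (ρ x * w x)) • A x (p x)
    + (Q x * w x ^ 2 - ⟪A x (p x), p x⟫_ℝ) • X x

lemma divergence_flux {A : E → E →L[ℝ] E} {X p : E → E} {Q ρ w : E → ℝ}
    {A' : E →L[ℝ] E →L[ℝ] E} {X' H : E →L[ℝ] E} {Q' ρ' : E →L[ℝ] ℝ} {y : E}
    (hA : HasFDerivAt A A' y) (hX : HasFDerivAt X X' y) (hQ : HasFDerivAt Q Q' y)
    (hρ : HasFDerivAt ρ ρ' y) (hw : HasFDerivAt w (innerSL ℝ (p y)) y) (hp : HasFDerivAt p H y)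
    (hAs : (A y : E →ₗ[ℝ] E).IsSymmetric) (hHs : (H : E →ₗ[ℝ] E).IsSymmetric) :
    divergence (flux A X Q ρ w p) y
      = 2 * (⟪X y, p y⟫_ℝ + ρ y * w y)
          * (traceL ((A y).comp H) + traceL (A'.flip (p y)) + Q y * w y)
        + (2 * ⟪X' (A y (p y)), p y⟫_ℝ + (2 * ρ y - traceL X') * ⟪A y (p y), p y⟫_ℝ
          - ⟪A' (X y) (p y), p y⟫_ℝ)
        + (Q' (X y) + (traceL X' - 2 * ρ y) * Q y) * w y ^ 2
        + 2 * w y * ρ' (A y (p y)) := by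
  have hAp := hA.clm_apply hp
  have hmult := ((hX.inner ℝ hp).const_mul 2).add ((hρ.mul hw).const_mul 2)
  have hpot := (hQ.mul (hw.pow 2)).sub (hAp.inner ℝ hp)
  rw [divergence, (show HasFDerivAt (flux A X Q ρ w p) _ y from
    (hmult.smul hAp).add (hpot.smul hX)).fderiv]
  have hH_symm : ⟪X y, H (A y (p y))⟫_ℝ = ⟪A y (p y), H (X y)⟫_ℝ := by
    rw [real_inner_comm, hHs.apply_clm]
  have hA_symm : ⟪A y (H (X y)), p y⟫_ℝ = ⟪A y (p y), H (X y)⟫_ℝ := by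
    rw [hAs.apply_clm, real_inner_comm]
  simp [map_add, map_smul, traceL_smulRight, inner_add_left, hH_symm, hA_symm,
    real_inner_comm (X y) (p y), real_inner_comm (A y (p y)) (p y)]
  ring

end trace

section halfSpace

variable {d : ℕ}

/-- The open upper half space `{y_n > 0}`. -/
def upperHalf (d : ℕ) : Set (Rn d) := {y | 0 < y (Fin.last d)}

/-- The inward unit normal `e_n` to the boundary of the upper half space. -/
noncomputable def eN (d : ℕ) : Rn d := EuclideanSpace.single (Fin.last d) 1

/-- The point of `ℝⁿ` with `k`-th coordinate `t` and remaining coordinates `z`, for integrating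
over lines in a coordinate direction. The remaining coordinates form a plain product rather than a
Euclidean space, as in Mathlib's `Fin.insertNth`. -/
def insertCoord (k : Fin (d + 1)) (t : ℝ) (z : Fin d → ℝ) : Rn d :=
  WithLp.toLp 2 (Fin.insertNth (α := fun _ => ℝ) k t z)

lemma measurableSet_upperHalf : MeasurableSet (upperHalf d) :=
  measurableSet_lt measurable_const (by fun_prop)

lemma insertCoord_eq_add (k : Fin (d + 1)) (t : ℝ) (z : Fin d → ℝ) :
    insertCoord k t z = insertCoord k 0 z + t • EuclideanSpace.single k 1 := by
  ext i
  rcases Fin.eq_self_or_eq_succAbove k i with rfl | ⟨j, rfl⟩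
  · simp [insertCoord]
  · simp [insertCoord, Fin.succAbove_ne]

lemma measurePreserving_insertCoord (k : Fin (d + 1)) :
    MeasurePreserving (fun x : ℝ × (Fin d → ℝ) => insertCoord k x.1 x.2) :=
  (PiLp.volume_preserving_toLp (Fin (d + 1))).comp
    (volume_preserving_piFinSuccAbove (fun _ => ℝ) k).symm

lemma measurableEmbedding_insertCoord (k : Fin (d + 1)) :
    MeasurableEmbedding (fun x : ℝ × (Fin d → ℝ) => insertCoord k x.1 x.2) :=
  ((MeasurableEquiv.piFinSuccAbove (fun _ => ℝ) k).symm.trans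
    (MeasurableEquiv.toLp 2 (Fin (d + 1) → ℝ))).measurableEmbedding

lemma integral_eq_integral_insertCoord (k : Fin (d + 1)) {g : Rn d → ℝ} (hg : Integrable g) :
    ∫ y, g y = ∫ z, ∫ t, g (insertCoord k t z) := by
  rw [← (measurePreserving_insertCoord k).integral_comp (measurableEmbedding_insertCoord k)]
  exact integral_prod_symm _ (((measurePreserving_insertCoord k).integrable_comp_emb
    (measurableEmbedding_insertCoord k)).2 hg)

lemma hasDerivAt_insertCoord (k : Fin (d + 1)) (z : Fin d → ℝ) (t : ℝ) :
    HasDerivAt (fun t : ℝ => insertCoord k t z) (EuclideanSpace.single k (1 : ℝ)) t := by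
  rw [funext fun t => insertCoord_eq_add k t z]
  simpa only [id_eq, one_smul] using
    ((hasDerivAt_id t).smul_const (EuclideanSpace.single k (1 : ℝ))).const_add (insertCoord k 0 z)

lemma contDiff_comp_insertCoord {f : Rn d → ℝ} {n : WithTop ℕ∞} (hf : ContDiff ℝ n f)
    (k : Fin (d + 1)) (z : Fin d → ℝ) : ContDiff ℝ n (fun t => f (insertCoord k t z)) := by
  refine hf.comp (g := f) (f := fun t => insertCoord k t z) ?_
  rw [funext fun t => insertCoord_eq_add k t z]
  fun_prop

lemma deriv_comp_insertCoord {f : Rn d → ℝ} (hf : Differentiable ℝ f) (k : Fin (d + 1))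
    (z : Fin d → ℝ) (t : ℝ) : deriv (fun t => f (insertCoord k t z)) t
      = fderiv ℝ f (insertCoord k t z) (EuclideanSpace.single k 1) :=
  ((hf _).hasFDerivAt.comp_hasDerivAt t (hasDerivAt_insertCoord k z t)).deriv

lemma hasCompactSupport_comp_insertCoord {f : Rn d → ℝ} (hc : HasCompactSupport f)
    (k : Fin (d + 1)) (z : Fin d → ℝ) : HasCompactSupport (fun t => f (insertCoord k t z)) := by
  have h : Isometry fun t => insertCoord k t z := fun s t => by
    change edist (insertCoord k s z) (insertCoord k t z) = _
    rw [insertCoord_eq_add k s, insertCoord_eq_add k t, edist_add_left, edist_eq_enorm_sub,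
      ← sub_smul, enorm_smul, edist_eq_enorm_sub]
    simp [← ofReal_norm]
  exact hc.comp_isClosedEmbedding h.isClosedEmbedding

lemma flatPoint_eq_insertCoord (y' : Rn' d) :
    flatPoint y' = insertCoord (Fin.last d) 0 (fun i => y' i) := by
  simp [flatPoint, insertCoord, Fin.insertNth_last']

lemma integral_flatPoint (f : Rn d → ℝ) :
    ∫ y' : Rn' d, f (flatPoint y') = ∫ z, f (insertCoord (Fin.last d) 0 z) := by
  rw [← (PiLp.volume_preserving_ofLp (Fin d)).integral_comp
    (MeasurableEquiv.toLp 2 (Fin d → ℝ)).symm.measurableEmbedding]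
  simp only [flatPoint_eq_insertCoord]

lemma flatPoint_last (y' : Rn' d) : flatPoint y' (Fin.last d) = 0 := by simp [flatPoint]

lemma norm_flatPoint (y' : Rn' d) : ‖flatPoint y'‖ = ‖y'‖ := by
  simp [EuclideanSpace.norm_eq, Fin.sum_univ_castSucc, flatPoint]

/-- The embedding `y' ↦ (y', 0)` as a linear isometry. -/
def flatEmb (d : ℕ) : Rn' d →ₗᵢ[ℝ] Rn d where
  toFun := flatPoint
  map_add' x y := by
    ext i
    refine Fin.lastCases ?_ (fun j => ?_) i <;> simp [flatPoint]
  map_smul' c x := by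
    ext i
    refine Fin.lastCases ?_ (fun j => ?_) i <;> simp [flatPoint]
  norm_map' := norm_flatPoint

lemma isClosedEmbedding_flatPoint : Topology.IsClosedEmbedding (flatPoint (d := d)) :=
  (flatEmb d).isometry.isClosedEmbedding

lemma integrable_fderiv_apply {f : Rn d → ℝ} (hf : ContDiff ℝ 1 f) (hc : HasCompactSupport f)
    (v : Rn d) : Integrable fun y => fderiv ℝ f y v :=
  ((hf.continuous_fderiv one_ne_zero).clm_apply continuous_const).integrable_of_hasCompactSupport
    (hc.fderiv_apply (𝕜 := ℝ) v)

lemma integral_upperHalf_fderiv_last {f : Rn d → ℝ} (hf : ContDiff ℝ 1 f)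
    (hc : HasCompactSupport f) :
    ∫ y in upperHalf d, fderiv ℝ f y (EuclideanSpace.single (Fin.last d) 1)
      = - ∫ y' : Rn' d, f (flatPoint y') := by
  rw [← integral_indicator measurableSet_upperHalf,
    integral_eq_integral_insertCoord (Fin.last d)
      ((integrable_fderiv_apply hf hc _).indicator measurableSet_upperHalf),
    integral_flatPoint, ← integral_neg]
  congr 1 with z
  rw [← (hasCompactSupport_comp_insertCoord hc _ z).integral_Ioi_deriv_eq
    (contDiff_comp_insertCoord hf _ z) 0, ← integral_indicator measurableSet_Ioi]
  congr 1 with t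
  simp only [Set.indicator, upperHalf, Set.mem_ofPred_eq, Set.mem_Ioi,
    deriv_comp_insertCoord (hf.differentiable one_ne_zero)]
  simp [insertCoord]

lemma integral_upperHalf_fderiv_of_ne_last {f : Rn d → ℝ} (hf : ContDiff ℝ 1 f)
    (hc : HasCompactSupport f) {k : Fin (d + 1)} (hk : k ≠ Fin.last d) :
    ∫ y in upperHalf d, fderiv ℝ f y (EuclideanSpace.single k 1) = 0 := by
  rw [← integral_indicator measurableSet_upperHalf, integral_eq_integral_insertCoord k
    ((integrable_fderiv_apply hf hc _).indicator measurableSet_upperHalf)]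
  refine integral_eq_zero_of_ae (.of_forall fun z => ?_)
  obtain ⟨j, hj⟩ := Fin.exists_succAbove_eq (Ne.symm hk)
  have mem_iff (t : ℝ) : insertCoord k t z ∈ upperHalf d ↔ 0 < z j := by
    simp only [upperHalf, Set.mem_ofPred_eq, insertCoord, ← hj, Fin.insertNth_apply_succAbove]
  by_cases hz : 0 < z j
  · have hf1 := contDiff_comp_insertCoord hf k z
    have hc1 := hasCompactSupport_comp_insertCoord hc k z
    simp only [Set.indicator, mem_iff, hz, if_true,
      ← deriv_comp_insertCoord (hf.differentiable one_ne_zero)]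
    exact integral_eq_zero_of_hasDerivAt_of_integrable
      (fun t => (hf1.differentiable one_ne_zero t).hasDerivAt)
      ((hf1.continuous_deriv le_rfl).integrable_of_hasCompactSupport hc1.deriv)
      (hf1.continuous.integrable_of_hasCompactSupport hc1)
  · simp [Set.indicator, mem_iff, hz]

lemma divergence_eq_sum {F : Rn d → Rn d} {y : Rn d} (hF : DifferentiableAt ℝ F y) :
    divergence F y = ∑ k, fderiv ℝ (fun x => F x k) y (EuclideanSpace.single k 1) := by
  rw [divergence, traceL_eq_sum (EuclideanSpace.basisFun (Fin (d + 1)) ℝ)]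
  refine Finset.sum_congr rfl fun k _ => ?_
  have h : HasFDerivAt (fun x => F x k) _ y :=
    (EuclideanSpace.proj (𝕜 := ℝ) k).hasFDerivAt.comp y hF.hasFDerivAt
  simp [h.fderiv, EuclideanSpace.inner_single_left]

theorem integral_upperHalf_divergence {F : Rn d → Rn d} (hF : ContDiff ℝ 1 F)
    (hc : HasCompactSupport F) :
    ∫ y in upperHalf d, divergence F y = - ∫ y' : Rn' d, F (flatPoint y') (Fin.last d) := by
  have hFk (k : Fin (d + 1)) : ContDiff ℝ 1 fun y => F y k := by fun_prop
  have hck (k : Fin (d + 1)) : HasCompactSupport fun y => F y k :=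
    hc.comp_left (g := fun v : Rn d => v k) rfl
  simp only [divergence_eq_sum (hF.differentiable one_ne_zero _)]
  rw [integral_finsetSum _ fun k _ => (integrable_fderiv_apply (hFk k) (hck k) _).integrableOn,
    Fintype.sum_eq_single (Fin.last d) fun k hk =>
      integral_upperHalf_fderiv_of_ne_last (hFk k) (hck k) hk,
    integral_upperHalf_fderiv_last (hFk _) (hck _)]

lemma integrable_divergence {F : Rn d → Rn d} (hF : ContDiff ℝ 1 F) (hc : HasCompactSupport F) :
    Integrable (divergence F) :=
  (integrable_finsetSum _ fun k _ => integrable_fderiv_apply (f := fun y => F y k) (by fun_prop)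
    (hc.comp_left (g := fun v : Rn d => v k) rfl) _).congr
    (.of_forall fun y => (divergence_eq_sum (hF.differentiable one_ne_zero y)).symm)

end halfSpace

/-- The data at one point that enter the Carleman estimate: the coefficients `A`, `b`, `c` and their
derivatives `A'`, `b'`, `c'`, the gradient `n` of a phase `ψ` with `D²ψ = -2`, the convexity
parameter `μ` and the local frequency `T`, which satisfies `∇T = μ T n`. -/
structure CarlemanJet (E : Type*) [NormedAddCommGroup E] [InnerProductSpace ℝ E] where
  A : E →L[ℝ] E
  A' : E →L[ℝ] E →L[ℝ] E
  b : E
  b' : E →L[ℝ] E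
  c : ℝ
  c' : E →L[ℝ] ℝ
  n : E
  μ : ℝ
  T : ℝ

namespace CarlemanJet

section jet

variable {E : Type*} [NormedAddCommGroup E] [InnerProductSpace ℝ E]

/-- The quadratic form `⟨A n, n⟩` on the gradient of the phase. -/
def form (J : CarlemanJet E) : ℝ := ⟪J.A J.n, J.n⟫_ℝ

/-- The drift of the operator conjugated by the weight; it is the multiplier field. -/
def field (J : CarlemanJet E) : E := (2 * J.T) • J.A J.n + J.b

/-- The part of the potential of the conjugated operator that is not of order `T ^ 2`. -/
def potLower (J : CarlemanJet E) : ℝ := J.T * ⟪J.b, J.n⟫_ℝ - J.c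

/-- The potential of the operator conjugated by the weight. -/
def pot (J : CarlemanJet E) : ℝ := J.T ^ 2 * J.form + J.potLower

/-- The zeroth order part of the multiplier. -/
def mult (J : CarlemanJet E) : ℝ := 2 * J.μ * J.T * J.form

/-- The derivative of `CarlemanJet.form`. -/
noncomputable def formDeriv (J : CarlemanJet E) : E →L[ℝ] ℝ :=
  (innerSL ℝ J.n).comp (J.A'.flip J.n) - (4 : ℝ) • innerSL ℝ (J.A J.n)

/-- The part of the derivative of `CarlemanJet.field` that carries no factor `μ`. -/
noncomputable def fieldRem (J : CarlemanJet E) : E →L[ℝ] E :=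
  (2 * J.T) • J.A'.flip J.n - (4 * J.T) • J.A + J.b'

/-- The derivative of `CarlemanJet.field`. -/
noncomputable def fieldDeriv (J : CarlemanJet E) : E →L[ℝ] E :=
  (2 * J.μ * J.T) • (innerSL ℝ J.n).smulRight (J.A J.n) + J.fieldRem

/-- The part of the derivative of `CarlemanJet.pot` that carries no factor `μ`. -/
noncomputable def potRem (J : CarlemanJet E) : E →L[ℝ] ℝ :=
  J.T ^ 2 • J.formDeriv + J.T • (innerSL ℝ J.n).comp J.b' - (2 * J.T) • innerSL ℝ J.b - J.c'

/-- The derivative of `CarlemanJet.pot`. -/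
noncomputable def potDeriv (J : CarlemanJet E) : E →L[ℝ] ℝ :=
  (2 * J.μ * J.T ^ 2 * J.form + J.μ * J.T * ⟪J.b, J.n⟫_ℝ) • innerSL ℝ J.n + J.potRem

/-- The derivative of `CarlemanJet.mult`. -/
noncomputable def multDeriv (J : CarlemanJet E) : E →L[ℝ] ℝ :=
  (2 * J.μ ^ 2 * J.T * J.form) • innerSL ℝ J.n + (2 * J.μ * J.T) • J.formDeriv

lemma formDeriv_apply (J : CarlemanJet E) (z : E) :
    J.formDeriv z = ⟪J.n, J.A'.flip J.n z⟫_ℝ - 4 * ⟪J.A J.n, z⟫_ℝ :=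
  rfl

lemma potRem_apply (J : CarlemanJet E) (z : E) :
    J.potRem z = J.T ^ 2 * J.formDeriv z + J.T * ⟪J.n, J.b' z⟫_ℝ - 2 * J.T * ⟪J.b, z⟫_ℝ - J.c' z :=
  rfl

lemma multDeriv_apply (J : CarlemanJet E) (z : E) :
    J.multDeriv z = 2 * J.μ ^ 2 * J.T * J.form * ⟪J.n, z⟫_ℝ + 2 * J.μ * J.T * J.formDeriv z :=
  rfl

/-- Ellipticity with constant `θ`, bounds on the leading coefficients by `M`, and bounds on the
lower order coefficients in terms of the local frequency `T`, which has to exceed `μ ^ 2`. -/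
structure Bounds (J : CarlemanJet E) (θ M : ℝ) : Prop where
  pos : 0 < θ
  one_le : 1 ≤ M
  one_le_μ : 1 ≤ J.μ
  sq_μ_le : J.μ ^ 2 ≤ J.T
  symm : (J.A : E →ₗ[ℝ] E).IsSymmetric
  coercive : ∀ x, θ * ‖x‖ ^ 2 ≤ ⟪J.A x, x⟫_ℝ
  norm_A_le : ‖J.A‖ ≤ M
  norm_A'_le : ‖J.A'‖ ≤ M
  two_le_norm_n : 2 ≤ ‖J.n‖
  norm_n_le : ‖J.n‖ ≤ 3
  μ_mul_norm_b_le : J.μ * ‖J.b‖ ≤ J.T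
  μ_mul_norm_b'_le : J.μ * ‖J.b'‖ ≤ J.T
  μ_mul_abs_c_le : J.μ * |J.c| ≤ J.T ^ 2
  μ_mul_norm_c'_le : J.μ * ‖J.c'‖ ≤ J.T ^ 2

end jet

section trace

variable {E : Type*} [NormedAddCommGroup E] [InnerProductSpace ℝ E] [FiniteDimensional ℝ E]

lemma traceL_fieldDeriv (J : CarlemanJet E) :
    traceL J.fieldDeriv = 2 * J.μ * J.T * J.form + traceL J.fieldRem := by
  rw [fieldDeriv, map_add, map_smul, traceL_smulRight, innerSL_apply_apply, smul_eq_mul,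
    real_inner_comm, form]

/-- The conjugated equation at one point: `g` is the value of the operator, conjugated by the
weight, on a function with value `w`, gradient `p` and Hessian `H`. -/
def Conjugated (J : CarlemanJet E) (w : ℝ) (p : E) (H : E →L[ℝ] E) (g : ℝ) : Prop :=
  traceL (J.A.comp H) = ⟪J.field, p⟫_ℝ - J.pot * w
    + (J.μ * J.T * J.form - 2 * J.T * traceL J.A) * w - g

end trace

namespace Bounds

section firstOrder

variable {E : Type*} [NormedAddCommGroup E] [InnerProductSpace ℝ E] {J : CarlemanJet E} {θ M : ℝ}

lemma μ_pos (h : J.Bounds θ M) : 0 < J.μ := one_pos.trans_le h.one_le_μ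

lemma one_le_T (h : J.Bounds θ M) : 1 ≤ J.T := (one_le_pow₀ h.one_le_μ).trans h.sq_μ_le

lemma T_pos (h : J.Bounds θ M) : 0 < J.T := one_pos.trans_le h.one_le_T

lemma μ_le_T (h : J.Bounds θ M) : J.μ ≤ J.T :=
  (le_self_pow₀ h.one_le_μ two_ne_zero).trans h.sq_μ_le

lemma M_pos (h : J.Bounds θ M) : 0 < M := one_pos.trans_le h.one_le

lemma T_le (h : J.Bounds θ M) : J.T ≤ M * J.T := le_mul_of_one_le_left h.T_pos.le h.one_le

lemma norm_b_le (h : J.Bounds θ M) : ‖J.b‖ ≤ J.T :=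
  (le_mul_of_one_le_left (norm_nonneg _) h.one_le_μ).trans h.μ_mul_norm_b_le

lemma norm_b'_le (h : J.Bounds θ M) : ‖J.b'‖ ≤ J.T :=
  (le_mul_of_one_le_left (norm_nonneg _) h.one_le_μ).trans h.μ_mul_norm_b'_le

lemma norm_c'_le (h : J.Bounds θ M) : ‖J.c'‖ ≤ J.T ^ 2 :=
  (le_mul_of_one_le_left (norm_nonneg _) h.one_le_μ).trans h.μ_mul_norm_c'_le

lemma norm_A_apply_le (h : J.Bounds θ M) (x : E) : ‖J.A x‖ ≤ M * ‖x‖ :=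
  J.A.le_of_opNorm_le h.norm_A_le x

lemma norm_A_n_le (h : J.Bounds θ M) : ‖J.A J.n‖ ≤ 3 * M := by
  have := h.M_pos
  calc ‖J.A J.n‖ ≤ M * ‖J.n‖ := h.norm_A_apply_le _
    _ ≤ M * 3 := by gcongr; exact h.norm_n_le
    _ = 3 * M := mul_comm _ _

lemma norm_A'_flip_le (h : J.Bounds θ M) (x : E) : ‖J.A'.flip x‖ ≤ M * ‖x‖ :=
  J.A'.flip.le_of_opNorm_le (J.A'.opNorm_flip.trans_le h.norm_A'_le) x

lemma abs_inner_A_self_le (h : J.Bounds θ M) (x : E) : |⟪J.A x, x⟫_ℝ| ≤ M * ‖x‖ ^ 2 :=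
  calc |⟪J.A x, x⟫_ℝ| ≤ ‖J.A‖ * ‖x‖ * ‖x‖ := abs_inner_apply_le _ _ _
    _ ≤ M * ‖x‖ * ‖x‖ := by gcongr; exact h.norm_A_le
    _ = M * ‖x‖ ^ 2 := by ring

lemma le_form (h : J.Bounds θ M) : 4 * θ ≤ J.form := by
  have := h.pos
  calc 4 * θ = θ * 2 ^ 2 := by ring
    _ ≤ θ * ‖J.n‖ ^ 2 := by gcongr; exact h.two_le_norm_n
    _ ≤ J.form := h.coercive _

lemma form_pos (h : J.Bounds θ M) : 0 < J.form := by linarith [h.le_form, h.pos]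

lemma form_le (h : J.Bounds θ M) : J.form ≤ 9 * M := by
  have := h.M_pos
  calc J.form ≤ M * ‖J.n‖ ^ 2 := (le_abs_self _).trans (h.abs_inner_A_self_le _)
    _ ≤ M * 3 ^ 2 := by gcongr; exact h.norm_n_le
    _ = 9 * M := by ring

lemma abs_inner_b_n_le (h : J.Bounds θ M) : |⟪J.b, J.n⟫_ℝ| ≤ 3 * ‖J.b‖ :=
  calc |⟪J.b, J.n⟫_ℝ| ≤ ‖J.b‖ * ‖J.n‖ := abs_real_inner_le_norm _ _
    _ ≤ ‖J.b‖ * 3 := by gcongr; exact h.norm_n_le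
    _ = 3 * ‖J.b‖ := mul_comm _ _

lemma abs_μ_mul_inner_b_n_le (h : J.Bounds θ M) : |J.μ * ⟪J.b, J.n⟫_ℝ| ≤ 3 * J.T := by
  have := h.μ_pos
  rw [abs_mul, abs_of_pos h.μ_pos]
  calc J.μ * |⟪J.b, J.n⟫_ℝ| ≤ J.μ * (3 * ‖J.b‖) := by gcongr; exact h.abs_inner_b_n_le
    _ ≤ 3 * J.T := by linarith [h.μ_mul_norm_b_le]

lemma norm_field_le (h : J.Bounds θ M) : ‖J.field‖ ≤ 7 * M * J.T := by
  have := h.T_pos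
  calc ‖J.field‖ ≤ 2 * J.T * ‖J.A J.n‖ + ‖J.b‖ := by
        refine (norm_add_le _ _).trans_eq ?_
        rw [norm_smul, Real.norm_of_nonneg (by positivity)]
    _ ≤ 2 * J.T * (3 * M) + M * J.T := by
        gcongr
        exacts [h.norm_A_n_le, h.norm_b_le.trans h.T_le]
    _ = 7 * M * J.T := by ring

lemma μ_mul_abs_potLower_le (h : J.Bounds θ M) : J.μ * |J.potLower| ≤ 4 * J.T ^ 2 := by
  have := h.μ_pos
  have := h.T_pos
  calc J.μ * |J.potLower| ≤ J.μ * (J.T * |⟪J.b, J.n⟫_ℝ| + |J.c|) := by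
        gcongr
        refine (abs_sub _ _).trans_eq ?_
        rw [abs_mul, abs_of_pos h.T_pos]
    _ = J.T * |J.μ * ⟪J.b, J.n⟫_ℝ| + J.μ * |J.c| := by
        rw [abs_mul, abs_of_pos h.μ_pos]
        ring
    _ ≤ J.T * (3 * J.T) + J.T ^ 2 := by
        gcongr
        exacts [h.abs_μ_mul_inner_b_n_le, h.μ_mul_abs_c_le]
    _ = 4 * J.T ^ 2 := by ring

lemma abs_pot_le (h : J.Bounds θ M) : |J.pot| ≤ 13 * M * J.T ^ 2 := by
  have hlow : |J.potLower| ≤ 4 * J.T ^ 2 :=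
    (le_mul_of_one_le_left (abs_nonneg _) h.one_le_μ).trans h.μ_mul_abs_potLower_le
  have hM : 4 * J.T ^ 2 ≤ 4 * M * J.T ^ 2 := by gcongr; linarith [h.one_le]
  calc |J.pot| ≤ J.T ^ 2 * J.form + |J.potLower| := by
        refine (abs_add_le _ _).trans_eq ?_
        rw [abs_of_nonneg (mul_nonneg (sq_nonneg _) h.form_pos.le)]
    _ ≤ J.T ^ 2 * (9 * M) + 4 * M * J.T ^ 2 := by
        gcongr
        exacts [h.form_le, hlow.trans hM]
    _ = 13 * M * J.T ^ 2 := by ring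

lemma mult_nonneg (h : J.Bounds θ M) : 0 ≤ J.mult :=
  mul_nonneg (mul_nonneg (mul_nonneg zero_le_two h.μ_pos.le) h.T_pos.le) h.form_pos.le

lemma mult_le (h : J.Bounds θ M) : J.mult ≤ 18 * M * J.μ * J.T := by
  have := h.μ_pos
  have := h.T_pos
  calc J.mult ≤ 2 * J.μ * J.T * (9 * M) := by unfold mult; gcongr; exact h.form_le
    _ = 18 * M * J.μ * J.T := by ring

lemma sq_mult_le (h : J.Bounds θ M) : J.mult ^ 2 ≤ 324 * M ^ 2 * J.T ^ 3 := by
  have := h.T_pos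
  calc J.mult ^ 2 ≤ (18 * M * J.μ * J.T) ^ 2 := pow_le_pow_left₀ h.mult_nonneg h.mult_le 2
    _ = 324 * M ^ 2 * J.T ^ 2 * J.μ ^ 2 := by ring
    _ ≤ 324 * M ^ 2 * J.T ^ 2 * J.T := by gcongr; exact h.sq_μ_le
    _ = 324 * M ^ 2 * J.T ^ 3 := by ring

lemma abs_formDeriv_le (h : J.Bounds θ M) (z : E) : |J.formDeriv z| ≤ 21 * M * ‖z‖ := by
  have := h.M_pos
  calc |J.formDeriv z| ≤ |⟪J.n, J.A'.flip J.n z⟫_ℝ| + 4 * |⟪J.A J.n, z⟫_ℝ| := by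
        rw [formDeriv_apply]
        refine (abs_sub _ _).trans_eq ?_
        rw [abs_mul 4, abs_of_pos (four_pos : (0 : ℝ) < 4)]
    _ ≤ 3 * (M * 3 * ‖z‖) + 4 * (3 * M * ‖z‖) := by
        gcongr
        · refine (abs_real_inner_le_norm _ _).trans ?_
          gcongr
          · exact h.norm_n_le
          · refine ContinuousLinearMap.le_of_opNorm_le _ ((h.norm_A'_flip_le _).trans ?_) z
            gcongr
            exact h.norm_n_le
        · exact (abs_real_inner_le_norm _ _).trans (by gcongr; exact h.norm_A_n_le)
    _ = 21 * M * ‖z‖ := by ring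

lemma norm_fieldRem_le (h : J.Bounds θ M) : ‖J.fieldRem‖ ≤ 11 * M * J.T := by
  have := h.T_pos
  have := h.M_pos
  calc ‖J.fieldRem‖ ≤ 2 * J.T * ‖J.A'.flip J.n‖ + 4 * J.T * ‖J.A‖ + ‖J.b'‖ := by
        refine (norm_add_le _ _).trans (add_le_add_left ((norm_sub_le _ _).trans_eq ?_) _)
        rw [norm_smul, norm_smul, Real.norm_of_nonneg (by positivity),
          Real.norm_of_nonneg (by positivity)]
    _ ≤ 2 * J.T * (M * 3) + 4 * J.T * M + M * J.T := by
        gcongr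
        · exact (h.norm_A'_flip_le _).trans (by gcongr; exact h.norm_n_le)
        · exact h.norm_A_le
        · exact h.norm_b'_le.trans h.T_le
    _ = 11 * M * J.T := by ring

lemma abs_potRem_le (h : J.Bounds θ M) (z : E) : |J.potRem z| ≤ 27 * M * J.T ^ 2 * ‖z‖ := by
  have := h.T_pos
  have hM : J.T ^ 2 ≤ M * J.T ^ 2 := le_mul_of_one_le_left (by positivity) h.one_le
  calc |J.potRem z| ≤ J.T ^ 2 * |J.formDeriv z| + J.T * |⟪J.n, J.b' z⟫_ℝ|
        + 2 * J.T * |⟪J.b, z⟫_ℝ| + |J.c' z| := by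
        rw [potRem_apply]
        refine (abs_sub _ _).trans (add_le_add_left ((abs_sub _ _).trans
          (add_le_add ((abs_add_le _ _).trans (add_le_add ?_ ?_)) ?_)) _)
        all_goals rw [abs_mul, abs_of_pos (by positivity)]
    _ ≤ J.T ^ 2 * (21 * M * ‖z‖) + J.T * (3 * (J.T * ‖z‖)) + 2 * J.T * (J.T * ‖z‖)
        + J.T ^ 2 * ‖z‖ := by
        gcongr
        · exact h.abs_formDeriv_le z
        · refine (abs_real_inner_le_norm _ _).trans ?_
          gcongr
          exacts [h.norm_n_le, J.b'.le_of_opNorm_le h.norm_b'_le z]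
        · exact (abs_real_inner_le_norm _ _).trans (by gcongr; exact h.norm_b_le)
        · exact J.c'.le_of_opNorm_le h.norm_c'_le z
    _ = (21 * M * J.T ^ 2 + 6 * J.T ^ 2) * ‖z‖ := by ring
    _ ≤ (21 * M * J.T ^ 2 + 6 * (M * J.T ^ 2)) * ‖z‖ := by gcongr
    _ = 27 * M * J.T ^ 2 * ‖z‖ := by ring

lemma le_potDeriv_field (h : J.Bounds θ M) :
    4 * J.μ * J.T ^ 3 * J.form ^ 2 - 306 * M ^ 2 * J.T ^ 3 ≤ J.potDeriv J.field := by
  have := h.T_pos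
  have := h.M_pos
  have hnX : ⟪J.n, J.field⟫_ℝ = 2 * J.T * J.form + ⟪J.b, J.n⟫_ℝ := by
    rw [field, inner_add_right, inner_smul_right, form, real_inner_comm J.n (J.A J.n),
      real_inner_comm J.b J.n]
  have hexpand : J.potDeriv J.field = 4 * J.μ * J.T ^ 3 * J.form ^ 2
      + (4 * J.T ^ 2 * J.form * (J.μ * ⟪J.b, J.n⟫_ℝ)
        + J.T * ⟪J.b, J.n⟫_ℝ * (J.μ * ⟪J.b, J.n⟫_ℝ) + J.potRem J.field) := by
    simp only [potDeriv, add_apply, smul_apply, innerSL_apply_apply, hnX, smul_eq_mul]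
    ring
  have hcross : |4 * J.T ^ 2 * J.form * (J.μ * ⟪J.b, J.n⟫_ℝ)|
      ≤ 4 * J.T ^ 2 * (9 * M) * (3 * J.T) := by
    have := h.form_pos
    rw [abs_mul, abs_of_pos (show 0 < 4 * J.T ^ 2 * J.form by positivity)]
    gcongr
    exacts [h.form_le, h.abs_μ_mul_inner_b_n_le]
  have hdrift : |J.T * ⟪J.b, J.n⟫_ℝ * (J.μ * ⟪J.b, J.n⟫_ℝ)| ≤ J.T * (3 * J.T) * (3 * J.T) := by
    rw [abs_mul, abs_mul, abs_of_pos h.T_pos]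
    gcongr
    · linarith [h.abs_inner_b_n_le, h.norm_b_le]
    · exact h.abs_μ_mul_inner_b_n_le
  have hrem : |J.potRem J.field| ≤ 27 * M * J.T ^ 2 * (7 * M * J.T) :=
    (h.abs_potRem_le _).trans (by gcongr; exact h.norm_field_le)
  have hM1 : M * J.T ^ 3 ≤ M ^ 2 * J.T ^ 3 := by
    gcongr
    exact le_self_pow₀ h.one_le two_ne_zero
  have hM2 : J.T ^ 3 ≤ M ^ 2 * J.T ^ 3 :=
    le_mul_of_one_le_left (by positivity) (one_le_pow₀ h.one_le)
  rw [hexpand]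
  linarith [neg_le_of_abs_le hcross, neg_le_of_abs_le hdrift, neg_le_of_abs_le hrem]

lemma le_multDeriv_term (h : J.Bounds θ M) (p : E) (w : ℝ) :
    -(96 * M ^ 2 * (J.T * ‖p‖ ^ 2 + J.T ^ 3 * w ^ 2)) ≤ 2 * w * J.multDeriv (J.A p) := by
  have := h.T_pos
  have := h.M_pos
  have := h.μ_pos
  have hform := h.form_pos
  have hmult : |J.multDeriv (J.A p)| ≤ 96 * M ^ 2 * J.μ ^ 2 * J.T * ‖p‖ := by
    calc |J.multDeriv (J.A p)| ≤ 2 * J.μ ^ 2 * J.T * J.form * |⟪J.n, J.A p⟫_ℝ|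
          + 2 * J.μ * J.T * |J.formDeriv (J.A p)| := by
          rw [multDeriv_apply]
          refine (abs_add_le _ _).trans (add_le_add ?_ ?_)
          all_goals rw [abs_mul, abs_of_pos (by positivity)]
      _ ≤ 2 * J.μ ^ 2 * J.T * (9 * M) * (3 * (M * ‖p‖))
          + 2 * J.μ ^ 2 * J.T * (21 * M * (M * ‖p‖)) := by
          gcongr
          · exact h.form_le
          · refine (abs_real_inner_le_norm _ _).trans ?_
            gcongr
            exacts [h.norm_n_le, h.norm_A_apply_le p]
          · exact le_self_pow₀ h.one_le_μ two_ne_zero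
          · exact (h.abs_formDeriv_le _).trans (by gcongr; exact h.norm_A_apply_le p)
      _ = 96 * M ^ 2 * J.μ ^ 2 * J.T * ‖p‖ := by ring
  have hprod : |w * J.multDeriv (J.A p)| ≤ |w| * (96 * M ^ 2 * J.μ ^ 2 * J.T * ‖p‖) := by
    rw [abs_mul]
    gcongr
  have hμT : (J.μ ^ 2 * |w|) ^ 2 ≤ J.T ^ 2 * w ^ 2 := by
    rw [mul_pow, sq_abs]
    gcongr
    exact h.sq_μ_le
  have hyoung : 96 * M ^ 2 * J.T * (2 * (J.μ ^ 2 * |w|) * ‖p‖)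
      ≤ 96 * M ^ 2 * J.T * (J.T ^ 2 * w ^ 2 + ‖p‖ ^ 2) := by
    gcongr
    exact (two_mul_le_add_sq _ _).trans (add_le_add_left hμT _)
  linarith [neg_le_of_abs_le hprod]

lemma norm_flux_le (h : J.Bounds θ M) (p : E) (w : ℝ) :
    ‖(2 * ⟪J.field, p⟫_ℝ + 2 * (J.mult * w)) • J.A p + (J.pot * w ^ 2 - ⟪J.A p, p⟫_ℝ) • J.field‖
      ≤ 109 * M ^ 2 * (J.T * ‖p‖ ^ 2 + J.T ^ 3 * w ^ 2) := by
  have := h.T_pos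
  have := h.M_pos
  have := h.μ_pos
  have hfirst : |2 * ⟪J.field, p⟫_ℝ + 2 * (J.mult * w)|
      ≤ 2 * (7 * M * J.T * ‖p‖) + 2 * (18 * M * J.μ * J.T * |w|) := by
    refine (abs_add_le _ _).trans ?_
    rw [abs_mul, abs_mul 2, abs_mul J.mult, abs_two, abs_of_nonneg h.mult_nonneg]
    gcongr
    · exact (abs_real_inner_le_norm _ _).trans (by gcongr; exact h.norm_field_le)
    · exact h.mult_le
  have hsecond : |J.pot * w ^ 2 - ⟪J.A p, p⟫_ℝ| ≤ 13 * M * J.T ^ 2 * w ^ 2 + M * ‖p‖ ^ 2 := by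
    refine (abs_sub _ _).trans ?_
    rw [abs_mul, abs_of_nonneg (sq_nonneg w)]
    gcongr
    exacts [h.abs_pot_le, h.abs_inner_A_self_le p]
  have hyoung : 2 * (J.μ * |w| * ‖p‖) ≤ J.T ^ 2 * w ^ 2 + ‖p‖ ^ 2 :=
    calc 2 * (J.μ * |w| * ‖p‖) ≤ (J.μ * |w|) ^ 2 + ‖p‖ ^ 2 := by
          linarith [two_mul_le_add_sq (J.μ * |w|) ‖p‖]
      _ ≤ J.T ^ 2 * w ^ 2 + ‖p‖ ^ 2 := by
          rw [mul_pow, sq_abs]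
          gcongr
          exact h.μ_le_T
  calc _ ≤ (2 * (7 * M * J.T * ‖p‖) + 2 * (18 * M * J.μ * J.T * |w|)) * (M * ‖p‖)
        + (13 * M * J.T ^ 2 * w ^ 2 + M * ‖p‖ ^ 2) * (7 * M * J.T) := by
        refine (norm_add_le _ _).trans ?_
        rw [norm_smul, norm_smul, Real.norm_eq_abs, Real.norm_eq_abs]
        gcongr
        exacts [h.norm_A_apply_le p, h.norm_field_le]
    _ = M ^ 2 * J.T * (21 * ‖p‖ ^ 2 + 91 * (J.T ^ 2 * w ^ 2) + 18 * (2 * (J.μ * |w| * ‖p‖))) := by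
        ring
    _ ≤ M ^ 2 * J.T * (21 * ‖p‖ ^ 2 + 91 * (J.T ^ 2 * w ^ 2)
        + 18 * (J.T ^ 2 * w ^ 2 + ‖p‖ ^ 2)) := by gcongr
    _ ≤ M ^ 2 * J.T * (109 * (‖p‖ ^ 2 + J.T ^ 2 * w ^ 2)) := by
        gcongr
        linarith [sq_nonneg ‖p‖]
    _ = 109 * M ^ 2 * (J.T * ‖p‖ ^ 2 + J.T ^ 3 * w ^ 2) := by ring

end firstOrder

section secondOrder

variable {E : Type*} [NormedAddCommGroup E] [InnerProductSpace ℝ E] [FiniteDimensional ℝ E]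
  {J : CarlemanJet E} {θ M : ℝ}

local notation "N" => (Module.finrank ℝ E : ℝ)

lemma one_le_finrank (h : J.Bounds θ M) : 1 ≤ N := by
  have : Nontrivial E := ⟨J.n, 0, norm_pos_iff.1 (two_pos.trans_le h.two_le_norm_n)⟩
  exact_mod_cast Module.finrank_pos (R := ℝ) (M := E)

lemma abs_traceL_fieldRem_le (h : J.Bounds θ M) :
    |traceL J.fieldRem| ≤ 11 * N * M * J.T :=
  calc |traceL J.fieldRem| ≤ N * ‖J.fieldRem‖ := abs_traceL_le _
    _ ≤ N * (11 * M * J.T) := by gcongr; exact h.norm_fieldRem_le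
    _ = 11 * N * M * J.T := by ring

lemma le_gradient_terms (h : J.Bounds θ M) (p : E) :
    8 * θ ^ 2 * J.μ * J.T * ‖p‖ ^ 2 - 40 * N * M ^ 2 * J.T * ‖p‖ ^ 2
      ≤ 2 * ⟪J.fieldDeriv (J.A p), p⟫_ℝ
        + (2 * J.mult - traceL J.fieldDeriv) * ⟪J.A p, p⟫_ℝ - ⟪J.A' J.field p, p⟫_ℝ := by
  have := h.T_pos
  have := h.M_pos
  have := h.μ_pos
  have := h.pos
  have hN := h.one_le_finrank
  have hrank : ⟪J.fieldDeriv (J.A p), p⟫_ℝ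
      = 2 * J.μ * J.T * ⟪J.A J.n, p⟫_ℝ ^ 2 + ⟪J.fieldRem (J.A p), p⟫_ℝ := by
    simp only [fieldDeriv, add_apply, smul_apply, ContinuousLinearMap.smulRight_apply,
      innerSL_apply_apply, inner_add_left, real_inner_smul_left, ← h.symm.apply_clm J.n p]
    ring
  have hmain : 2 * J.μ * J.T * (4 * θ * (θ * ‖p‖ ^ 2))
      ≤ 2 * J.μ * J.T * (J.form * ⟪J.A p, p⟫_ℝ) := by
    gcongr
    exacts [h.form_pos.le, h.le_form, h.coercive p]
  have hsq : 0 ≤ 4 * J.μ * J.T * ⟪J.A J.n, p⟫_ℝ ^ 2 := by positivity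
  have hrem : |⟪J.fieldRem (J.A p), p⟫_ℝ| ≤ 11 * M * J.T * (M * ‖p‖) * ‖p‖ :=
    (abs_inner_apply_le _ _ _).trans
      (by gcongr; exacts [h.norm_fieldRem_le, h.norm_A_apply_le p])
  have htr : |traceL J.fieldRem * ⟪J.A p, p⟫_ℝ| ≤ 11 * N * M * J.T * (M * ‖p‖ ^ 2) := by
    rw [abs_mul]
    gcongr
    exacts [h.abs_traceL_fieldRem_le, h.abs_inner_A_self_le p]
  have hA' : |⟪J.A' J.field p, p⟫_ℝ| ≤ M * (7 * M * J.T) * ‖p‖ * ‖p‖ := by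
    refine (abs_inner_apply_le _ _ _).trans ?_
    gcongr
    refine (J.A'.le_of_opNorm_le h.norm_A'_le _).trans ?_
    gcongr
    exact h.norm_field_le
  have hN' : 1 * (29 * M ^ 2 * J.T * ‖p‖ ^ 2) ≤ N * (29 * M ^ 2 * J.T * ‖p‖ ^ 2) := by gcongr
  rw [hrank, traceL_fieldDeriv, mult]
  linarith [neg_le_of_abs_le hrem, le_of_abs_le htr, le_of_abs_le hA']

lemma le_zeroth_order_terms (h : J.Bounds θ M) :
    32 * θ ^ 2 * J.μ * J.T ^ 3 - 521 * N * M ^ 2 * J.T ^ 3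
      ≤ J.potDeriv J.field + (traceL J.fieldDeriv - 2 * J.mult) * J.pot := by
  have := h.T_pos
  have := h.M_pos
  have := h.μ_pos
  have := h.pos
  have hform := h.form_pos
  have hN := h.one_le_finrank
  have hexpand : (traceL J.fieldDeriv - 2 * J.mult) * J.pot
      = -(2 * J.μ * J.T ^ 3 * J.form ^ 2) - 2 * J.T * J.form * (J.μ * J.potLower)
        + traceL J.fieldRem * J.pot := by
    rw [traceL_fieldDeriv, mult, pot]
    ring
  have hmain : 2 * J.μ * J.T ^ 3 * (4 * θ) ^ 2 ≤ 2 * J.μ * J.T ^ 3 * J.form ^ 2 := by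
    gcongr
    exact h.le_form
  have hlow : |2 * J.T * J.form * (J.μ * J.potLower)| ≤ 2 * J.T * (9 * M) * (4 * J.T ^ 2) := by
    rw [abs_mul, abs_of_pos (by positivity : 0 < 2 * J.T * J.form), abs_mul, abs_of_pos h.μ_pos]
    gcongr 2 * J.T * ?_ * ?_
    exacts [h.form_le, h.μ_mul_abs_potLower_le]
  have htr : |traceL J.fieldRem * J.pot| ≤ 11 * N * M * J.T * (13 * M * J.T ^ 2) := by
    rw [abs_mul]
    gcongr
    exacts [h.abs_traceL_fieldRem_le, h.abs_pot_le]
  have hM : M * J.T ^ 3 ≤ M ^ 2 * J.T ^ 3 := by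
    gcongr
    exact le_self_pow₀ h.one_le two_ne_zero
  have hN' : 1 * (378 * M ^ 2 * J.T ^ 3) ≤ N * (378 * M ^ 2 * J.T ^ 3) := by gcongr
  rw [hexpand]
  linarith [h.le_potDeriv_field, le_of_abs_le hlow, neg_le_of_abs_le htr]

lemma sq_conjugationError_le (h : J.Bounds θ M) :
    (J.μ * J.T * J.form - 2 * J.T * traceL J.A) ^ 2 ≤ 121 * N ^ 2 * M ^ 2 * J.T ^ 3 := by
  have := h.T_pos
  have := h.M_pos
  have := h.μ_pos
  have hform := h.form_pos
  have htrA : |traceL J.A| ≤ N * M :=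
    (abs_traceL_le _).trans (by gcongr; exact h.norm_A_le)
  have habs : |J.μ * J.T * J.form - 2 * J.T * traceL J.A| ≤ 11 * N * M * J.μ * J.T := by
    calc |J.μ * J.T * J.form - 2 * J.T * traceL J.A|
        ≤ J.μ * J.T * J.form + 2 * J.T * |traceL J.A| := by
          refine (abs_sub _ _).trans_eq ?_
          rw [abs_of_pos (by positivity), abs_mul, abs_of_pos (by positivity)]
      _ ≤ J.μ * J.T * (9 * M) + 2 * J.T * (N * M) := by gcongr; exact h.form_le
      _ ≤ N * (J.μ * J.T * (9 * M)) + 2 * J.T * (N * M) * J.μ :=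
          add_le_add (le_mul_of_one_le_left (by positivity) h.one_le_finrank)
            (le_mul_of_one_le_right (by positivity) h.one_le_μ)
      _ = 11 * N * M * J.μ * J.T := by ring
  calc (J.μ * J.T * J.form - 2 * J.T * traceL J.A) ^ 2
      ≤ (11 * N * M * J.μ * J.T) ^ 2 := by
        rw [← sq_abs]
        gcongr
    _ = 121 * N ^ 2 * M ^ 2 * J.T ^ 2 * J.μ ^ 2 := by ring
    _ ≤ 121 * N ^ 2 * M ^ 2 * J.T ^ 2 * J.T := by gcongr; exact h.sq_μ_le
    _ = 121 * N ^ 2 * M ^ 2 * J.T ^ 3 := by ring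

lemma sq_traceL_flip_le (h : J.Bounds θ M) (p : E) :
    traceL (J.A'.flip p) ^ 2 ≤ N ^ 2 * M ^ 2 * J.T * ‖p‖ ^ 2 :=
  calc traceL (J.A'.flip p) ^ 2 ≤ (N * (M * ‖p‖)) ^ 2 := by
        rw [← sq_abs]
        gcongr
        exact (abs_traceL_le _).trans (by gcongr; exact h.norm_A'_flip_le p)
    _ = N ^ 2 * M ^ 2 * 1 * ‖p‖ ^ 2 := by ring
    _ ≤ N ^ 2 * M ^ 2 * J.T * ‖p‖ ^ 2 := by gcongr; exact h.one_le_T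

lemma le_equation_terms (h : J.Bounds θ M) {w g : ℝ} {p : E} {H : E →L[ℝ] E}
    (heq : J.Conjugated w p H g) :
    -(6 * g ^ 2) - 726 * N ^ 2 * M ^ 2 * J.T ^ 3 * w ^ 2 - 6 * N ^ 2 * M ^ 2 * J.T * ‖p‖ ^ 2
        - 648 * M ^ 2 * J.T ^ 3 * w ^ 2
      ≤ 2 * (⟪J.field, p⟫_ℝ + J.mult * w)
        * (traceL (J.A.comp H) + traceL (J.A'.flip p) + J.pot * w) := by
  set k := J.μ * J.T * J.form - 2 * J.T * traceL J.A with hk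
  set l := traceL (J.A'.flip p)
  have hsplit : traceL (J.A.comp H) + l + J.pot * w = ⟪J.field, p⟫_ℝ - (g - k * w - l) := by
    rw [heq, ← hk]
    ring
  have herror : (g - k * w - l) ^ 2 ≤ 3 * (g ^ 2 + k ^ 2 * w ^ 2 + l ^ 2) := by
    linarith [sq_nonneg (g + k * w), sq_nonneg (g + l), sq_nonneg (k * w - l)]
  have hproduct (s r f : ℝ) : -2 * f ^ 2 - 2 * r ^ 2 ≤ 2 * (s + r) * (s - f) := by
    linarith [sq_nonneg (s - f), sq_nonneg (s + r), sq_nonneg (f - r)]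
  have hkw : k ^ 2 * w ^ 2 ≤ 121 * N ^ 2 * M ^ 2 * J.T ^ 3 * w ^ 2 := by
    gcongr
    exact h.sq_conjugationError_le
  have hmult : (J.mult * w) ^ 2 ≤ 324 * M ^ 2 * J.T ^ 3 * w ^ 2 := by
    rw [mul_pow]
    gcongr
    exact h.sq_mult_le
  rw [hsplit]
  linarith [hproduct ⟪J.field, p⟫_ℝ (J.mult * w) (g - k * w - l), h.sq_traceL_flip_le p]

theorem le_divergence_terms (h : J.Bounds θ M) (hμ : 2000 * N ^ 2 * M ^ 2 ≤ θ ^ 2 * J.μ)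
    {w g : ℝ} {p : E} {H : E →L[ℝ] E} (heq : J.Conjugated w p H g) :
    θ ^ 2 * J.μ * (J.T * ‖p‖ ^ 2 + J.T ^ 3 * w ^ 2) - 6 * g ^ 2
      ≤ 2 * (⟪J.field, p⟫_ℝ + J.mult * w)
          * (traceL (J.A.comp H) + traceL (J.A'.flip p) + J.pot * w)
        + (2 * ⟪J.fieldDeriv (J.A p), p⟫_ℝ
          + (2 * J.mult - traceL J.fieldDeriv) * ⟪J.A p, p⟫_ℝ - ⟪J.A' J.field p, p⟫_ℝ)
        + (J.potDeriv J.field + (traceL J.fieldDeriv - 2 * J.mult) * J.pot) * w ^ 2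
        + 2 * w * J.multDeriv (J.A p) := by
  have := h.T_pos
  have hzeroth := mul_le_mul_of_nonneg_right h.le_zeroth_order_terms (sq_nonneg w)
  have hN : N ≤ N ^ 2 := le_self_pow₀ h.one_le_finrank two_ne_zero
  have hN2 : 1 ≤ N ^ 2 := one_le_pow₀ h.one_le_finrank
  have habsorb (t : ℝ) (ht : 0 ≤ t) : 0 ≤ t * (θ ^ 2 * J.μ - 2000 * N ^ 2 * M ^ 2)
      ∧ N * (M ^ 2 * t) ≤ N ^ 2 * (M ^ 2 * t) ∧ M ^ 2 * t ≤ N ^ 2 * (M ^ 2 * t)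
      ∧ 0 ≤ N ^ 2 * (M ^ 2 * t) :=
    ⟨mul_nonneg ht (sub_nonneg.2 hμ), by gcongr, le_mul_of_one_le_left (by positivity) hN2,
      by positivity⟩
  obtain ⟨_, _, _, _⟩ := habsorb (J.T * ‖p‖ ^ 2) (by positivity)
  obtain ⟨_, _, _, _⟩ := habsorb (J.T ^ 3 * w ^ 2) (by positivity)
  linarith [h.le_equation_terms heq, h.le_gradient_terms p, h.le_multDeriv_term p w]

end secondOrder
end Bounds
end CarlemanJet

section support

variable {E : Type*} [NormedAddCommGroup E] [InnerProductSpace ℝ E]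

lemma gradient_eq_zero_of_notMem_tsupport [CompleteSpace E] {u : E → ℝ} {y : E}
    (hy : y ∉ tsupport u) : ∇ u y = 0 := by
  rw [(notMem_tsupport_iff_eventuallyEq.1 hy).gradient_eq]
  exact gradient_fun_const y 0

lemma hess_eq_zero_of_notMem_tsupport [CompleteSpace E] {u : E → ℝ} {y : E}
    (hy : y ∉ tsupport u) : hess u y = 0 := by
  have h : ∇ u =ᶠ[nhds y] fun _ => 0 := by
    filter_upwards [(isClosed_tsupport u).isOpen_compl.mem_nhds hy] with z hz
    exact gradient_eq_zero_of_notMem_tsupport hz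
  rw [hess, h.fderiv_eq, fderiv_fun_const, Pi.zero_apply]

variable [FiniteDimensional ℝ E] {A : E → E →L[ℝ] E} {b : E → E} {c u : E → ℝ}

lemma divergence_eq_zero_of_notMem_tsupport {F : E → E} {y : E} (hy : y ∉ tsupport F) :
    divergence F y = 0 := by
  rw [divergence, (notMem_tsupport_iff_eventuallyEq.1 hy).fderiv_eq]
  simp

lemma nondivOp_eq_zero_of_notMem_tsupport {y : E} (hy : y ∉ tsupport u) :
    nondivOp A b c u y = 0 := by
  simp [nondivOp, hess_eq_zero_of_notMem_tsupport hy, gradient_eq_zero_of_notMem_tsupport hy,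
    image_eq_zero_of_notMem_tsupport hy]

lemma continuous_nondivOp (hA : Continuous A) (hb : Continuous b) (hc : Continuous c)
    (hu : ContDiff ℝ 2 u) : Continuous (nondivOp A b c u) := by
  have hgrad : ContDiff ℝ 1 (∇ u) := contDiff_gradient hu (by norm_num)
  have hhess : Continuous (hess u) := hgrad.continuous_fderiv one_ne_zero
  exact ((traceL.continuous.comp (hA.clm_comp hhess)).neg.add
    (hb.inner hgrad.continuous)).add (hc.mul hu.continuous)

end support

section weight

variable {d : ℕ}

/-- The phase `-(|y|² + 2 y_n)` of the Carleman weight. It vanishes at the origin, which is its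
maximum over the closed half space, and its superlevel sets cut off small caps around the origin. -/
noncomputable def phase (y : Rn d) : ℝ := -(‖y‖ ^ 2 + 2 * ⟪eN d, y⟫_ℝ)

/-- The gradient of the phase. -/
noncomputable def phaseGrad (y : Rn d) : Rn d := (-2 : ℝ) • (y + eN d)

/-- The local frequency `τ μ e^{μψ}` of the Carleman weight, where `ψ` is the phase. -/
noncomputable def freq (μ τ : ℝ) (y : Rn d) : ℝ := τ * μ * Real.exp (μ * phase y)

/-- The Carleman weight `exp (τ e^{μψ})`, where `ψ` is the phase. -/
noncomputable def weight (μ τ : ℝ) (y : Rn d) : ℝ := Real.exp (τ * Real.exp (μ * phase y))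

lemma phase_eq (y : Rn d) : phase y = -(‖y‖ ^ 2 + 2 * y (Fin.last d)) := by
  simp [phase, eN, EuclideanSpace.inner_single_left]

lemma contDiff_phase {n : WithTop ℕ∞} : ContDiff ℝ n (phase (d := d)) :=
  ((contDiff_norm_sq ℝ).add (contDiff_const.mul (contDiff_const.inner ℝ contDiff_id))).neg

lemma contDiff_phaseGrad {n : WithTop ℕ∞} : ContDiff ℝ n (phaseGrad (d := d)) := by
  unfold phaseGrad
  fun_prop

lemma contDiff_freq {n : WithTop ℕ∞} (μ τ : ℝ) : ContDiff ℝ n (freq (d := d) μ τ) :=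
  contDiff_const.mul (contDiff_const.mul contDiff_phase).exp

lemma contDiff_weight {n : WithTop ℕ∞} (μ τ : ℝ) : ContDiff ℝ n (weight (d := d) μ τ) :=
  (contDiff_const.mul (contDiff_const.mul contDiff_phase).exp).exp

lemma hasFDerivAt_phaseGrad (y : Rn d) :
    HasFDerivAt phaseGrad ((-2 : ℝ) • ContinuousLinearMap.id ℝ (Rn d)) y :=
  ((hasFDerivAt_id y).add_const (eN d)).const_smul (-2 : ℝ)

lemma hasFDerivAt_phase (y : Rn d) : HasFDerivAt phase (innerSL ℝ (phaseGrad y)) y := by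
  refine (((hasStrictFDerivAt_norm_sq y).hasFDerivAt).add
    (((innerSL ℝ (eN d)).hasFDerivAt (x := y)).const_mul (2 : ℝ))).neg.congr_fderiv ?_
  ext z
  simp [phaseGrad]
  ring

lemma hasFDerivAt_freq (μ τ : ℝ) (y : Rn d) :
    HasFDerivAt (freq μ τ) ((μ * freq μ τ y) • innerSL ℝ (phaseGrad y)) y := by
  refine ((((hasFDerivAt_phase y).const_mul μ).exp).const_mul (τ * μ)).congr_fderiv ?_
  ext z
  simp [freq]
  ring

lemma hasFDerivAt_weight (μ τ : ℝ) (y : Rn d) :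
    HasFDerivAt (weight μ τ) ((freq μ τ y * weight μ τ y) • innerSL ℝ (phaseGrad y)) y := by
  refine ((((hasFDerivAt_phase y).const_mul μ).exp).const_mul τ).exp.congr_fderiv ?_
  ext z
  simp [freq, weight]
  ring

lemma gradient_weight (μ τ : ℝ) (y : Rn d) :
    ∇ (weight μ τ) y = (freq μ τ y * weight μ τ y) • phaseGrad y :=
  gradient_eq_of_hasFDerivAt (by simpa only [map_smul] using hasFDerivAt_weight μ τ y)

lemma hess_weight (μ τ : ℝ) (y : Rn d) : hess (weight μ τ) y
    = (-2 * freq μ τ y * weight μ τ y) • ContinuousLinearMap.id ℝ (Rn d)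
      + (weight μ τ y * (μ * freq μ τ y + freq μ τ y ^ 2)) •
        (innerSL ℝ (phaseGrad y)).smulRight (phaseGrad y) := by
  have hgrad : ∇ (weight (d := d) μ τ) = fun y => (freq μ τ y * weight μ τ y) • phaseGrad y :=
    funext fun y => gradient_weight μ τ y
  rw [hess, hgrad, (show HasFDerivAt (fun y => (freq μ τ y * weight μ τ y) • phaseGrad y) _ y from
    ((hasFDerivAt_freq μ τ y).mul (hasFDerivAt_weight μ τ y)).smul
      (hasFDerivAt_phaseGrad y)).fderiv]
  ext z i
  simp
  ring

lemma traceL_comp_hess_weight (μ τ : ℝ) (y : Rn d) (A : Rn d →L[ℝ] Rn d) :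
    traceL (A.comp (hess (weight μ τ) y)) = weight μ τ y
      * ((μ * freq μ τ y + freq μ τ y ^ 2) * ⟪A (phaseGrad y), phaseGrad y⟫_ℝ
        - 2 * freq μ τ y * traceL A) := by
  rw [hess_weight]
  simp only [ContinuousLinearMap.comp_add, ContinuousLinearMap.comp_smul, map_add, map_smul,
    traceL_comp_smulRight, ContinuousLinearMap.comp_id, smul_eq_mul,
    real_inner_comm (A (phaseGrad y)) (phaseGrad y)]
  ring

lemma norm_eN : ‖eN d‖ = 1 := by simp [eN]

lemma norm_phaseGrad_le {y : Rn d} (h : ‖y‖ ≤ 1 / 3) : ‖phaseGrad y‖ ≤ 3 :=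
  calc ‖phaseGrad y‖ = 2 * ‖y + eN d‖ := by
        rw [phaseGrad, norm_smul, norm_neg, Real.norm_two]
    _ ≤ 2 * (1 / 3 + 1) := by
        gcongr
        exact (norm_add_le _ _).trans (add_le_add h norm_eN.le)
    _ ≤ 3 := by norm_num

lemma le_norm_phaseGrad {y : Rn d} (h : 0 ≤ y (Fin.last d)) : 2 ≤ ‖phaseGrad y‖ :=
  calc 2 ≤ |-2 * (y (Fin.last d) + 1)| := by
        rw [abs_mul, abs_neg, abs_two, abs_of_nonneg (by positivity)]
        linarith
    _ = ‖phaseGrad y (Fin.last d)‖ := by simp [phaseGrad, eN, mul_add]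
    _ ≤ ‖phaseGrad y‖ := PiLp.norm_apply_le _ _

end weight

/-- The closed half ball `{|y| ≤ r, y_n ≥ 0}`. -/
def closedHalfBall (d : ℕ) (r : ℝ) : Set (Rn d) := {y | ‖y‖ ≤ r ∧ 0 ≤ y (Fin.last d)}

section carleman

variable {d : ℕ}

/-- The data at `y` that enter the Carleman estimate with weight `weight μ τ` for the operator
`nondivOp A b c`. -/
noncomputable def carlemanJet (μ τ : ℝ) (A : Rn d → Rn d →L[ℝ] Rn d) (b : Rn d → Rn d)
    (c : Rn d → ℝ) (y : Rn d) : CarlemanJet (Rn d) where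
  A := A y
  A' := fderiv ℝ A y
  b := b y
  b' := fderiv ℝ b y
  c := c y
  c' := fderiv ℝ c y
  n := phaseGrad y
  μ := μ
  T := freq μ τ y

/-- The multiplier flux in the Carleman estimate. -/
noncomputable def carlemanFlux (μ τ : ℝ) (A : Rn d → Rn d →L[ℝ] Rn d) (b : Rn d → Rn d)
    (c w : Rn d → ℝ) : Rn d → Rn d :=
  flux A (fun y => (carlemanJet μ τ A b c y).field) (fun y => (carlemanJet μ τ A b c y).pot)
    (fun y => (carlemanJet μ τ A b c y).mult) w (∇ w)

variable {A : Rn d → Rn d →L[ℝ] Rn d} {b : Rn d → Rn d} {c v w : Rn d → ℝ} {μ τ θ M : ℝ}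

lemma contDiff_form (hA : ContDiff ℝ 1 A) :
    ContDiff ℝ 1 fun y => (carlemanJet μ τ A b c y).form :=
  (hA.clm_apply contDiff_phaseGrad).inner ℝ contDiff_phaseGrad

lemma contDiff_field (hA : ContDiff ℝ 1 A) (hb : ContDiff ℝ 1 b) :
    ContDiff ℝ 1 fun y => (carlemanJet μ τ A b c y).field :=
  ((contDiff_const.mul (contDiff_freq μ τ)).smul (hA.clm_apply contDiff_phaseGrad)).add hb

lemma contDiff_pot (hA : ContDiff ℝ 1 A) (hb : ContDiff ℝ 1 b) (hc : ContDiff ℝ 1 c) :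
    ContDiff ℝ 1 fun y => (carlemanJet μ τ A b c y).pot :=
  (((contDiff_freq μ τ).pow 2).mul (contDiff_form (μ := μ) (τ := τ) (b := b) (c := c) hA)).add
    (((contDiff_freq μ τ).mul (hb.inner ℝ contDiff_phaseGrad)).sub hc)

lemma contDiff_mult (hA : ContDiff ℝ 1 A) :
    ContDiff ℝ 1 fun y => (carlemanJet μ τ A b c y).mult :=
  ((contDiff_const (c := 2 * μ)).mul (contDiff_freq μ τ)).mul
    (contDiff_form (μ := μ) (τ := τ) (b := b) (c := c) hA)

lemma contDiff_carlemanFlux (hA : ContDiff ℝ 1 A) (hb : ContDiff ℝ 1 b)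
    (hc : ContDiff ℝ 1 c) (hw : ContDiff ℝ 2 w) :
    ContDiff ℝ 1 (carlemanFlux μ τ A b c w) := by
  have hX : ContDiff ℝ 1 fun y => (carlemanJet μ τ A b c y).field := contDiff_field hA hb
  have hp : ContDiff ℝ 1 (∇ w) := contDiff_gradient hw (by norm_num)
  have hw1 : ContDiff ℝ 1 w := hw.of_le (by norm_num)
  have hAp := hA.clm_apply hp
  exact (((contDiff_const.mul (hX.inner ℝ hp)).add
    (contDiff_const.mul ((contDiff_mult hA).mul hw1))).smul hAp).add
      ((((contDiff_pot hA hb hc).mul (hw1.pow 2)).sub (hAp.inner ℝ hp)).smul hX)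

lemma hasFDerivAt_form (hA : ContDiff ℝ 1 A) {y : Rn d}
    (hAs : (A y : Rn d →ₗ[ℝ] Rn d).IsSymmetric) :
    HasFDerivAt (fun y => (carlemanJet μ τ A b c y).form)
      (carlemanJet μ τ A b c y).formDeriv y := by
  refine (((hA.differentiable one_ne_zero y).hasFDerivAt.clm_apply
    (hasFDerivAt_phaseGrad y)).inner ℝ (hasFDerivAt_phaseGrad y)).congr_fderiv ?_
  ext z
  have h : ⟪phaseGrad y, A y z⟫_ℝ = ⟪A y (phaseGrad y), z⟫_ℝ := (hAs.apply_clm _ _).symm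
  simp [CarlemanJet.formDeriv_apply, carlemanJet, two_smul, inner_add_right, h,
    real_inner_comm (phaseGrad y)]
  ring

lemma hasFDerivAt_field (hA : ContDiff ℝ 1 A) (hb : ContDiff ℝ 1 b) (y : Rn d) :
    HasFDerivAt (fun y => (carlemanJet μ τ A b c y).field)
    (carlemanJet μ τ A b c y).fieldDeriv y := by
  refine ((((hasFDerivAt_freq μ τ y).const_mul 2).smul
    ((hA.differentiable one_ne_zero y).hasFDerivAt.clm_apply (hasFDerivAt_phaseGrad y))).add
      (hb.differentiable one_ne_zero y).hasFDerivAt).congr_fderiv ?_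
  ext z i
  simp [CarlemanJet.fieldDeriv, CarlemanJet.fieldRem, carlemanJet]
  ring

lemma hasFDerivAt_pot (hA : ContDiff ℝ 1 A) (hb : ContDiff ℝ 1 b)
    (hc : ContDiff ℝ 1 c) {y : Rn d} (hAs : (A y : Rn d →ₗ[ℝ] Rn d).IsSymmetric) :
    HasFDerivAt (fun y => (carlemanJet μ τ A b c y).pot)
      (carlemanJet μ τ A b c y).potDeriv y := by
  refine ((((hasFDerivAt_freq μ τ y).pow 2).mul (hasFDerivAt_form (μ := μ) (τ := τ) (b := b)
    (c := c) hA hAs)).add (((hasFDerivAt_freq μ τ y).mul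
      ((hb.differentiable one_ne_zero y).hasFDerivAt.inner ℝ (hasFDerivAt_phaseGrad y))).sub
        (hc.differentiable one_ne_zero y).hasFDerivAt)).congr_fderiv ?_
  ext z
  simp [CarlemanJet.potDeriv, CarlemanJet.potRem_apply, carlemanJet, inner_smul_right,
    real_inner_comm (phaseGrad y)]
  ring

lemma hasFDerivAt_mult (hA : ContDiff ℝ 1 A) {y : Rn d}
    (hAs : (A y : Rn d →ₗ[ℝ] Rn d).IsSymmetric) :
    HasFDerivAt (fun y => (carlemanJet μ τ A b c y).mult)
      (carlemanJet μ τ A b c y).multDeriv y := by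
  refine (((hasFDerivAt_freq μ τ y).const_mul (2 * μ)).mul (hasFDerivAt_form (μ := μ) (τ := τ)
    (b := b) (c := c) hA hAs)).congr_fderiv ?_
  ext z
  simp [CarlemanJet.multDeriv_apply, carlemanJet]
  ring

lemma conjugated_weight_mul (hv : ContDiff ℝ 2 v) {y : Rn d}
    (hAs : (A y : Rn d →ₗ[ℝ] Rn d).IsSymmetric) :
    (carlemanJet μ τ A b c y).Conjugated (weight μ τ y * v y) (∇ (fun x => weight μ τ x * v x) y)
      (hess (fun x => weight μ τ x * v x) y) (weight μ τ y * nondivOp A b c v y) := by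
  rw [CarlemanJet.Conjugated]
  change traceL ((A y).comp _) = _
  rw [traceL_comp_hess_mul (contDiff_weight μ τ) hv y hAs,
    gradient_mul ((contDiff_weight (n := 1) μ τ).differentiable one_ne_zero y)
      (hv.differentiable two_ne_zero y), traceL_comp_hess_weight, gradient_weight]
  simp only [carlemanJet, CarlemanJet.field, CarlemanJet.pot, CarlemanJet.potLower,
    CarlemanJet.form, nondivOp, map_smul, inner_add_left, inner_add_right, real_inner_smul_left,
    real_inner_smul_right]
  ring

lemma le_divergence_carlemanFlux (hμM : 2000 * (d + 1) ^ 2 * M ^ 2 ≤ θ ^ 2 * μ)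
    (hA : ContDiff ℝ 1 A) (hb : ContDiff ℝ 1 b) (hc : ContDiff ℝ 1 c) (hv : ContDiff ℝ 2 v)
    {y : Rn d} (h : (carlemanJet μ τ A b c y).Bounds θ M) :
    θ ^ 2 * μ * (freq μ τ y ^ 3 * (weight μ τ y * v y) ^ 2)
        - 6 * (weight μ τ y * nondivOp A b c v y) ^ 2
      ≤ divergence (carlemanFlux μ τ A b c fun x => weight μ τ x * v x) y := by
  have hw : ContDiff ℝ 2 fun x => weight μ τ x * v x := (contDiff_weight μ τ).mul hv
  have hμ : 0 < μ := h.μ_pos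
  have hT : 0 < freq μ τ y := h.T_pos
  have hmono : θ ^ 2 * μ * (freq μ τ y ^ 3 * (weight μ τ y * v y) ^ 2)
      ≤ θ ^ 2 * μ * (freq μ τ y * ‖∇ (fun x => weight μ τ x * v x) y‖ ^ 2
        + freq μ τ y ^ 3 * (weight μ τ y * v y) ^ 2) := by
    gcongr
    exact le_add_of_nonneg_left (by positivity)
  refine (sub_le_sub_right hmono _).trans ((h.le_divergence_terms ?_
    (conjugated_weight_mul hv h.symm)).trans_eq
    (divergence_flux (hA.differentiable one_ne_zero y).hasFDerivAt (hasFDerivAt_field hA hb y)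
      (hasFDerivAt_pot hA hb hc h.symm) (hasFDerivAt_mult hA h.symm)
      (hasFDerivAt_innerSL_gradient (hw.differentiable two_ne_zero y))
      (hasFDerivAt_gradient hw y) h.symm (isSymmetric_hess hw y)).symm)
  rw [finrank_euclideanSpace, Fintype.card_fin]
  exact_mod_cast hμM

lemma carlemanFlux_eq_zero_of_notMem_tsupport {y : Rn d} (hy : y ∉ tsupport w) :
    carlemanFlux μ τ A b c w y = 0 := by
  simp [carlemanFlux, flux, gradient_eq_zero_of_notMem_tsupport hy,
    image_eq_zero_of_notMem_tsupport hy]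

lemma tsupport_carlemanFlux_subset : tsupport (carlemanFlux μ τ A b c w) ⊆ tsupport w :=
  closure_minimal (fun _ hy => of_not_not fun h =>
    hy (carlemanFlux_eq_zero_of_notMem_tsupport h)) (isClosed_tsupport w)

lemma neg_integral_carlemanFlux_le (hA : ContDiff ℝ 1 A) (hb : ContDiff ℝ 1 b)
    (hc : ContDiff ℝ 1 c) (hw : ContDiff ℝ 2 w) (hws : tsupport w ⊆ Metric.closedBall 0 (1 / 3))
    (hbd : ∀ y ∈ closedHalfBall d (1 / 3), (carlemanJet μ τ A b c y).Bounds θ M) :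
    -∫ y' : Rn' d, carlemanFlux μ τ A b c w (flatPoint y') (Fin.last d)
      ≤ 109 * M ^ 2 * ∫ y' : Rn' d, (freq μ τ (flatPoint y') * ‖∇ w (flatPoint y')‖ ^ 2
        + freq μ τ (flatPoint y') ^ 3 * w (flatPoint y') ^ 2) := by
  have hcpt : HasCompactSupport w :=
    (isCompact_closedBall (0 : Rn d) (1 / 3)).of_isClosed_subset (isClosed_tsupport w) hws
  have hintegrable {f : Rn d → ℝ} (hf : Continuous f) (hf0 : ∀ y ∉ tsupport w, f y = 0) :
      Integrable fun y' : Rn' d => f (flatPoint y') :=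
    (hf.comp isClosedEmbedding_flatPoint.continuous).integrable_of_hasCompactSupport
      ((HasCompactSupport.intro hcpt hf0).comp_isClosedEmbedding isClosedEmbedding_flatPoint)
  have hT : Continuous (freq (d := d) μ τ) := (contDiff_freq (n := 0) μ τ).continuous
  have hp : Continuous (∇ w) := (contDiff_gradient (m := 1) hw (by norm_num)).continuous
  have hF := (contDiff_carlemanFlux (μ := μ) (τ := τ) hA hb hc hw).continuous
  rw [← integral_neg, ← integral_const_mul]
  refine integral_mono (hintegrable (f := fun y => carlemanFlux μ τ A b c w y (Fin.last d))
    (by fun_prop) fun y hy => ?_).neg ((hintegrable (f := fun y => freq μ τ y * ‖∇ w y‖ ^ 2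
      + freq μ τ y ^ 3 * w y ^ 2) ?_ fun y hy => ?_).const_mul _) fun y' => ?_
  · rw [carlemanFlux_eq_zero_of_notMem_tsupport hy, PiLp.zero_apply]
  · exact (hT.mul (hp.norm.pow 2)).add ((hT.pow 3).mul (hw.continuous.pow 2))
  · simp [gradient_eq_zero_of_notMem_tsupport hy, image_eq_zero_of_notMem_tsupport hy]
  · by_cases hy : flatPoint y' ∈ tsupport w
    · have hnorm : ‖flatPoint y'‖ ≤ 1 / 3 := mem_closedBall_zero_iff.1 (hws hy)
      exact ((neg_le_abs _).trans (PiLp.norm_apply_le (carlemanFlux μ τ A b c w _) _)).trans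
        ((hbd _ ⟨hnorm, (flatPoint_last y').ge⟩).norm_flux_le _ _)
    · simp [carlemanFlux_eq_zero_of_notMem_tsupport hy, gradient_eq_zero_of_notMem_tsupport hy,
        image_eq_zero_of_notMem_tsupport hy]

theorem carleman_estimate (hμM : 2000 * (d + 1) ^ 2 * M ^ 2 ≤ θ ^ 2 * μ)
    (hA : ContDiff ℝ 1 A) (hb : ContDiff ℝ 1 b) (hc : ContDiff ℝ 1 c) (hv : ContDiff ℝ 2 v)
    (hvs : tsupport v ⊆ Metric.closedBall 0 (1 / 3))
    (hbd : ∀ y ∈ closedHalfBall d (1 / 3), (carlemanJet μ τ A b c y).Bounds θ M) :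
    θ ^ 2 * μ * ∫ y in upperHalf d, freq μ τ y ^ 3 * (weight μ τ y * v y) ^ 2
      ≤ 6 * (∫ y in upperHalf d, (weight μ τ y * nondivOp A b c v y) ^ 2)
        + 109 * M ^ 2 * ∫ y' : Rn' d, (freq μ τ (flatPoint y')
            * ‖∇ (fun x => weight μ τ x * v x) (flatPoint y')‖ ^ 2
          + freq μ τ (flatPoint y') ^ 3 * (weight μ τ (flatPoint y') * v (flatPoint y')) ^ 2) := by
  set w : Rn d → ℝ := fun x => weight μ τ x * v x with hw_def
  have hw : ContDiff ℝ 2 w := (contDiff_weight μ τ).mul hv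
  have hwv : tsupport w ⊆ tsupport v := tsupport_mul_subset_right
  have hvc : HasCompactSupport v :=
    (isCompact_closedBall (0 : Rn d) (1 / 3)).of_isClosed_subset (isClosed_tsupport v) hvs
  have hF := contDiff_carlemanFlux (μ := μ) (τ := τ) hA hb hc hw
  have hFc : HasCompactSupport (carlemanFlux μ τ A b c w) := HasCompactSupport.intro hvc
    fun y hy => carlemanFlux_eq_zero_of_notMem_tsupport fun h => hy (hwv h)
  have hpointwise : ∀ y ∈ upperHalf d, θ ^ 2 * μ * (freq μ τ y ^ 3 * w y ^ 2)
      - 6 * (weight μ τ y * nondivOp A b c v y) ^ 2 ≤ divergence (carlemanFlux μ τ A b c w) y := by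
    intro y hy
    by_cases hyv : y ∈ tsupport v
    · exact le_divergence_carlemanFlux hμM hA hb hc hv
        (hbd y ⟨mem_closedBall_zero_iff.1 (hvs hyv), hy.le⟩)
    · rw [divergence_eq_zero_of_notMem_tsupport fun h =>
        hyv (hwv (tsupport_carlemanFlux_subset h)), nondivOp_eq_zero_of_notMem_tsupport hyv,
        show w y = 0 by simp [hw_def, image_eq_zero_of_notMem_tsupport hyv]]
      simp
  have hleft : Integrable fun y => freq μ τ y ^ 3 * w y ^ 2 :=
    Continuous.integrable_of_hasCompactSupport
      (((contDiff_freq (n := 0) μ τ).continuous.pow 3).mul (hw.continuous.pow 2))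
      (HasCompactSupport.intro hvc fun y hy => by
        simp [hw_def, image_eq_zero_of_notMem_tsupport hy])
  have hright : Integrable fun y => (weight μ τ y * nondivOp A b c v y) ^ 2 :=
    Continuous.integrable_of_hasCompactSupport
      (((contDiff_weight (n := 0) μ τ).continuous.mul
        (continuous_nondivOp hA.continuous hb.continuous hc.continuous hv)).pow 2)
      (HasCompactSupport.intro hvc fun y hy => by simp [nondivOp_eq_zero_of_notMem_tsupport hy])
  have hmono := setIntegral_mono_on
    ((hleft.const_mul (θ ^ 2 * μ)).sub (hright.const_mul 6)).integrableOn
    (integrable_divergence hF hFc).integrableOn measurableSet_upperHalf hpointwise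
  rw [integral_upperHalf_divergence hF hFc] at hmono
  simp only [Pi.sub_apply] at hmono
  rw [integral_sub (hleft.const_mul _).integrableOn (hright.const_mul _).integrableOn,
    integral_const_mul, integral_const_mul] at hmono
  linarith [neg_integral_carlemanFlux_le hA hb hc hw (hwv.trans hvs) hbd]

end carleman

/-- Bounds on the coefficients of `nondivOp A b c` at a point. The ellipticity is `θ`, the
leading part is bounded by `M`, and `S` is the size of the first order terms and the square root of
the size of the zeroth order terms, up to the factor `B`. -/
structure CoeffBounds {E : Type*} [NormedAddCommGroup E] [InnerProductSpace ℝ E] (θ M B S : ℝ)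
    (A : E → E →L[ℝ] E) (b : E → E) (c : E → ℝ) (y : E) : Prop where
  pos : 0 < θ
  one_le_M : 1 ≤ M
  nonneg : 0 ≤ B
  one_le_S : 1 ≤ S
  norm_A_le : ‖A y‖ ≤ M
  norm_fderiv_A_le : ‖fderiv ℝ A y‖ ≤ M
  symm : (A y : E →ₗ[ℝ] E).IsSymmetric
  coercive : ∀ x, θ * ‖x‖ ^ 2 ≤ ⟪A y x, x⟫_ℝ
  norm_b_le : ‖b y‖ ≤ B * S
  norm_fderiv_b_le : ‖fderiv ℝ b y‖ ≤ B * S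
  abs_c_le : |c y| ≤ B * S ^ 2
  norm_fderiv_c_le : ‖fderiv ℝ c y‖ ≤ B * S ^ 2

lemma mul_le_half_mul_sq_add_sq_div {θ : ℝ} (hθ : 0 < θ) (x y : ℝ) :
    x * y ≤ θ / 2 * x ^ 2 + y ^ 2 / (2 * θ) := by
  have h : θ / 2 * x ^ 2 + y ^ 2 / (2 * θ) - x * y = (θ * x - y) ^ 2 / (2 * θ) := by
    field_simp
    ring
  exact sub_nonneg.1 (h ▸ by positivity)

section caccioppoliField

variable {E : Type*} [NormedAddCommGroup E] [InnerProductSpace ℝ E] {A : E → E →L[ℝ] E}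
  {b : E → E} {c u η : E → ℝ} {θ M B S K : ℝ} {y : E}

lemma CoeffBounds.abs_caccioppoli_zeroth_order_le (h : CoeffBounds θ M B S A b c y) {e U g : ℝ}
    (he0 : 0 ≤ e) (he1 : e ≤ 1) :
    |e ^ 2 * U * (c y * U - g)| ≤ (B + 1) * S ^ 2 * U ^ 2 + g ^ 2 := by
  have hS : 1 ≤ S ^ 2 := one_le_pow₀ h.one_le_S
  calc |e ^ 2 * U * (c y * U - g)| = e ^ 2 * |c y * U ^ 2 - U * g| := by
        rw [← abs_of_nonneg (sq_nonneg e), ← abs_mul, abs_of_nonneg (sq_nonneg e)]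
        ring_nf
    _ ≤ 1 * |c y * U ^ 2 - U * g| := by
        gcongr
        exact pow_le_one₀ he0 he1
    _ ≤ |c y| * U ^ 2 + |U * g| := by
        rw [one_mul, ← abs_of_nonneg (sq_nonneg U), ← abs_mul, abs_of_nonneg (sq_nonneg U)]
        exact abs_sub _ _
    _ ≤ B * S ^ 2 * U ^ 2 + (U ^ 2 + g ^ 2) := by
        gcongr
        · exact h.abs_c_le
        · exact abs_le.2 ⟨by nlinarith [sq_nonneg (U + g)], by nlinarith [sq_nonneg (U - g)]⟩
    _ ≤ (B + 1) * S ^ 2 * U ^ 2 + g ^ 2 := by nlinarith [sq_nonneg U]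

variable [FiniteDimensional ℝ E]

/-- The field `η² u A∇u`, the flux obtained by testing the equation for `u` against `η² u`. -/
noncomputable def caccioppoliField (A : E → E →L[ℝ] E) (u η : E → ℝ) (y : E) : E :=
  (η y ^ 2 * u y) • A y (∇ u y)

lemma contDiff_caccioppoliField (hA : ContDiff ℝ 1 A) (hu : ContDiff ℝ 2 u)
    (hη : ContDiff ℝ 1 η) : ContDiff ℝ 1 (caccioppoliField A u η) :=
  ((hη.pow 2).mul (hu.of_le (by norm_num))).smul
    (hA.clm_apply (contDiff_gradient hu (by norm_num)))

lemma divergence_caccioppoliField (hA : ContDiff ℝ 1 A) (hu : ContDiff ℝ 2 u)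
    (hη : ContDiff ℝ 1 η) (y : E) :
    divergence (caccioppoliField A u η) y = η y ^ 2 * ⟪A y (∇ u y), ∇ u y⟫_ℝ
      + (η y ^ 2 * u y * (⟪b y, ∇ u y⟫_ℝ + traceL ((fderiv ℝ A y).flip (∇ u y)))
        + 2 * η y * u y * ⟪A y (∇ u y), ∇ η y⟫_ℝ)
      + η y ^ 2 * u y * (c y * u y - nondivOp A b c u y) := by
  have hcut := ((hasFDerivAt_innerSL_gradient (hη.differentiable one_ne_zero y)).pow 2).mul
    (hasFDerivAt_innerSL_gradient (hu.differentiable two_ne_zero y))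
  have hfield := (hA.differentiable one_ne_zero y).hasFDerivAt.clm_apply (hasFDerivAt_gradient hu y)
  refine (divergence_smul hcut hfield).trans ?_
  rw [map_add, nondivOp]
  simp [real_inner_comm (A y (∇ u y))]
  ring

lemma CoeffBounds.abs_traceL_flip_le (h : CoeffBounds θ M B S A b c y) (p : E) :
    |traceL ((fderiv ℝ A y).flip p)| ≤ Module.finrank ℝ E * M * ‖p‖ :=
  calc |traceL ((fderiv ℝ A y).flip p)| ≤ Module.finrank ℝ E * ‖(fderiv ℝ A y).flip p‖ :=
        abs_traceL_le _
    _ ≤ Module.finrank ℝ E * (M * ‖p‖) := by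
        gcongr
        exact (fderiv ℝ A y).flip.le_of_opNorm_le
          ((fderiv ℝ A y).opNorm_flip.trans_le h.norm_fderiv_A_le) p
    _ = Module.finrank ℝ E * M * ‖p‖ := (mul_assoc _ _ _).symm

lemma CoeffBounds.abs_caccioppoli_first_order_le (h : CoeffBounds θ M B S A b c y) {e U : ℝ}
    {p z : E} (he0 : 0 ≤ e) (he1 : e ≤ 1) (hz : ‖z‖ ≤ K) :
    |e ^ 2 * U * (⟪b y, p⟫_ℝ + traceL ((fderiv ℝ A y).flip p)) + 2 * e * U * ⟪A y p, z⟫_ℝ|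
      ≤ e * ‖p‖ * ((B + Module.finrank ℝ E * M + 2 * M * K) * S * |U|) := by
  have hM : 0 ≤ M := zero_le_one.trans h.one_le_M
  have : 0 ≤ B := h.nonneg
  have hS : 1 ≤ S := h.one_le_S
  have hK : 0 ≤ K := (norm_nonneg z).trans hz
  have hb : |⟪b y, p⟫_ℝ| ≤ B * S * ‖p‖ :=
    (abs_real_inner_le_norm _ _).trans (by gcongr; exact h.norm_b_le)
  have hA : |⟪A y p, z⟫_ℝ| ≤ M * ‖p‖ * K :=
    (abs_inner_apply_le _ _ _).trans (by gcongr; exact h.norm_A_le)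
  calc |e ^ 2 * U * (⟪b y, p⟫_ℝ + traceL ((fderiv ℝ A y).flip p)) + 2 * e * U * ⟪A y p, z⟫_ℝ|
      = e * |U| * |e * (⟪b y, p⟫_ℝ + traceL ((fderiv ℝ A y).flip p)) + 2 * ⟪A y p, z⟫_ℝ| := by
        rw [← abs_of_nonneg he0, ← abs_mul, ← abs_mul, abs_of_nonneg he0]
        ring_nf
    _ ≤ e * |U| * (1 * (B * S * ‖p‖ + Module.finrank ℝ E * M * ‖p‖) + 2 * (M * ‖p‖ * K)) := by
        gcongr
        refine (abs_add_le _ _).trans ?_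
        rw [abs_mul, abs_mul, abs_of_nonneg he0, abs_two]
        gcongr
        exact (abs_add_le _ _).trans (add_le_add hb (h.abs_traceL_flip_le p))
    _ = e * |U| * (B * ‖p‖ * S + (Module.finrank ℝ E * M * ‖p‖ + 2 * M * ‖p‖ * K) * 1) := by ring
    _ ≤ e * |U| * (B * ‖p‖ * S + (Module.finrank ℝ E * M * ‖p‖ + 2 * M * ‖p‖ * K) * S) := by
        gcongr
    _ = e * ‖p‖ * ((B + Module.finrank ℝ E * M + 2 * M * K) * S * |U|) := by ring

/-- The constant in Caccioppoli's inequality for a cutoff with gradient at most `K`, in dimension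
`N`. -/
noncomputable def caccioppoliConst (N : ℕ) (θ M B K : ℝ) : ℝ :=
  (B + N * M + 2 * M * K) ^ 2 / (2 * θ) + (B + 1)

lemma CoeffBounds.le_divergence_caccioppoliField (h : CoeffBounds θ M B S A b c y)
    (hA : ContDiff ℝ 1 A) (hu : ContDiff ℝ 2 u) (hη : ContDiff ℝ 1 η) (hη0 : 0 ≤ η y)
    (hη1 : η y ≤ 1) (hK : ‖∇ η y‖ ≤ K) :
    θ / 2 * (η y ^ 2 * ‖∇ u y‖ ^ 2) ≤ divergence (caccioppoliField A u η) y
      + (caccioppoliConst (Module.finrank ℝ E) θ M B K * S ^ 2 * u y ^ 2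
        + nondivOp A b c u y ^ 2) := by
  set D := B + Module.finrank ℝ E * M + 2 * M * K with hD
  rw [divergence_caccioppoliField (b := b) (c := c) hA hu hη]
  have hlead : η y ^ 2 * (θ * ‖∇ u y‖ ^ 2) ≤ η y ^ 2 * ⟪A y (∇ u y), ∇ u y⟫_ℝ := by
    gcongr
    exact h.coercive _
  have hfirst := (abs_le.1 ((h.abs_caccioppoli_first_order_le (U := u y) (p := ∇ u y) hη0 hη1
    hK).trans (mul_le_half_mul_sq_add_sq_div h.pos _ _))).1
  have hzeroth := (abs_le.1 (h.abs_caccioppoli_zeroth_order_le (U := u y)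
    (g := nondivOp A b c u y) hη0 hη1)).1
  have hsplit : (D * S * |u y|) ^ 2 / (2 * θ) + (B + 1) * S ^ 2 * u y ^ 2
      = caccioppoliConst (Module.finrank ℝ E) θ M B K * S ^ 2 * u y ^ 2 := by
    rw [caccioppoliConst, ← hD, mul_pow, mul_pow, sq_abs]
    ring
  linarith

end caccioppoliField

section caccioppoli

variable {d : ℕ} {A : Rn d → Rn d →L[ℝ] Rn d} {b : Rn d → Rn d} {c u η : Rn d → ℝ}
  {θ M B S K : ℝ}

lemma isOpen_halfBall (d : ℕ) (r : ℝ) : IsOpen (halfBall d r) :=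
  (isOpen_lt continuous_norm continuous_const).inter
    (isOpen_lt continuous_const (EuclideanSpace.proj (Fin.last d)).continuous)

/-- The square of the `L²` norm of the Cauchy data on the flat ball of radius `1/3`, for a function
that is smooth across it. -/
noncomputable def flatData (u : Rn d → ℝ) : ℝ :=
  ∫ y' in Metric.ball (0 : Rn' d) (1 / 3), (u (flatPoint y') ^ 2 + ‖∇ u (flatPoint y')‖ ^ 2)

lemma flatData_nonneg (u : Rn d → ℝ) : 0 ≤ flatData u :=
  integral_nonneg fun y => by positivity

lemma integrableOn_halfBall {f : Rn d → ℝ} (hf : Continuous f) (r : ℝ) :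
    IntegrableOn f (halfBall d r) :=
  (hf.continuousOn.integrableOn_compact (isCompact_closedBall 0 r)).mono_set
    fun _ hy => mem_closedBall_zero_iff.2 hy.1.le

lemma integrableOn_flatData (hu : ContDiff ℝ 1 u) : IntegrableOn
    (fun y' : Rn' d => u (flatPoint y') ^ 2 + ‖∇ u (flatPoint y')‖ ^ 2)
    (Metric.ball (0 : Rn' d) (1 / 3)) := by
  have hflat : Continuous (flatPoint (d := d)) := isClosedEmbedding_flatPoint.continuous
  have hgrad : Continuous (∇ u) := (contDiff_gradient (m := 0) hu (by norm_num)).continuous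
  exact (Continuous.continuousOn (((hu.continuous.comp hflat).pow 2).add
    ((hgrad.comp hflat).norm.pow 2))).integrableOn_compact (isCompact_closedBall _ _)
      |>.mono_set Metric.ball_subset_closedBall

lemma CoeffBounds.norm_caccioppoliField_le {y : Rn d} (h : CoeffBounds θ M B S A b c y)
    (hη0 : 0 ≤ η y) (hη1 : η y ≤ 1) :
    ‖caccioppoliField A u η y‖ ≤ M * (u y ^ 2 + ‖∇ u y‖ ^ 2) := by
  have hM : 0 ≤ M := zero_le_one.trans h.one_le_M
  calc ‖caccioppoliField A u η y‖ = η y ^ 2 * |u y| * ‖A y (∇ u y)‖ := by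
        rw [caccioppoliField, norm_smul, norm_mul, norm_pow, Real.norm_of_nonneg hη0,
          Real.norm_eq_abs]
    _ ≤ 1 * |u y| * (M * ‖∇ u y‖) := by
        gcongr
        · exact pow_le_one₀ hη0 hη1
        · exact (A y).le_of_opNorm_le h.norm_A_le _
    _ = M * (|u y| * ‖∇ u y‖) := by ring
    _ ≤ M * (u y ^ 2 + ‖∇ u y‖ ^ 2) := by
        gcongr
        rw [← sq_abs]
        nlinarith [sq_nonneg (|u y| - ‖∇ u y‖), abs_nonneg (u y), norm_nonneg (∇ u y)]

lemma neg_integral_caccioppoliField_le (hA : ContDiff ℝ 1 A) (hu : ContDiff ℝ 2 u)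
    (hη : ContDiff ℝ 1 η) (hη0 : ∀ y, 0 ≤ η y) (hη1 : ∀ y, η y ≤ 1)
    (hηs : ∀ y : Rn d, 1 / 3 ≤ ‖y‖ → η y = 0)
    (hbd : ∀ y ∈ closedHalfBall d (1 / 3), CoeffBounds θ M B S A b c y) :
    -∫ y' : Rn' d, caccioppoliField A u η (flatPoint y') (Fin.last d) ≤ M * flatData u := by
  have hF := (contDiff_caccioppoliField hA hu hη).continuous
  have hflat : Continuous (flatPoint (d := d)) := isClosedEmbedding_flatPoint.continuous
  have hzero : ∀ y' : Rn' d, 1 / 3 ≤ ‖y'‖ → caccioppoliField A u η (flatPoint y') = 0 :=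
    fun y' hy' => by simp [caccioppoliField, hηs _ (by rwa [norm_flatPoint])]
  rw [← integral_neg, flatData, ← integral_const_mul, ← integral_indicator measurableSet_ball]
  have hdata : IntegrableOn (fun y' => M * (u (flatPoint y') ^ 2 + ‖∇ u (flatPoint y')‖ ^ 2))
      (Metric.ball (0 : Rn' d) (1 / 3)) :=
    (integrableOn_flatData (hu.of_le (by norm_num))).const_mul M
  refine integral_mono (Integrable.neg ?_) (hdata.integrable_indicator measurableSet_ball)
    fun y' => ?_
  · refine Continuous.integrable_of_hasCompactSupport (by fun_prop)
      (HasCompactSupport.intro (isCompact_closedBall (0 : Rn' d) (1 / 3)) fun y' hy' => ?_)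
    rw [mem_closedBall_zero_iff, not_le] at hy'
    rw [hzero y' hy'.le, PiLp.zero_apply]
  · by_cases hy' : ‖y'‖ < 1 / 3
    · rw [Set.indicator_of_mem (mem_ball_zero_iff.2 hy')]
      exact ((neg_le_abs _).trans (PiLp.norm_apply_le (caccioppoliField A u η _) _)).trans
        ((hbd _ ⟨(norm_flatPoint y').trans_le hy'.le, (flatPoint_last y').ge⟩
          |>.norm_caccioppoliField_le) (hη0 _) (hη1 _))
    · rw [Set.indicator_of_notMem (mt mem_ball_zero_iff.1 hy')]
      simp [hzero y' (not_lt.1 hy')]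

lemma caccioppoli_cutoff (hA : ContDiff ℝ 1 A) (hb : Continuous b) (hc : Continuous c)
    (hu : ContDiff ℝ 2 u) (hη : ContDiff ℝ 1 η) (hη0 : ∀ y, 0 ≤ η y) (hη1 : ∀ y, η y ≤ 1)
    (hηs : ∀ y : Rn d, 1 / 3 ≤ ‖y‖ → η y = 0) (hK : ∀ y, ‖∇ η y‖ ≤ K)
    (hbd : ∀ y ∈ closedHalfBall d (1 / 3), CoeffBounds θ M B S A b c y) :
    θ / 2 * ∫ y in upperHalf d, η y ^ 2 * ‖∇ u y‖ ^ 2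
      ≤ caccioppoliConst (Module.finrank ℝ (Rn d)) θ M B K * S ^ 2
          * (∫ y in halfBall d (1 / 3), u y ^ 2)
        + (∫ y in halfBall d (1 / 3), nondivOp A b c u y ^ 2) + M * flatData u := by
  set C := caccioppoliConst (Module.finrank ℝ (Rn d)) θ M B K
  have hF := contDiff_caccioppoliField hA hu hη
  have hzero : ∀ y ∉ Metric.closedBall (0 : Rn d) (1 / 3), η y = 0 := fun y hy =>
    hηs y (not_le.1 (mt mem_closedBall_zero_iff.2 hy)).le
  have hFc : HasCompactSupport (caccioppoliField A u η) := .intro (isCompact_closedBall 0 (1 / 3))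
    fun y hy => by simp [caccioppoliField, hzero y hy]
  have hleft : Integrable fun y => η y ^ 2 * ‖∇ u y‖ ^ 2 :=
    ((hη.continuous.pow 2).mul ((contDiff_gradient (m := 1) hu
      (by norm_num)).continuous.norm.pow 2)).integrable_of_hasCompactSupport
        (.intro (isCompact_closedBall 0 (1 / 3)) fun y hy => by simp [hzero y hy])
  have hu2 : IntegrableOn (fun y => C * S ^ 2 * u y ^ 2) (halfBall d (1 / 3)) :=
    integrableOn_halfBall (continuous_const.mul (hu.continuous.pow 2)) _
  have hL2 : IntegrableOn (fun y => nondivOp A b c u y ^ 2) (halfBall d (1 / 3)) :=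
    integrableOn_halfBall ((continuous_nondivOp hA.continuous hb hc hu).pow 2) _
  have hrest := (hu2.add hL2).integrable_indicator (isOpen_halfBall d (1 / 3)).measurableSet
  have hmono := setIntegral_mono_on (hleft.const_mul (θ / 2)).integrableOn
    ((integrable_divergence hF hFc).add hrest).integrableOn measurableSet_upperHalf fun y hy => by
      by_cases hy3 : ‖y‖ < 1 / 3
      · rw [Pi.add_apply, Set.indicator_of_mem (show y ∈ halfBall d (1 / 3) from ⟨hy3, hy⟩)]
        exact (hbd y ⟨hy3.le, hy.le⟩).le_divergence_caccioppoliField hA hu hη (hη0 y) (hη1 y) (hK y)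
      · rw [Pi.add_apply, Set.indicator_of_notMem fun h => hy3 h.1,
          divergence_caccioppoliField (b := b) (c := c) hA hu hη, hηs y (not_lt.1 hy3)]
        simp
  simp only [Pi.add_apply] at hmono
  rw [integral_const_mul, integral_add (integrable_divergence hF hFc).integrableOn
    hrest.integrableOn, integral_upperHalf_divergence hF hFc,
    setIntegral_indicator (isOpen_halfBall d (1 / 3)).measurableSet,
    Set.inter_eq_self_of_subset_right (show halfBall d (1 / 3) ⊆ upperHalf d from fun _ hy => hy.2),
    integral_add' hu2 hL2, integral_const_mul] at hmono
  linarith [neg_integral_caccioppoliField_le hA hu hη hη0 hη1 hηs hbd]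

lemma setIntegral_halfBall_le_integral_sq_mul {r : ℝ} {η f : Rn d → ℝ} (hη : Continuous η)
    (hηs : HasCompactSupport η) (hη1 : ∀ y, ‖y‖ < r → η y = 1) (hf : Continuous f)
    (hf0 : ∀ y, 0 ≤ f y) :
    ∫ y in halfBall d r, f y ≤ ∫ y in upperHalf d, η y ^ 2 * f y := by
  have hint : Integrable fun y => η y ^ 2 * f y :=
    ((hη.pow 2).mul hf).integrable_of_hasCompactSupport
      (hηs.mono' fun y hy => subset_tsupport _ fun h => hy (by simp [h]))
  rw [setIntegral_congr_fun (g := fun y => η y ^ 2 * f y) (isOpen_halfBall d r).measurableSet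
    fun y hy => by simp [hη1 y hy.1]]
  exact setIntegral_mono_set hint.integrableOn
    (.of_forall fun y => mul_nonneg (sq_nonneg _) (hf0 y)) (.of_forall fun y hy => hy.2)

theorem caccioppoli (hθ : 0 < θ) (hB : 0 ≤ B) (hM : 1 ≤ M) :
    ∃ C, 0 < C ∧ ∀ (S : ℝ) (A : Rn d → Rn d →L[ℝ] Rn d) (b : Rn d → Rn d) (c u : Rn d → ℝ),
      ContDiff ℝ 1 A → Continuous b → Continuous c → ContDiff ℝ 2 u →
      (∀ y ∈ closedHalfBall d (1 / 3), CoeffBounds θ M B S A b c y) →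
      ∫ y in halfBall d (3 / 10), ‖∇ u y‖ ^ 2 ≤ C * (S ^ 2 * (∫ y in halfBall d (1 / 3), u y ^ 2)
        + (∫ y in halfBall d (1 / 3), nondivOp A b c u y ^ 2) + flatData u) := by
  let η : ContDiffBump (0 : Rn d) := ⟨3 / 10, 1 / 3, by norm_num, by norm_num⟩
  have hη : ContDiff ℝ 1 η := η.contDiff
  have hηs : ∀ y : Rn d, 1 / 3 ≤ ‖y‖ → η y = 0 := fun y hy =>
    η.zero_of_le_dist (by rwa [dist_zero_right])
  obtain ⟨K, hK⟩ : ∃ K, ∀ y, ‖∇ η y‖ ≤ K := by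
    simpa only [norm_gradient] using (hη.continuous_fderiv
      one_ne_zero).bounded_above_of_compact_support (η.hasCompactSupport.fderiv (𝕜 := ℝ))
  set E := caccioppoliConst (Module.finrank ℝ (Rn d)) θ M B K with hE
  have hE0 : 0 < E := by
    rw [hE, caccioppoliConst]
    positivity
  refine ⟨2 / θ * (E + 1 + M), by positivity, fun S A b c u hA hb hc hu hbd => ?_⟩
  have hlow : ∫ y in halfBall d (3 / 10), ‖∇ u y‖ ^ 2
      ≤ ∫ y in upperHalf d, η y ^ 2 * ‖∇ u y‖ ^ 2 :=
    setIntegral_halfBall_le_integral_sq_mul hη.continuous η.hasCompactSupport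
      (fun y hy => η.one_of_mem_closedBall (mem_closedBall_zero_iff.2 hy.le))
      ((contDiff_gradient (m := 1) hu (by norm_num)).continuous.norm.pow 2) fun y => sq_nonneg _
  set U := ∫ y in halfBall d (1 / 3), u y ^ 2
  set G := ∫ y in halfBall d (1 / 3), nondivOp A b c u y ^ 2
  have : 0 ≤ U := integral_nonneg fun y => sq_nonneg _
  have : 0 ≤ G := integral_nonneg fun y => sq_nonneg _
  have hD : 0 ≤ flatData u := flatData_nonneg u
  calc ∫ y in halfBall d (3 / 10), ‖∇ u y‖ ^ 2
      ≤ 2 / θ * (θ / 2 * ∫ y in upperHalf d, η y ^ 2 * ‖∇ u y‖ ^ 2) := by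
        rwa [← mul_assoc, div_mul_div_cancel₀' two_ne_zero, div_self hθ.ne', one_mul]
    _ ≤ 2 / θ * (E * S ^ 2 * U + G + M * flatData u) := by
        gcongr
        exact caccioppoli_cutoff hA hb hc hu hη (fun _ => η.nonneg) (fun _ => η.le_one) hηs hK hbd
    _ = 2 / θ * (E * (S ^ 2 * U) + 1 * G + M * flatData u) := by ring
    _ ≤ 2 / θ * ((E + 1 + M) * (S ^ 2 * U) + (E + 1 + M) * G + (E + 1 + M) * flatData u) := by
        gcongr <;> linarith
    _ = 2 / θ * (E + 1 + M) * (S ^ 2 * U + G + flatData u) := by ring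

end caccioppoli

section weightBounds

variable {d : ℕ} {μ τ s : ℝ} {y : Rn d}

lemma phase_nonpos (hy : 0 ≤ y (Fin.last d)) : phase y ≤ 0 := by
  rw [phase_eq]
  nlinarith [sq_nonneg ‖y‖]

lemma last_le_norm (y : Rn d) : y (Fin.last d) ≤ ‖y‖ :=
  (le_abs_self _).trans (PiLp.norm_apply_le y (Fin.last d))

lemma neg_one_le_phase (hy : ‖y‖ ≤ 1 / 3) : -1 ≤ phase y := by
  rw [phase_eq]
  nlinarith [last_le_norm y, norm_nonneg y]

lemma le_phase_of_norm_le (hy : ‖y‖ ≤ 1 / 256) : -(1 / 100) ≤ phase y := by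
  rw [phase_eq]
  nlinarith [last_le_norm y, norm_nonneg y]

lemma phase_le_of_le_norm (hy : 1 / 4 ≤ ‖y‖) (h : 0 ≤ y (Fin.last d)) : phase y ≤ -(1 / 16) := by
  rw [phase_eq]
  nlinarith

lemma weight_pos (μ τ : ℝ) (y : Rn d) : 0 < weight μ τ y := Real.exp_pos _

lemma weight_le (hμ : 0 ≤ μ) (hτ : 0 ≤ τ) (h : phase y ≤ s) :
    weight μ τ y ≤ Real.exp (τ * Real.exp (μ * s)) := by
  unfold weight
  gcongr

lemma weight_le_exp (hμ : 0 ≤ μ) (hτ : 0 ≤ τ) (hy : 0 ≤ y (Fin.last d)) :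
    weight μ τ y ≤ Real.exp τ := by
  simpa using weight_le hμ hτ (phase_nonpos hy)

lemma le_weight (hμ : 0 ≤ μ) (hτ : 0 ≤ τ) (h : s ≤ phase y) :
    Real.exp (τ * Real.exp (μ * s)) ≤ weight μ τ y := by
  unfold weight
  gcongr

lemma le_freq (hμ : 0 ≤ μ) (hτ : 0 ≤ τ) (hy : ‖y‖ ≤ 1 / 3) :
    τ * μ * Real.exp (-μ) ≤ freq μ τ y := by
  have hphase := neg_one_le_phase hy
  unfold freq
  gcongr
  nlinarith

lemma freq_nonneg (hμ : 0 ≤ μ) (hτ : 0 ≤ τ) (y : Rn d) : 0 ≤ freq μ τ y := by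
  unfold freq
  positivity

lemma freq_le (hμ : 0 ≤ μ) (hτ : 0 ≤ τ) (h : 0 ≤ y (Fin.last d)) : freq μ τ y ≤ τ * μ :=
  mul_le_of_le_one_right (by positivity) (Real.exp_le_one_iff.2
    (mul_nonpos_of_nonneg_of_nonpos hμ (phase_nonpos h)))

lemma exp_sq (x : ℝ) : Real.exp x ^ 2 = Real.exp (2 * x) := by
  rw [← Real.exp_nat_mul, Nat.cast_ofNat]

lemma CoeffBounds.carlemanBounds {θ M B S : ℝ} {A : Rn d → Rn d →L[ℝ] Rn d} {b : Rn d → Rn d}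
    {c : Rn d → ℝ} (h : CoeffBounds θ M B S A b c y) (hμ : 1 ≤ μ)
    (hτ : (B + μ + 1) * Real.exp μ * S ≤ τ) (hy : y ∈ closedHalfBall d (1 / 3)) :
    (carlemanJet μ τ A b c y).Bounds θ M := by
  have hB : 0 ≤ B := h.nonneg
  have hS : 1 ≤ S := h.one_le_S
  have hτ0 : 0 ≤ τ := le_trans (by positivity) hτ
  have hfreq : (B + μ + 1) * S * μ ≤ freq μ τ y :=
    calc (B + μ + 1) * S * μ = ((B + μ + 1) * Real.exp μ * S) * μ * Real.exp (-μ) := by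
          rw [Real.exp_neg]
          field_simp
      _ ≤ τ * μ * Real.exp (-μ) := by gcongr
      _ ≤ freq μ τ y := le_freq (by linarith) hτ0 hy.1
  have hBSμ : 0 ≤ B * S * μ := by positivity
  have hsq : μ ^ 2 ≤ freq μ τ y := by nlinarith
  have hS_le : S ≤ freq μ τ y := by nlinarith
  have hb : μ * (B * S) ≤ freq μ τ y := by nlinarith
  have hc : μ * (B * S ^ 2) ≤ freq μ τ y ^ 2 :=
    calc μ * (B * S ^ 2) = (μ * (B * S)) * S := by ring
      _ ≤ freq μ τ y * freq μ τ y :=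
        mul_le_mul hb hS_le (by positivity) ((sq_nonneg μ).trans hsq)
      _ = freq μ τ y ^ 2 := by ring
  have hμ0 : 0 ≤ μ := zero_le_one.trans hμ
  exact {
    pos := h.pos
    one_le := h.one_le_M
    one_le_μ := hμ
    sq_μ_le := hsq
    symm := h.symm
    coercive := h.coercive
    norm_A_le := h.norm_A_le
    norm_A'_le := h.norm_fderiv_A_le
    two_le_norm_n := le_norm_phaseGrad hy.2
    norm_n_le := norm_phaseGrad_le hy.1
    μ_mul_norm_b_le := (mul_le_mul_of_nonneg_left h.norm_b_le hμ0).trans hb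
    μ_mul_norm_b'_le := (mul_le_mul_of_nonneg_left h.norm_fderiv_b_le hμ0).trans hb
    μ_mul_abs_c_le := (mul_le_mul_of_nonneg_left h.abs_c_le hμ0).trans hc
    μ_mul_norm_c'_le := (mul_le_mul_of_nonneg_left h.norm_fderiv_c_le hμ0).trans hc }

end weightBounds

section commutator

variable {E : Type*} [NormedAddCommGroup E] [InnerProductSpace ℝ E] [FiniteDimensional ℝ E]
  {A : E → E →L[ℝ] E} {b : E → E} {c u χ : E → ℝ} {y : E}

/-- The commutator of `nondivOp A b c` with multiplication by `χ`, applied to `u`. It does not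
involve `c`. -/
noncomputable def cutoffCommutator (A : E → E →L[ℝ] E) (b : E → E) (χ u : E → ℝ) (y : E) : ℝ :=
  (⟪b y, ∇ χ y⟫_ℝ - traceL ((A y).comp (hess χ y))) * u y - 2 * ⟪A y (∇ χ y), ∇ u y⟫_ℝ

lemma nondivOp_mul (hχ : ContDiff ℝ 2 χ) (hu : ContDiff ℝ 2 u)
    (hA : (A y : E →ₗ[ℝ] E).IsSymmetric) :
    nondivOp A b c (fun x => χ x * u x) y
      = χ y * nondivOp A b c u y + cutoffCommutator A b χ u y := by
  rw [nondivOp, nondivOp, cutoffCommutator, traceL_comp_hess_mul hχ hu y hA,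
    gradient_mul (hχ.differentiable two_ne_zero y) (hu.differentiable two_ne_zero y),
    inner_add_right, real_inner_smul_right, real_inner_smul_right]
  ring

lemma CoeffBounds.abs_cutoffCommutator_le {θ M B S C : ℝ} (h : CoeffBounds θ M B S A b c y)
    (hgrad : ‖∇ χ y‖ ≤ C) (hhess : ‖hess χ y‖ ≤ C) :
    |cutoffCommutator A b χ u y|
      ≤ (B + (Module.finrank ℝ E + 2) * M) * C * S * (|u y| + ‖∇ u y‖) := by
  have hC : 0 ≤ C := (norm_nonneg _).trans hgrad
  have hB : 0 ≤ B := h.nonneg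
  have hM : 0 ≤ M := zero_le_one.trans h.one_le_M
  have hS : 1 ≤ S := h.one_le_S
  have hdrift : |⟪b y, ∇ χ y⟫_ℝ| ≤ B * C * S :=
    calc |⟪b y, ∇ χ y⟫_ℝ| ≤ ‖b y‖ * ‖∇ χ y‖ := abs_real_inner_le_norm _ _
      _ ≤ (B * S) * C := by gcongr; exact h.norm_b_le
      _ = B * C * S := by ring
  have htrace : |traceL ((A y).comp (hess χ y))| ≤ Module.finrank ℝ E * M * C * S :=
    calc |traceL ((A y).comp (hess χ y))| ≤ Module.finrank ℝ E * (‖A y‖ * ‖hess χ y‖) :=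
        (abs_traceL_le _).trans (by gcongr; exact (A y).opNorm_comp_le _)
      _ ≤ Module.finrank ℝ E * (M * C) := by gcongr; exact h.norm_A_le
      _ = Module.finrank ℝ E * M * C * 1 := by ring
      _ ≤ Module.finrank ℝ E * M * C * S := by gcongr
  have hcross : |⟪A y (∇ χ y), ∇ u y⟫_ℝ| ≤ M * C * S * ‖∇ u y‖ :=
    calc |⟪A y (∇ χ y), ∇ u y⟫_ℝ| ≤ ‖A y‖ * ‖∇ χ y‖ * ‖∇ u y‖ := abs_inner_apply_le _ _ _
      _ ≤ (M * C * 1) * ‖∇ u y‖ := by rw [mul_one]; gcongr; exact h.norm_A_le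
      _ ≤ M * C * S * ‖∇ u y‖ := by gcongr
  calc |cutoffCommutator A b χ u y|
      ≤ (|⟪b y, ∇ χ y⟫_ℝ| + |traceL ((A y).comp (hess χ y))|) * |u y|
        + 2 * |⟪A y (∇ χ y), ∇ u y⟫_ℝ| := by
        rw [cutoffCommutator]
        refine (abs_sub _ _).trans ?_
        rw [abs_mul, abs_mul 2, abs_two]
        gcongr
        exact abs_sub _ _
    _ ≤ (B * C * S + Module.finrank ℝ E * M * C * S) * |u y| + 2 * (M * C * S * ‖∇ u y‖) := by
        gcongr
    _ ≤ (B * C * S + Module.finrank ℝ E * M * C * S) * |u y| + 2 * (M * C * S * ‖∇ u y‖)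
        + (2 * M * C * S * |u y| + (B + Module.finrank ℝ E * M) * C * S * ‖∇ u y‖) :=
        le_add_of_nonneg_right (by positivity)
    _ = (B + (Module.finrank ℝ E + 2) * M) * C * S * (|u y| + ‖∇ u y‖) := by ring

lemma CoeffBounds.sq_cutoffCommutator_le {θ M B S C : ℝ} (h : CoeffBounds θ M B S A b c y)
    (hgrad : ‖∇ χ y‖ ≤ C) (hhess : ‖hess χ y‖ ≤ C) :
    cutoffCommutator A b χ u y ^ 2 ≤ 2 * (B + (Module.finrank ℝ E + 2) * M) ^ 2 * C ^ 2 * S ^ 2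
      * (u y ^ 2 + ‖∇ u y‖ ^ 2) :=
  calc cutoffCommutator A b χ u y ^ 2
      ≤ ((B + (Module.finrank ℝ E + 2) * M) * C * S * (|u y| + ‖∇ u y‖)) ^ 2 := by
        rw [← sq_abs]
        gcongr
        exact h.abs_cutoffCommutator_le hgrad hhess
    _ = ((B + (Module.finrank ℝ E + 2) * M) * C * S) ^ 2 * (|u y| + ‖∇ u y‖) ^ 2 := mul_pow _ _ 2
    _ ≤ ((B + (Module.finrank ℝ E + 2) * M) * C * S) ^ 2
        * (2 * (|u y| ^ 2 + ‖∇ u y‖ ^ 2)) := by gcongr; exact add_sq_le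
    _ = _ := by rw [sq_abs]; ring

end commutator

section cutoff

variable {d : ℕ} {A : Rn d → Rn d →L[ℝ] Rn d} {b : Rn d → Rn d} {c u : Rn d → ℝ} {y : Rn d}
  {θ M B S C μ τ : ℝ}

/-- A smooth cutoff equal to `1` on the ball of radius `1/4` and supported in the ball of radius
`29/100`, used to localize the Carleman estimate. -/
noncomputable def cutoff (d : ℕ) : ContDiffBump (0 : Rn d) :=
  ⟨1 / 4, 29 / 100, by norm_num, by norm_num⟩

lemma exists_cutoff_bound (d : ℕ) :
    ∃ C, ∀ y : Rn d, ‖∇ (cutoff d) y‖ ≤ C ∧ ‖hess (cutoff d) y‖ ≤ C := by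
  have hg : ContDiff ℝ 1 (∇ (cutoff d)) := contDiff_gradient (cutoff d).contDiff le_rfl
  have hgc : HasCompactSupport (∇ (cutoff d)) :=
    HasCompactSupport.intro (cutoff d).hasCompactSupport
      fun _ hy => gradient_eq_zero_of_notMem_tsupport hy
  obtain ⟨C₁, h₁⟩ := hg.continuous.bounded_above_of_compact_support hgc
  obtain ⟨C₂, h₂⟩ := (hg.continuous_fderiv one_ne_zero).bounded_above_of_compact_support
    (hgc.fderiv (𝕜 := ℝ))
  exact ⟨max C₁ C₂, fun y => ⟨(h₁ y).trans (le_max_left _ _), (h₂ y).trans (le_max_right _ _)⟩⟩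

lemma cutoff_eq_one (hy : ‖y‖ ≤ 1 / 4) : cutoff d y = 1 :=
  (cutoff d).one_of_mem_closedBall (mem_closedBall_zero_iff.2 hy)

lemma cutoffCommutator_cutoff_eq_zero (hy : ‖y‖ < 1 / 4) :
    cutoffCommutator A b (cutoff d) u y = 0 := by
  have hgrad : ∇ (cutoff d) =ᶠ[nhds y] fun _ => 0 := by
    filter_upwards [(isOpen_lt continuous_norm continuous_const).eventually_mem hy] with z hz
    have hone : (cutoff d : Rn d → ℝ) =ᶠ[nhds z] fun _ => 1 := by
      filter_upwards [(isOpen_lt continuous_norm continuous_const).eventually_mem hz] with x hx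
      exact cutoff_eq_one (le_of_lt hx)
    rw [hone.gradient_eq, gradient_fun_const]
  simp [cutoffCommutator, hess, hgrad.fderiv_eq, hgrad.self_of_nhds]

lemma tsupport_cutoff_mul (u : Rn d → ℝ) :
    tsupport (fun x => cutoff d x * u x) ⊆ Metric.closedBall 0 (29 / 100) :=
  (tsupport_mul_subset_left (f := cutoff d)).trans (cutoff d).tsupport_eq.subset

lemma norm_le_of_mem_tsupport_cutoff_mul (hy : y ∈ tsupport fun x => cutoff d x * u x) :
    ‖y‖ ≤ 29 / 100 :=
  mem_closedBall_zero_iff.1 (tsupport_cutoff_mul u hy)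

lemma hasCompactSupport_cutoff_mul (u : Rn d → ℝ) :
    HasCompactSupport fun x => cutoff d x * u x :=
  (cutoff d).hasCompactSupport.mul_right

lemma sq_weight_mul_cutoffCommutator_le (h : CoeffBounds θ M B S A b c y) (hμ : 0 ≤ μ)
    (hτ : 0 ≤ τ) (hC : ‖∇ (cutoff d) y‖ ≤ C ∧ ‖hess (cutoff d) y‖ ≤ C)
    (hy : 0 ≤ y (Fin.last d)) :
    (weight μ τ y * cutoffCommutator A b (cutoff d) u y) ^ 2
      ≤ Real.exp (2 * (τ * Real.exp (μ * -(1 / 16))))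
        * (2 * (B + (Module.finrank ℝ (Rn d) + 2) * M) ^ 2 * C ^ 2 * S ^ 2
          * (u y ^ 2 + ‖∇ u y‖ ^ 2)) := by
  rcases lt_or_ge ‖y‖ (1 / 4) with hin | hout
  · rw [cutoffCommutator_cutoff_eq_zero hin, mul_zero, zero_pow two_ne_zero]
    positivity
  · rw [mul_pow, ← exp_sq]
    gcongr
    · exact (weight_pos μ τ y).le
    · exact weight_le hμ hτ (phase_le_of_le_norm hout hy)
    · exact h.sq_cutoffCommutator_le hC.1 hC.2

lemma sq_weight_mul_nondivOp_cutoff_le (h : CoeffBounds θ M B S A b c y) (hμ : 0 ≤ μ)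
    (hτ : 0 ≤ τ) (hu : ContDiff ℝ 2 u) (hC : ‖∇ (cutoff d) y‖ ≤ C ∧ ‖hess (cutoff d) y‖ ≤ C)
    (hy : 0 ≤ y (Fin.last d)) :
    (weight μ τ y * nondivOp A b c (fun x => cutoff d x * u x) y) ^ 2
      ≤ 2 * Real.exp (2 * τ) * nondivOp A b c u y ^ 2
        + 4 * (B + (Module.finrank ℝ (Rn d) + 2) * M) ^ 2 * C ^ 2 * S ^ 2
          * Real.exp (2 * (τ * Real.exp (μ * -(1 / 16)))) * (u y ^ 2 + ‖∇ u y‖ ^ 2) := by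
  have hmain : (weight μ τ y * (cutoff d y * nondivOp A b c u y)) ^ 2
      ≤ Real.exp (2 * τ) * nondivOp A b c u y ^ 2 := by
    rw [← mul_assoc, mul_pow, ← exp_sq]
    gcongr
    · exact mul_nonneg (weight_pos μ τ y).le (cutoff d).nonneg
    · exact (mul_le_of_le_one_right (weight_pos μ τ y).le (cutoff d).le_one).trans
        (weight_le_exp hμ hτ hy)
  calc (weight μ τ y * nondivOp A b c (fun x => cutoff d x * u x) y) ^ 2
      = (weight μ τ y * (cutoff d y * nondivOp A b c u y)
          + weight μ τ y * cutoffCommutator A b (cutoff d) u y) ^ 2 := by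
        rw [nondivOp_mul (cutoff d).contDiff hu h.symm, mul_add]
    _ ≤ 2 * ((weight μ τ y * (cutoff d y * nondivOp A b c u y)) ^ 2
          + (weight μ τ y * cutoffCommutator A b (cutoff d) u y) ^ 2) := add_sq_le
    _ ≤ 2 * (Real.exp (2 * τ) * nondivOp A b c u y ^ 2
          + Real.exp (2 * (τ * Real.exp (μ * -(1 / 16))))
            * (2 * (B + (Module.finrank ℝ (Rn d) + 2) * M) ^ 2 * C ^ 2 * S ^ 2
              * (u y ^ 2 + ‖∇ u y‖ ^ 2))) := by
        gcongr
        exact sq_weight_mul_cutoffCommutator_le h hμ hτ hC hy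
    _ = _ := by ring

lemma norm_gradient_cutoff_mul_le (hu : ContDiff ℝ 1 u) (hC : ‖∇ (cutoff d) y‖ ≤ C) :
    ‖∇ (fun x => cutoff d x * u x) y‖ ≤ ‖∇ u y‖ + C * |u y| := by
  have hcut : DifferentiableAt ℝ (cutoff d) y := (cutoff d).contDiffAt.differentiableAt one_ne_zero
  rw [gradient_mul hcut (hu.differentiable one_ne_zero y)]
  refine (norm_add_le _ _).trans ?_
  rw [norm_smul, norm_smul, Real.norm_of_nonneg (cutoff d).nonneg, Real.norm_eq_abs, mul_comm C]
  gcongr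
  exact mul_le_of_le_one_left (norm_nonneg _) (cutoff d).le_one

lemma abs_cutoff_mul_le (u : Rn d → ℝ) (y : Rn d) : |cutoff d y * u y| ≤ |u y| := by
  rw [abs_mul, abs_of_nonneg (cutoff d).nonneg]
  exact mul_le_of_le_one_left (abs_nonneg _) (cutoff d).le_one

lemma norm_gradient_weight_mul_cutoff_mul_le (hμ : 0 ≤ μ) (hτ : 0 ≤ τ) (hμτ : 1 ≤ τ * μ)
    (hu : ContDiff ℝ 1 u) (hC : ‖∇ (cutoff d) y‖ ≤ C) (hy : y ∈ closedHalfBall d (1 / 3)) :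
    ‖∇ (fun x => weight μ τ x * (cutoff d x * u x)) y‖
      ≤ Real.exp τ * (τ * μ) * (‖∇ u y‖ + (C + 3) * |u y|) := by
  have hC0 : 0 ≤ C := (norm_nonneg _).trans hC
  have hw : 0 ≤ weight μ τ y := (weight_pos μ τ y).le
  have hv : ContDiff ℝ 1 fun x => cutoff d x * u x := (cutoff d).contDiff.mul hu
  have hwexp : weight μ τ y ≤ Real.exp τ := weight_le_exp hμ hτ hy.2
  have hfreq0 : 0 ≤ freq μ τ y := freq_nonneg hμ hτ y
  have hfreq : freq μ τ y ≤ τ * μ := freq_le hμ hτ hy.2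
  have hphase : ‖phaseGrad y‖ ≤ 3 := norm_phaseGrad_le hy.1
  have habs : |cutoff d y * u y| ≤ |u y| := abs_cutoff_mul_le u y
  have hgrad : ‖∇ (fun x => cutoff d x * u x) y‖ ≤ ‖∇ u y‖ + C * |u y| :=
    norm_gradient_cutoff_mul_le hu hC
  rw [gradient_mul ((contDiff_weight (n := 1) μ τ).differentiable one_ne_zero y)
    (hv.differentiable one_ne_zero y), gradient_weight]
  refine (norm_add_le _ _).trans ?_
  rw [norm_smul, norm_smul, norm_smul, Real.norm_of_nonneg hw,
    Real.norm_of_nonneg (mul_nonneg hfreq0 hw), Real.norm_eq_abs]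
  calc weight μ τ y * ‖∇ (fun x => cutoff d x * u x) y‖
        + |cutoff d y * u y| * (freq μ τ y * weight μ τ y * ‖phaseGrad y‖)
      ≤ Real.exp τ * (‖∇ u y‖ + C * |u y|) + |u y| * ((τ * μ) * Real.exp τ * 3) := by
        gcongr
    _ ≤ Real.exp τ * (‖∇ u y‖ + C * |u y|) * (τ * μ) + |u y| * ((τ * μ) * Real.exp τ * 3) :=
        add_le_add_left (le_mul_of_one_le_right (by positivity) hμτ) _
    _ = Real.exp τ * (τ * μ) * (‖∇ u y‖ + (C + 3) * |u y|) := by ring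

lemma sq_add_mul_le {a b C : ℝ} (hC : 1 ≤ C) :
    (a + C * |b|) ^ 2 ≤ 2 * C ^ 2 * (b ^ 2 + a ^ 2) :=
  calc (a + C * |b|) ^ 2 ≤ 2 * (a ^ 2 + (C * |b|) ^ 2) := add_sq_le
    _ = 2 * (1 * a ^ 2 + C ^ 2 * b ^ 2) := by rw [mul_pow, sq_abs, one_mul]
    _ ≤ 2 * (C ^ 2 * a ^ 2 + C ^ 2 * b ^ 2) := by gcongr; exact one_le_pow₀ hC
    _ = 2 * C ^ 2 * (b ^ 2 + a ^ 2) := by ring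

lemma carleman_boundary_term_le (hμ : 0 ≤ μ) (hτ : 0 ≤ τ) (hT : 1 ≤ freq μ τ y)
    (hu : ContDiff ℝ 1 u) (hC : ‖∇ (cutoff d) y‖ ≤ C) (hy : y ∈ closedHalfBall d (1 / 3)) :
    freq μ τ y * ‖∇ (fun x => weight μ τ x * (cutoff d x * u x)) y‖ ^ 2
        + freq μ τ y ^ 3 * (weight μ τ y * (cutoff d y * u y)) ^ 2
      ≤ (τ * μ) ^ 3 * Real.exp (2 * τ) * (2 * (C + 3) ^ 2 + 1) * (u y ^ 2 + ‖∇ u y‖ ^ 2) := by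
  have hC0 : 0 ≤ C := (norm_nonneg _).trans hC
  have hfreq : freq μ τ y ≤ τ * μ := freq_le hμ hτ hy.2
  have hvalue : (weight μ τ y * (cutoff d y * u y)) ^ 2 ≤ (Real.exp τ * |u y|) ^ 2 := by
    rw [← sq_abs, abs_mul, abs_of_pos (weight_pos μ τ y)]
    exact pow_le_pow_left₀ (by have := weight_pos μ τ y; positivity) (mul_le_mul
      (weight_le_exp hμ hτ hy.2) (abs_cutoff_mul_le u y) (abs_nonneg _) (Real.exp_pos τ).le) 2
  calc _ ≤ (τ * μ) * (Real.exp τ * (τ * μ) * (‖∇ u y‖ + (C + 3) * |u y|)) ^ 2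
        + (τ * μ) ^ 3 * (Real.exp τ * |u y|) ^ 2 := by
        have hgrad := norm_gradient_weight_mul_cutoff_mul_le hμ hτ (hT.trans hfreq) hu hC hy
        gcongr
    _ = (τ * μ) ^ 3 * Real.exp (2 * τ) * ((‖∇ u y‖ + (C + 3) * |u y|) ^ 2 + u y ^ 2) := by
        rw [← exp_sq, mul_pow (Real.exp τ) |u y|, sq_abs]
        ring
    _ ≤ (τ * μ) ^ 3 * Real.exp (2 * τ) * (2 * (C + 3) ^ 2 * (u y ^ 2 + ‖∇ u y‖ ^ 2)
          + (u y ^ 2 + ‖∇ u y‖ ^ 2)) := by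
        gcongr
        · exact sq_add_mul_le (by linarith)
        · exact le_add_of_nonneg_right (sq_nonneg _)
    _ = _ := by ring

end cutoff

section carlemanCutoff

variable {d : ℕ} {A : Rn d → Rn d →L[ℝ] Rn d} {b : Rn d → Rn d} {c u : Rn d → ℝ}
  {θ M B S C μ τ : ℝ}

lemma setIntegral_halfBall_mono {f : Rn d → ℝ} (hf : Continuous f) (hf0 : ∀ y, 0 ≤ f y)
    {r s : ℝ} (hrs : r ≤ s) : ∫ y in halfBall d r, f y ≤ ∫ y in halfBall d s, f y :=
  setIntegral_mono_set (integrableOn_halfBall hf s) (.of_forall hf0)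
    (.of_forall fun _ hy => ⟨hy.1.trans_le hrs, hy.2⟩)

lemma integral_halfBall_le_integral_weight (hμ : 0 ≤ μ) (hτ : 0 ≤ τ) (hu : ContDiff ℝ 2 u)
    (hT : ∀ y ∈ closedHalfBall d (1 / 3), 1 ≤ freq μ τ y) :
    Real.exp (2 * (τ * Real.exp (μ * -(1 / 100)))) * (∫ y in halfBall d (1 / 256), u y ^ 2)
      ≤ ∫ y in upperHalf d, freq μ τ y ^ 3 * (weight μ τ y * (cutoff d y * u y)) ^ 2 := by
  have hint : Integrable fun y => freq μ τ y ^ 3 * (weight μ τ y * (cutoff d y * u y)) ^ 2 :=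
    Continuous.integrable_of_hasCompactSupport
      (((contDiff_freq (n := 0) μ τ).continuous.pow 3).mul
        (((contDiff_weight (n := 0) μ τ).continuous.mul
          ((cutoff d).continuous.mul hu.continuous)).pow 2))
      (HasCompactSupport.intro (cutoff d).hasCompactSupport fun y hy => by
        simp [image_eq_zero_of_notMem_tsupport hy])
  rw [← integral_const_mul]
  calc ∫ y in halfBall d (1 / 256), Real.exp (2 * (τ * Real.exp (μ * -(1 / 100)))) * u y ^ 2
      ≤ ∫ y in halfBall d (1 / 256), freq μ τ y ^ 3 * (weight μ τ y * (cutoff d y * u y)) ^ 2 := by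
        refine setIntegral_mono_on (integrableOn_halfBall (by fun_prop) _)
          hint.integrableOn (isOpen_halfBall d _).measurableSet fun y hy => ?_
        have hy0 : ‖y‖ ≤ 1 / 256 := le_of_lt hy.1
        have hfreq : 1 ≤ freq μ τ y ^ 3 :=
          one_le_pow₀ (hT y ⟨hy0.trans (by norm_num), le_of_lt hy.2⟩)
        rw [cutoff_eq_one (hy0.trans (by norm_num)), one_mul, ← exp_sq, ← mul_pow]
        refine le_trans ?_ (le_mul_of_one_le_left (sq_nonneg _) hfreq)
        rw [mul_pow, mul_pow]
        gcongr
        exact le_weight hμ hτ (le_phase_of_norm_le hy0)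
    _ ≤ ∫ y in upperHalf d, freq μ τ y ^ 3 * (weight μ τ y * (cutoff d y * u y)) ^ 2 :=
        setIntegral_mono_set hint.integrableOn
          (.of_forall fun y => mul_nonneg (pow_nonneg (freq_nonneg hμ hτ y) 3) (sq_nonneg _))
          (.of_forall fun y hy => hy.2)

lemma integral_sq_weight_mul_nondivOp_cutoff_le (hμ : 0 ≤ μ) (hτ : 0 ≤ τ) (hA : Continuous A)
    (hb : Continuous b) (hc : Continuous c) (hu : ContDiff ℝ 2 u)
    (hC : ∀ y : Rn d, ‖∇ (cutoff d) y‖ ≤ C ∧ ‖hess (cutoff d) y‖ ≤ C)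
    (hbd : ∀ y ∈ closedHalfBall d (1 / 3), CoeffBounds θ M B S A b c y) :
    ∫ y in upperHalf d, (weight μ τ y * nondivOp A b c (fun x => cutoff d x * u x) y) ^ 2
      ≤ 2 * Real.exp (2 * τ) * (∫ y in halfBall d (1 / 3), nondivOp A b c u y ^ 2)
        + 4 * (B + (Module.finrank ℝ (Rn d) + 2) * M) ^ 2 * C ^ 2 * S ^ 2
          * Real.exp (2 * (τ * Real.exp (μ * -(1 / 16))))
          * ((∫ y in halfBall d (1 / 3), u y ^ 2) + ∫ y in halfBall d (3 / 10), ‖∇ u y‖ ^ 2) := by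
  set L : Rn d → ℝ := nondivOp A b c (fun x => cutoff d x * u x) with hL
  set W := 4 * (B + (Module.finrank ℝ (Rn d) + 2) * M) ^ 2 * C ^ 2 * S ^ 2
    * Real.exp (2 * (τ * Real.exp (μ * -(1 / 16))))
  have : 0 ≤ W := by positivity
  have hLv : Continuous L := continuous_nondivOp hA hb hc ((cutoff d).contDiff.mul hu)
  have hu2 : Continuous fun y => u y ^ 2 := hu.continuous.pow 2
  have hLu2 : Continuous fun y => nondivOp A b c u y ^ 2 := (continuous_nondivOp hA hb hc hu).pow 2
  have hgrad2 : Continuous fun y => ‖∇ u y‖ ^ 2 :=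
    (contDiff_gradient (m := 1) hu (by norm_num)).continuous.norm.pow 2
  have hint : Integrable fun y => (weight μ τ y * L y) ^ 2 :=
    Continuous.integrable_of_hasCompactSupport
      (((contDiff_weight (n := 0) μ τ).continuous.mul hLv).pow 2)
      (HasCompactSupport.intro (hasCompactSupport_cutoff_mul u) fun y hy => by
        simp [hL, nondivOp_eq_zero_of_notMem_tsupport hy])
  have hzero : ∀ y ∈ upperHalf d \ halfBall d (3 / 10), (weight μ τ y * L y) ^ 2 = 0 := by
    intro y hy
    rw [hL, nondivOp_eq_zero_of_notMem_tsupport fun h => hy.2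
      ⟨(norm_le_of_mem_tsupport_cutoff_mul h).trans_lt (by norm_num), hy.1⟩, mul_zero,
      zero_pow two_ne_zero]
  calc ∫ y in upperHalf d, (weight μ τ y * L y) ^ 2
      = ∫ y in halfBall d (3 / 10), (weight μ τ y * L y) ^ 2 :=
        setIntegral_eq_of_subset_of_forall_sdiff_eq_zero measurableSet_upperHalf
          (fun _ hy => hy.2) hzero
    _ ≤ ∫ y in halfBall d (3 / 10), (2 * Real.exp (2 * τ) * nondivOp A b c u y ^ 2
          + W * (u y ^ 2 + ‖∇ u y‖ ^ 2)) :=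
        setIntegral_mono_on hint.integrableOn (integrableOn_halfBall (by fun_prop) _)
          (isOpen_halfBall d _).measurableSet fun y hy => sq_weight_mul_nondivOp_cutoff_le
            (hbd y ⟨hy.1.le.trans (by norm_num), hy.2.le⟩) hμ hτ hu (hC y) hy.2.le
    _ = 2 * Real.exp (2 * τ) * (∫ y in halfBall d (3 / 10), nondivOp A b c u y ^ 2)
          + W * ((∫ y in halfBall d (3 / 10), u y ^ 2)
            + ∫ y in halfBall d (3 / 10), ‖∇ u y‖ ^ 2) := by
        rw [integral_add (integrableOn_halfBall (by fun_prop) _)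
          (integrableOn_halfBall (by fun_prop) _), integral_const_mul, integral_const_mul,
          integral_add (integrableOn_halfBall hu2 _) (integrableOn_halfBall hgrad2 _)]
    _ ≤ _ := by
        gcongr ?_ * ?_ + ?_ * (?_ + ?_)
        · exact setIntegral_halfBall_mono hLu2 (fun _ => sq_nonneg _) (by norm_num)
        · exact setIntegral_halfBall_mono hu2 (fun _ => sq_nonneg _) (by norm_num)
        · exact le_rfl

lemma integral_carleman_boundary_term_le (hμ : 0 ≤ μ) (hτ : 0 ≤ τ) (hu : ContDiff ℝ 2 u)
    (hT : ∀ y ∈ closedHalfBall d (1 / 3), 1 ≤ freq μ τ y)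
    (hC : ∀ y : Rn d, ‖∇ (cutoff d) y‖ ≤ C ∧ ‖hess (cutoff d) y‖ ≤ C) :
    ∫ y' : Rn' d, (freq μ τ (flatPoint y')
          * ‖∇ (fun x => weight μ τ x * (cutoff d x * u x)) (flatPoint y')‖ ^ 2
        + freq μ τ (flatPoint y') ^ 3
          * (weight μ τ (flatPoint y') * (cutoff d (flatPoint y') * u (flatPoint y'))) ^ 2)
      ≤ (τ * μ) ^ 3 * Real.exp (2 * τ) * (2 * (C + 3) ^ 2 + 1) * flatData u := by
  set w : Rn d → ℝ := fun x => weight μ τ x * (cutoff d x * u x)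
  have hw : ContDiff ℝ 2 w := (contDiff_weight μ τ).mul ((cutoff d).contDiff.mul hu)
  have hflat : Continuous (flatPoint (d := d)) := isClosedEmbedding_flatPoint.continuous
  have hF : Continuous fun y' : Rn' d => freq μ τ (flatPoint y') * ‖∇ w (flatPoint y')‖ ^ 2
      + freq μ τ (flatPoint y') ^ 3 * w (flatPoint y') ^ 2 := by
    have hfreq := (contDiff_freq (n := 0) (d := d) μ τ).continuous
    have hgrad := (contDiff_gradient (m := 1) hw (by norm_num)).continuous
    have hw' := hw.continuous
    fun_prop
  have hzero : ∀ y' : Rn' d, y' ∉ Metric.ball 0 (1 / 3) →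
      freq μ τ (flatPoint y') * ‖∇ w (flatPoint y')‖ ^ 2
        + freq μ τ (flatPoint y') ^ 3 * w (flatPoint y') ^ 2 = 0 := by
    intro y' hy'
    have hnot : flatPoint y' ∉ tsupport w := fun h => hy' (mem_ball_zero_iff.2 (by
      have := norm_le_of_mem_tsupport_cutoff_mul (tsupport_mul_subset_right h)
      rw [norm_flatPoint] at this
      exact this.trans_lt (by norm_num)))
    simp [gradient_eq_zero_of_notMem_tsupport hnot, image_eq_zero_of_notMem_tsupport hnot]
  rw [← setIntegral_eq_integral_of_forall_compl_eq_zero hzero, flatData, ← integral_const_mul]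
  refine setIntegral_mono_on ((hF.continuousOn.integrableOn_compact
    (isCompact_closedBall 0 (1 / 3))).mono_set Metric.ball_subset_closedBall)
    ((integrableOn_flatData (hu.of_le (by norm_num))).const_mul _) measurableSet_ball
    fun y' hy' => ?_
  have hmem : flatPoint y' ∈ closedHalfBall d (1 / 3) :=
    ⟨(norm_flatPoint y').trans_le (mem_ball_zero_iff.1 hy').le, (flatPoint_last y').ge⟩
  exact carleman_boundary_term_le hμ hτ (hT _ hmem) (hu.of_le (by norm_num)) (hC _).1 hmem

lemma carleman_cutoff (hμ : 1 ≤ μ) (hμM : 2000 * (d + 1) ^ 2 * M ^ 2 ≤ θ ^ 2 * μ)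
    (hτ : (B + μ + 1) * Real.exp μ * S ≤ τ)
    (hC : ∀ y : Rn d, ‖∇ (cutoff d) y‖ ≤ C ∧ ‖hess (cutoff d) y‖ ≤ C)
    (hA : ContDiff ℝ 1 A) (hb : ContDiff ℝ 1 b) (hc : ContDiff ℝ 1 c) (hu : ContDiff ℝ 2 u)
    (hbd : ∀ y ∈ closedHalfBall d (1 / 3), CoeffBounds θ M B S A b c y) :
    Real.exp (2 * (τ * Real.exp (μ * -(1 / 100)))) * (∫ y in halfBall d (1 / 256), u y ^ 2)
      ≤ 12 * Real.exp (2 * τ) * (∫ y in halfBall d (1 / 3), nondivOp A b c u y ^ 2)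
        + 24 * (B + (Module.finrank ℝ (Rn d) + 2) * M) ^ 2 * C ^ 2 * S ^ 2
          * Real.exp (2 * (τ * Real.exp (μ * -(1 / 16))))
          * ((∫ y in halfBall d (1 / 3), u y ^ 2) + ∫ y in halfBall d (3 / 10), ‖∇ u y‖ ^ 2)
        + 109 * M ^ 2 * ((τ * μ) ^ 3 * Real.exp (2 * τ) * (2 * (C + 3) ^ 2 + 1))
          * flatData u := by
  have hμ0 : 0 ≤ μ := zero_le_one.trans hμ
  have h0 : CoeffBounds θ M B S A b c 0 := hbd 0 ⟨by simp, by simp⟩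
  have hB : 0 ≤ B := h0.nonneg
  have hS : 1 ≤ S := h0.one_le_S
  have hτ0 : 0 ≤ τ := le_trans (by positivity) hτ
  have hjet : ∀ y ∈ closedHalfBall d (1 / 3), (carlemanJet μ τ A b c y).Bounds θ M :=
    fun y hy => (hbd y hy).carlemanBounds hμ hτ hy
  have hT : ∀ y ∈ closedHalfBall d (1 / 3), 1 ≤ freq μ τ y := fun y hy => (hjet y hy).one_le_T
  have hone : 1 ≤ θ ^ 2 * μ :=
    calc (1 : ℝ) ≤ 2000 * 1 * 1 := by norm_num
      _ ≤ 2000 * (d + 1) ^ 2 * M ^ 2 := by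
        gcongr
        · exact one_le_pow₀ (by simp)
        · exact one_le_pow₀ h0.one_le_M
      _ ≤ θ ^ 2 * μ := hμM
  have hleft := (integral_halfBall_le_integral_weight hμ0 hτ0 hu hT).trans
    (le_mul_of_one_le_left (integral_nonneg fun y =>
      mul_nonneg (pow_nonneg (freq_nonneg hμ0 hτ0 y) 3) (sq_nonneg _)) hone)
  have hcarleman := carleman_estimate hμM hA hb hc ((cutoff d).contDiff.mul hu)
    ((tsupport_cutoff_mul u).trans (Metric.closedBall_subset_closedBall (by norm_num))) hjet
  have hinterior := integral_sq_weight_mul_nondivOp_cutoff_le hμ0 hτ0 hA.continuous hb.continuous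
    hc.continuous hu hC hbd
  have hboundary := mul_le_mul_of_nonneg_left
    (integral_carleman_boundary_term_le hμ0 hτ0 hu hT hC) (show 0 ≤ 109 * M ^ 2 by positivity)
  linarith

end carlemanCutoff

lemma pow_four_le_exp {x : ℝ} (hx : 0 ≤ x) : x ^ 4 ≤ 24 * Real.exp x := by
  have h := Real.pow_div_factorial_le_exp x hx 4
  norm_num only [Nat.factorial] at h
  linarith

section absorption

variable {I U G D L C₁ C₂ C₃ C₄ S τ a b : ℝ}

lemma le_pow_four_mul_of_caccioppoli (hS : 1 ≤ S) (hSτ : S ≤ τ) (ha : 0 ≤ a) (hab : a ≤ b)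
    (hC₁ : 0 ≤ C₁) (hC₂ : 0 ≤ C₂) (hC₃ : 0 ≤ C₃) (hC₄ : 0 ≤ C₄)
    (hU : 0 ≤ U) (hG : 0 ≤ G) (hD : 0 ≤ D) (hL : L ≤ C₄ * (S ^ 2 * U + G + D)) :
    C₁ * b * G + C₂ * S ^ 2 * a * (U + L) + C₃ * (τ ^ 3 * b) * D
      ≤ (C₁ + C₂ * (1 + C₄) + C₃) * τ ^ 4 * (a * U + b * (G + D)) := by
  have hτ : 1 ≤ τ := hS.trans hSτ
  have hb : 0 ≤ b := ha.trans hab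
  have hUL : U + L ≤ (1 + C₄) * (S ^ 2 * (U + G + D)) := by
    have hS2 : 1 ≤ S ^ 2 := one_le_pow₀ hS
    calc U + L ≤ U + C₄ * (S ^ 2 * U + G + D) := by gcongr
      _ ≤ (S ^ 2 * U + S ^ 2 * G + S ^ 2 * D)
          + C₄ * (S ^ 2 * U + S ^ 2 * G + S ^ 2 * D) := by
        gcongr
        · have hU' := le_mul_of_one_le_left hU hS2
          have hG' : 0 ≤ S ^ 2 * G := by positivity
          have hD' : 0 ≤ S ^ 2 * D := by positivity
          linarith
        · exact le_mul_of_one_le_left hG hS2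
        · exact le_mul_of_one_le_left hD hS2
      _ = (1 + C₄) * (S ^ 2 * (U + G + D)) := by ring
  calc C₁ * b * G + C₂ * S ^ 2 * a * (U + L) + C₃ * (τ ^ 3 * b) * D
      ≤ C₁ * b * G + C₂ * S ^ 2 * a * ((1 + C₄) * (S ^ 2 * (U + G + D)))
        + C₃ * (τ ^ 3 * b) * D := by gcongr
    _ = C₁ * (1 * (0 + b * (G + 0))) + C₂ * (1 + C₄) * (S ^ 4 * (a * U + a * (G + D)))
        + C₃ * (τ ^ 3 * (0 + b * (0 + D))) := by ring
    _ ≤ C₁ * (τ ^ 4 * (a * U + b * (G + D))) + C₂ * (1 + C₄) * (τ ^ 4 * (a * U + b * (G + D)))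
        + C₃ * (τ ^ 4 * (a * U + b * (G + D))) := by
      have haU : 0 ≤ a * U := by positivity
      gcongr
      · exact one_le_pow₀ hτ
      · norm_num
    _ = (C₁ + C₂ * (1 + C₄) + C₃) * τ ^ 4 * (a * U + b * (G + D)) := by ring

/-- Once the Carleman weights are divided out, the power of `τ` is absorbed by half of the
exponential gain. -/
lemma le_of_exp_mul_le_pow_four {Z φ₁ φ₂ : ℝ} (hZ : 0 ≤ Z) (hτ : 0 ≤ τ) (hφ : φ₂ < φ₁)
    (hφ₂ : 0 ≤ φ₂) (hU : 0 ≤ U) (hG : 0 ≤ G)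
    (h : Real.exp (2 * (τ * φ₁)) * I
      ≤ Z * τ ^ 4 * (Real.exp (2 * (τ * φ₂)) * U + Real.exp (2 * τ) * G)) :
    I ≤ Z * (24 / (φ₁ - φ₂) ^ 4)
      * (Real.exp (-(φ₁ - φ₂) * τ) * U + Real.exp (3 * τ) * G) := by
  have : 0 < φ₁ - φ₂ := sub_pos.2 hφ
  have hτ4 : τ ^ 4 ≤ 24 / (φ₁ - φ₂) ^ 4 * Real.exp ((φ₁ - φ₂) * τ) := by
    have := pow_four_le_exp (x := (φ₁ - φ₂) * τ) (by positivity)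
    rw [mul_pow] at this
    rw [div_mul_eq_mul_div, le_div_iff₀ (by positivity)]
    linarith
  calc I = Real.exp (-(2 * (τ * φ₁))) * (Real.exp (2 * (τ * φ₁)) * I) := by
        rw [← mul_assoc, ← Real.exp_add, neg_add_cancel, Real.exp_zero, one_mul]
    _ ≤ Real.exp (-(2 * (τ * φ₁)))
        * (Z * τ ^ 4 * (Real.exp (2 * (τ * φ₂)) * U + Real.exp (2 * τ) * G)) := by gcongr
    _ ≤ Real.exp (-(2 * (τ * φ₁))) * (Z * (24 / (φ₁ - φ₂) ^ 4 * Real.exp ((φ₁ - φ₂) * τ))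
          * (Real.exp (2 * (τ * φ₂)) * U + Real.exp (2 * τ) * G)) := by gcongr
    _ = Z * (24 / (φ₁ - φ₂) ^ 4)
        * (Real.exp (-(2 * (τ * φ₁)) + (φ₁ - φ₂) * τ + 2 * (τ * φ₂)) * U
          + Real.exp (-(2 * (τ * φ₁)) + (φ₁ - φ₂) * τ + 2 * τ) * G) := by
        simp only [Real.exp_add]
        ring
    _ ≤ Z * (24 / (φ₁ - φ₂) ^ 4)
        * (Real.exp (-(φ₁ - φ₂) * τ) * U + Real.exp (3 * τ) * G) := by
        gcongr <;> nlinarith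

end absorption

lemma carleman_cutoff_of_caccioppoli {d : ℕ} {μ τ θ M B S C C₄ : ℝ}
    {A : Rn d → Rn d →L[ℝ] Rn d} {b : Rn d → Rn d} {c u : Rn d → ℝ} (hμ : 1 ≤ μ)
    (hμM : 2000 * (d + 1) ^ 2 * M ^ 2 ≤ θ ^ 2 * μ) (hτ : (B + μ + 1) * Real.exp μ * S ≤ τ)
    (hC : ∀ y : Rn d, ‖∇ (cutoff d) y‖ ≤ C ∧ ‖hess (cutoff d) y‖ ≤ C) (hC₄ : 0 ≤ C₄)
    (hA : ContDiff ℝ 1 A) (hb : ContDiff ℝ 1 b) (hc : ContDiff ℝ 1 c) (hu : ContDiff ℝ 2 u)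
    (hbd : ∀ y ∈ closedHalfBall d (1 / 3), CoeffBounds θ M B S A b c y)
    (hcaccioppoli : ∫ y in halfBall d (3 / 10), ‖∇ u y‖ ^ 2
      ≤ C₄ * (S ^ 2 * (∫ y in halfBall d (1 / 3), u y ^ 2)
        + (∫ y in halfBall d (1 / 3), nondivOp A b c u y ^ 2) + flatData u)) :
    Real.exp (2 * (τ * Real.exp (μ * -(1 / 100)))) * (∫ y in halfBall d (1 / 256), u y ^ 2)
      ≤ (12 + 24 * (B + (Module.finrank ℝ (Rn d) + 2) * M) ^ 2 * C ^ 2 * (1 + C₄)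
          + 109 * M ^ 2 * (μ ^ 3 * (2 * (C + 3) ^ 2 + 1))) * τ ^ 4
        * (Real.exp (2 * (τ * Real.exp (μ * -(1 / 16)))) * (∫ y in halfBall d (1 / 3), u y ^ 2)
          + Real.exp (2 * τ) * ((∫ y in halfBall d (1 / 3), nondivOp A b c u y ^ 2)
            + flatData u)) := by
  have h0 : CoeffBounds θ M B S A b c 0 := hbd 0 ⟨by simp, by simp⟩
  have hB : 0 ≤ B := h0.nonneg
  have hS : 1 ≤ S := h0.one_le_S
  have hSτ : S ≤ τ := (le_mul_of_one_le_left (by linarith) (one_le_mul_of_one_le_of_one_le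
    (by linarith) (Real.one_le_exp (by linarith)))).trans hτ
  have hweights : Real.exp (2 * (τ * Real.exp (μ * -(1 / 16)))) ≤ Real.exp (2 * τ) := by
    gcongr
    exact mul_le_of_le_one_right (by linarith) (Real.exp_le_one_iff.2 (by linarith))
  exact (carleman_cutoff hμ hμM hτ hC hA hb hc hu hbd).trans
    ((show _ = _ by ring).trans_le (le_pow_four_mul_of_caccioppoli
      (C₁ := 12) (C₂ := 24 * (B + (Module.finrank ℝ (Rn d) + 2) * M) ^ 2 * C ^ 2)
      (C₃ := 109 * M ^ 2 * (μ ^ 3 * (2 * (C + 3) ^ 2 + 1))) hS hSτ (Real.exp_pos _).le hweights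
      (by norm_num) (by positivity) (by positivity) hC₄ (integral_nonneg fun y => sq_nonneg _)
      (integral_nonneg fun y => sq_nonneg _) (flatData_nonneg u) hcaccioppoli))

theorem carleman_caccioppoli_estimate {d : ℕ} {θ M B : ℝ} (hθ : 0 < θ) (hB : 0 ≤ B)
    (hM : 1 ≤ M) : ∃ C g : ℝ, 0 < C ∧ 0 < g ∧
      ∀ (S : ℝ) (A : Rn d → Rn d →L[ℝ] Rn d) (b : Rn d → Rn d) (c u : Rn d → ℝ),
      ContDiff ℝ 1 A → ContDiff ℝ 1 b → ContDiff ℝ 1 c → ContDiff ℝ 2 u →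
      (∀ y ∈ closedHalfBall d (1 / 3), CoeffBounds θ M B S A b c y) →
      ∀ τ, C * S ≤ τ → ∫ y in halfBall d (1 / 256), u y ^ 2
        ≤ C * (Real.exp (-g * τ) * (∫ y in halfBall d (1 / 3), u y ^ 2)
          + Real.exp (3 * τ) * ((∫ y in halfBall d (1 / 3), nondivOp A b c u y ^ 2)
            + flatData u)) := by
  obtain ⟨C₄, hC₄, hcaccioppoli⟩ := caccioppoli (d := d) hθ hB hM
  obtain ⟨K, hK⟩ := exists_cutoff_bound d
  obtain ⟨μ, hμ, hμM⟩ : ∃ μ : ℝ, 1 ≤ μ ∧ 2000 * (d + 1) ^ 2 * M ^ 2 ≤ θ ^ 2 * μ :=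
    ⟨max 1 (2000 * (d + 1) ^ 2 * M ^ 2 / θ ^ 2), le_max_left _ _,
      (div_le_iff₀' (by positivity)).1 (le_max_right _ _)⟩
  set φ₁ := Real.exp (μ * -(1 / 100))
  set φ₂ := Real.exp (μ * -(1 / 16))
  have hφ : φ₂ < φ₁ := Real.exp_lt_exp.2 (by linarith)
  have hgap : 0 < φ₁ - φ₂ := sub_pos.2 hφ
  set Z := 12 + 24 * (B + (Module.finrank ℝ (Rn d) + 2) * M) ^ 2 * K ^ 2 * (1 + C₄)
    + 109 * M ^ 2 * (μ ^ 3 * (2 * (K + 3) ^ 2 + 1))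
  refine ⟨Z * (24 / (φ₁ - φ₂) ^ 4) + (B + μ + 1) * Real.exp μ, φ₁ - φ₂, by positivity, hgap,
    fun S A b c u hA hb hc hu hbd τ hτ => ?_⟩
  have hS : 1 ≤ S := (hbd 0 ⟨by simp, by simp⟩).one_le_S
  have hμτ : (B + μ + 1) * Real.exp μ * S ≤ τ :=
    le_trans (by gcongr; exact le_add_of_nonneg_left (by positivity)) hτ
  have hU : 0 ≤ ∫ y in halfBall d (1 / 3), u y ^ 2 := integral_nonneg fun y => sq_nonneg _
  have : 0 ≤ ∫ y in halfBall d (1 / 3), nondivOp A b c u y ^ 2 :=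
    integral_nonneg fun y => sq_nonneg _
  have hD : 0 ≤ flatData u := flatData_nonneg u
  have hcollect := carleman_cutoff_of_caccioppoli hμ hμM hμτ hK hC₄.le hA hb hc hu hbd
    (hcaccioppoli S A b c u hA hb.continuous hc.continuous hu hbd)
  refine (le_of_exp_mul_le_pow_four (by positivity) (le_trans (by positivity) hμτ) hφ
    (Real.exp_pos _).le hU (by positivity) hcollect).trans ?_
  gcongr
  exact le_add_of_nonneg_right (by positivity)

section mollify

open scoped Convolution

variable {d : ℕ} {U : Set (Rn d)} {f g : Rn d → ℝ} {N : ℝ}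

/-- The convolution of `f` with the normalized bump function `φ`, for regularizing `W^{1,∞}`
coefficients. -/
noncomputable def mollify (φ : ContDiffBump (0 : Rn d)) (f : Rn d → ℝ) : Rn d → ℝ :=
  φ.normed volume ⋆[ContinuousLinearMap.lsmul ℝ ℝ, volume] f

lemma mollify_apply (φ : ContDiffBump (0 : Rn d)) (f : Rn d → ℝ) (y : Rn d) :
    mollify φ f y = ∫ t, φ.normed volume (y - t) * f t :=
  convolution_lsmul_swap

lemma contDiff_mollify (φ : ContDiffBump (0 : Rn d)) (hf : LocallyIntegrable f) :
    ContDiff ℝ 1 (mollify φ f) :=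
  φ.hasCompactSupport_normed.contDiff_convolution_left (n := 1) _ φ.contDiff_normed hf

lemma abs_mollify_le (φ : ContDiffBump (0 : Rn d)) (hf : ∀ᵐ t, |f t| ≤ N) (y : Rn d) :
    |mollify φ f y| ≤ N := by
  rw [mollify_apply, ← Real.norm_eq_abs]
  have hint : Integrable fun t => φ.normed volume (y - t) := φ.integrable_normed.comp_sub_left y
  calc ‖∫ t, φ.normed volume (y - t) * f t‖ ≤ ∫ t, φ.normed volume (y - t) * N := by
        refine norm_integral_le_of_norm_le (hint.mul_const N) ?_
        filter_upwards [hf] with t ht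
        have hφ : 0 ≤ φ.normed volume (y - t) := φ.nonneg_normed _
        rw [Real.norm_eq_abs, abs_mul, abs_of_nonneg hφ]
        gcongr
    _ = N := by
        rw [integral_mul_const, integral_sub_left_eq_self (φ.normed volume) volume y,
          φ.integral_normed, one_mul]

lemma fderiv_mollify_apply (φ : ContDiffBump (0 : Rn d)) (hf : LocallyIntegrable f)
    (y v : Rn d) :
    fderiv ℝ (mollify φ f) y v = ∫ t, f t * fderiv ℝ (φ.normed volume) (y - t) v := by
  have hφ : ContDiff ℝ 1 (φ.normed volume) := φ.contDiff_normed (n := 1)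
  have hflip : mollify φ f
      = f ⋆[(ContinuousLinearMap.lsmul ℝ ℝ).flip, volume] (φ.normed volume) := by
    rw [mollify, ← convolution_flip]
  rw [hflip, (φ.hasCompactSupport_normed.hasFDerivAt_convolution_right _ hf hφ y).fderiv,
    convolution_precompR_apply _ hf (φ.hasCompactSupport_normed.fderiv ℝ)
      (hφ.continuous_fderiv one_ne_zero)]
  simp [convolution_def, mul_comm]

lemma partialD_const_sub (hf : Differentiable ℝ f) (i : Fin (d + 1)) (y t : Rn d) :
    partialD i (fun t => f (y - t)) t = -partialD i f (y - t) := by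
  have h : HasFDerivAt (fun t => f (y - t)) _ t :=
    (hf (y - t)).hasFDerivAt.comp t ((hasFDerivAt_id t).const_sub y)
  simp [partialD, h.fderiv]

lemma tsupport_normed_const_sub_subset (φ : ContDiffBump (0 : Rn d)) (y : Rn d) :
    tsupport (fun t => φ.normed volume (y - t)) ⊆ Metric.closedBall y φ.rOut := by
  refine closure_minimal (fun t ht => ?_) Metric.isClosed_closedBall
  have hmem : y - t ∈ Function.support (φ.normed volume) := ht
  rw [φ.support_normed_eq, mem_ball_zero_iff] at hmem
  rw [Metric.mem_closedBall, dist_comm, dist_eq_norm]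
  exact hmem.le

/-- The reflected bump function is a test function in `U`, so the derivative passes to `f`. -/
lemma partialD_mollify_indicator (hU : MeasurableSet U) {i : Fin (d + 1)}
    (hf : LocallyIntegrable (U.indicator f)) (hfg : IsWeakPartialD U i f g)
    (φ : ContDiffBump (0 : Rn d)) {y : Rn d} (hy : Metric.closedBall y φ.rOut ⊆ U) :
    partialD i (mollify φ (U.indicator f)) y = mollify φ (U.indicator g) y := by
  set Φ : Rn d → ℝ := fun t => φ.normed volume (y - t)
  have hφ : ContDiff ℝ ∞ (φ.normed volume : Rn d → ℝ) := φ.contDiff_normed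
  have hΦ := tsupport_normed_const_sub_subset φ y
  calc partialD i (mollify φ (U.indicator f)) y
      = ∫ t, U.indicator (fun t => -(f t * partialD i Φ t)) t := by
        rw [partialD, fderiv_mollify_apply φ hf]
        congr 1 with t
        have hΦt : partialD i Φ t = -partialD i (φ.normed volume) (y - t) :=
          partialD_const_sub (hφ.differentiable (by simp)) i y t
        change U.indicator f t * partialD i (φ.normed volume) (y - t) = _
        by_cases ht : t ∈ U <;> simp [ht, hΦt]
    _ = ∫ t in U, g t * Φ t := by
        rw [integral_indicator hU, integral_neg,
          hfg Φ (hφ.comp (contDiff_const.sub contDiff_id))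
            ((isCompact_closedBall y φ.rOut).of_isClosed_subset (isClosed_tsupport _) hΦ)
            (hΦ.trans hy), neg_neg]
    _ = mollify φ (U.indicator g) y := by
        rw [mollify_apply, ← integral_indicator hU]
        congr 1 with t
        by_cases ht : t ∈ U <;> simp [ht, Φ, mul_comm]

lemma ae_abs_indicator_le_of_eLpNorm_le (hU : MeasurableSet U) (hN : 0 ≤ N)
    (hf : eLpNorm f ∞ (volume.restrict U) ≤ ENNReal.ofReal N) :
    ∀ᵐ t, |U.indicator f t| ≤ N := by
  have hU_bound : ∀ᵐ t ∂(volume.restrict U), |f t| ≤ N := by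
    rw [eLpNorm_exponent_top] at hf
    filter_upwards [ae_le_eLpNormEssSup (f := f) (μ := volume.restrict U)] with t ht
    have := ht.trans hf
    rwa [← ofReal_norm, ENNReal.ofReal_le_ofReal_iff hN] at this
  filter_upwards [(ae_restrict_iff' hU).1 hU_bound] with t ht
  by_cases htU : t ∈ U
  · simpa [htU] using ht htU
  · simpa [htU] using hN

lemma norm_le_of_abs_single_le {L : Rn d →L[ℝ] ℝ}
    (h : ∀ i, |L (EuclideanSpace.single i 1)| ≤ N) : ‖L‖ ≤ (d + 1) * N := by
  have hN : 0 ≤ N := (abs_nonneg _).trans (h 0)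
  refine L.opNorm_le_bound (by positivity) fun x => ?_
  calc ‖L x‖ = ‖∑ k, x k * L (EuclideanSpace.single k 1)‖ := by
        conv_lhs => rw [← (EuclideanSpace.basisFun (Fin (d + 1)) ℝ).sum_repr x]
        simp
    _ ≤ ∑ k, ‖x k * L (EuclideanSpace.single k 1)‖ := norm_sum_le _ _
    _ ≤ ∑ _k : Fin (d + 1), ‖x‖ * N := by
        gcongr with k
        rw [norm_mul]
        gcongr
        · exact PiLp.norm_apply_le x k
        · exact h k
    _ = (d + 1) * N * ‖x‖ := by simp; ring

lemma W1InftyNormLE.ae_abs_indicator_le (hU : MeasurableSet U) (hN : 0 ≤ N)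
    (hf : W1InftyNormLE U f N) : ∀ᵐ t, |U.indicator f t| ≤ N :=
  ae_abs_indicator_le_of_eLpNorm_le hU hN hf.2.1

lemma W1InftyNormLE.locallyIntegrable_indicator (hU : MeasurableSet U) (hN : 0 ≤ N)
    (hf : W1InftyNormLE U f N) : LocallyIntegrable (U.indicator f) :=
  (memLp_top_of_bound ((aestronglyMeasurable_indicator_iff hU).2 hf.1.1) N
    (hf.ae_abs_indicator_le hU hN)).locallyIntegrable le_top

lemma W1InftyNormLE.norm_fderiv_mollify_le (hU : MeasurableSet U) (hN : 0 ≤ N)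
    (hf : W1InftyNormLE U f N) (φ : ContDiffBump (0 : Rn d)) {y : Rn d}
    (hy : Metric.closedBall y φ.rOut ⊆ U) :
    ‖fderiv ℝ (mollify φ (U.indicator f)) y‖ ≤ (d + 1) * N := by
  refine norm_le_of_abs_single_le fun i => ?_
  obtain ⟨g, hfg, -, hg⟩ := hf.2.2 i
  have hpartial :=
    partialD_mollify_indicator hU (hf.locallyIntegrable_indicator hU hN) hfg φ hy
  rw [partialD] at hpartial
  rw [hpartial]
  exact abs_mollify_le φ (ae_abs_indicator_le_of_eLpNorm_le hU hN hg) y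

/-- A sequence of bump functions whose supports shrink to the origin. -/
noncomputable def bumpSeq (d : ℕ) (k : ℕ) : ContDiffBump (0 : Rn d) where
  rIn := 1 / (2 * (k + 1))
  rOut := 1 / (k + 1)
  rIn_pos := by positivity
  rIn_lt_rOut := one_div_lt_one_div_of_lt (by positivity) (by linarith)

lemma tendsto_bumpSeq_rOut : Filter.Tendsto (fun k => (bumpSeq d k).rOut) Filter.atTop (nhds 0) :=
  tendsto_one_div_add_atTop_nhds_zero_nat

lemma ae_tendsto_mollify (hf : LocallyIntegrable f) :
    ∀ᵐ y, Filter.Tendsto (fun k => mollify (bumpSeq d k) f y) Filter.atTop (nhds (f y)) := by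
  refine ContDiffBump.ae_convolution_tendsto_right_of_locallyIntegrable (K := 2)
    tendsto_bumpSeq_rOut (Filter.Eventually.of_forall fun k => ?_) hf
  simp only [bumpSeq]
  rw [mul_one_div, div_le_div_iff₀ (by positivity) (by positivity)]
  linarith

end mollify

section coefficients

section sumSmul

variable {ι E V : Type*} [Fintype ι] [NormedAddCommGroup E] [NormedSpace ℝ E]
  [NormedAddCommGroup V] [NormedSpace ℝ V] {v : ι → V} {N : ℝ}

lemma norm_sum_smul_le {f : ι → ℝ} (hv : ∀ i, ‖v i‖ ≤ 1) (hf : ∀ i, |f i| ≤ N) :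
    ‖∑ i, f i • v i‖ ≤ Fintype.card ι * N := by
  calc ‖∑ i, f i • v i‖ ≤ ∑ i, ‖f i • v i‖ := norm_sum_le _ _
    _ ≤ ∑ _i : ι, N := by
        gcongr with i
        rw [norm_smul]
        exact (mul_le_of_le_one_right (norm_nonneg _) (hv i)).trans (hf i)
    _ = Fintype.card ι * N := by simp

lemma norm_fderiv_sum_smul_le {f : ι → E → ℝ} {y : E} (hv : ∀ i, ‖v i‖ ≤ 1)
    (hf : ∀ i, DifferentiableAt ℝ (f i) y) (hf' : ∀ i, ‖fderiv ℝ (f i) y‖ ≤ N) :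
    ‖fderiv ℝ (fun x => ∑ i, f i x • v i) y‖ ≤ Fintype.card ι * N := by
  have h : HasFDerivAt (fun x => ∑ i, f i x • v i) (∑ i, (fderiv ℝ (f i) y).smulRight (v i)) y :=
    HasFDerivAt.fun_sum fun i _ => (hf i).hasFDerivAt.smul_const (v i)
  rw [h.fderiv]
  calc ‖∑ i, (fderiv ℝ (f i) y).smulRight (v i)‖
      ≤ ∑ i, ‖(fderiv ℝ (f i) y).smulRight (v i)‖ := norm_sum_le _ _
    _ ≤ ∑ _i : ι, N := by
        gcongr with i
        rw [ContinuousLinearMap.norm_smulRight_apply]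
        exact (mul_le_of_le_one_right (norm_nonneg _) (hv i)).trans (hf' i)
    _ = Fintype.card ι * N := by simp

end sumSmul

lemma sum_symmetrize {n : ℕ} (f h : Fin n → Fin n → ℝ) (hh : ∀ i j, h i j = h j i) :
    ∑ i, ∑ j, (f i j + f j i) / 2 * h i j = ∑ i, ∑ j, f i j * h i j := by
  have hswap : ∑ i, ∑ j, f j i * h i j = ∑ i, ∑ j, f i j * h i j := by
    rw [Finset.sum_comm]
    simp only [hh]
  calc ∑ i, ∑ j, (f i j + f j i) / 2 * h i j
      = (∑ i, ∑ j, f i j * h i j + ∑ i, ∑ j, f j i * h i j) / 2 := by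
        simp only [← Finset.sum_add_distrib, Finset.sum_div, ← add_mul, div_mul_eq_mul_div]
    _ = ∑ i, ∑ j, f i j * h i j := by rw [hswap, add_self_div_two]

variable {d : ℕ}

/-- The field of symmetric endomorphisms with matrix `(a + aᵀ) / 2`. It has the same quadratic form
and defines the same second order operator as `a`, which need not be symmetric. -/
noncomputable def coefMat (a : Fin (d + 1) → Fin (d + 1) → Rn d → ℝ) (y : Rn d) :
    Rn d →L[ℝ] Rn d :=
  ∑ s : Fin (d + 1) × Fin (d + 1), ((a s.1 s.2 y + a s.2 s.1 y) / 2) •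
    InnerProductSpace.rankOne ℝ (EuclideanSpace.single s.1 (1 : ℝ))
      (EuclideanSpace.single s.2 (1 : ℝ))

/-- The vector field with components `b`. -/
noncomputable def coefVec (b : Fin (d + 1) → Rn d → ℝ) (y : Rn d) : Rn d :=
  ∑ i, b i y • EuclideanSpace.single i (1 : ℝ)

section coefVec

variable {b : Fin (d + 1) → Rn d → ℝ} {N : ℝ} {y : Rn d}

lemma inner_coefVec (p : Rn d) : ⟪coefVec b y, p⟫_ℝ = ∑ i, b i y * p i := by
  simp [coefVec, sum_inner, real_inner_smul_left, EuclideanSpace.inner_single_left]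

lemma contDiff_coefVec (hb : ∀ i, ContDiff ℝ 1 (b i)) : ContDiff ℝ 1 (coefVec b) :=
  ContDiff.sum fun i _ => (hb i).smul contDiff_const

lemma norm_coefVec_le (hb : ∀ i, |b i y| ≤ N) : ‖coefVec b y‖ ≤ (d + 1) * N :=
  (norm_sum_smul_le (fun i => by simp) hb).trans_eq (by simp)

lemma norm_fderiv_coefVec_le (hb : ∀ i, DifferentiableAt ℝ (b i) y)
    (hb' : ∀ i, ‖fderiv ℝ (b i) y‖ ≤ N) : ‖fderiv ℝ (coefVec b) y‖ ≤ (d + 1) * N :=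
  (norm_fderiv_sum_smul_le (fun i => by simp) hb hb').trans_eq (by simp)

end coefVec

section coefMat

variable {a : Fin (d + 1) → Fin (d + 1) → Rn d → ℝ} {U : Set (Rn d)} {M : ℝ} {y : Rn d}

lemma inner_coefMat (x z : Rn d) :
    ⟪coefMat a y x, z⟫_ℝ = ∑ i, ∑ j, (a i j y + a j i y) / 2 * (x j * z i) := by
  simp only [coefMat, sum_apply, sum_inner, Fintype.sum_prod_type]
  refine Finset.sum_congr rfl fun i _ => Finset.sum_congr rfl fun j _ => ?_
  simp [real_inner_smul_left, EuclideanSpace.inner_single_left]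

lemma isSymmetric_coefMat : (coefMat a y : Rn d →ₗ[ℝ] Rn d).IsSymmetric := fun x z => by
  simp only [ContinuousLinearMap.coe_coe]
  rw [real_inner_comm (coefMat a y z), inner_coefMat, inner_coefMat, Finset.sum_comm]
  refine Finset.sum_congr rfl fun i _ => Finset.sum_congr rfl fun j _ => ?_
  ring

lemma inner_coefMat_self (x : Rn d) : ⟪coefMat a y x, x⟫_ℝ = ∑ i, ∑ j, a i j y * x i * x j := by
  rw [inner_coefMat, sum_symmetrize _ (fun i j => x j * x i) fun i j => mul_comm _ _]
  refine Finset.sum_congr rfl fun i _ => Finset.sum_congr rfl fun j _ => ?_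
  ring

lemma traceL_rankOne_comp (x z : Rn d) (H : Rn d →L[ℝ] Rn d) :
    traceL ((InnerProductSpace.rankOne ℝ x z).comp H) = ⟪z, H x⟫_ℝ := by
  have h : (InnerProductSpace.rankOne ℝ x z).comp H = ((innerSL ℝ z).comp H).smulRight x := by
    ext1 w
    simp
  rw [h, traceL_smulRight, ContinuousLinearMap.comp_apply, innerSL_apply_apply]

lemma traceL_coefMat_comp {H : Rn d →L[ℝ] Rn d} (hH : (H : Rn d →ₗ[ℝ] Rn d).IsSymmetric) :
    traceL ((coefMat a y).comp H) = ∑ i, ∑ j, a i j y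
      * ⟪H (EuclideanSpace.single i 1), EuclideanSpace.single j 1⟫_ℝ := by
  have hsymm : ∀ i j, ⟪H (EuclideanSpace.single i 1), EuclideanSpace.single j 1⟫_ℝ
      = ⟪H (EuclideanSpace.single j 1), EuclideanSpace.single i 1⟫_ℝ := fun i j => by
    rw [hH.apply_clm, real_inner_comm]
  rw [← sum_symmetrize _ _ hsymm, ← Fintype.sum_prod_type']
  simp only [coefMat, ContinuousLinearMap.finsetSum_comp, map_sum, ContinuousLinearMap.smul_comp,
    map_smul, smul_eq_mul]
  refine Finset.sum_congr rfl fun s _ => ?_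
  rw [traceL_rankOne_comp, real_inner_comm]

lemma contDiffOn_coefMat (ha : ∀ i j, C1NormLE U (a i j) M) : ContDiffOn ℝ 1 (coefMat a) U :=
  ContDiffOn.sum fun s _ => ContDiffOn.smul
    (((ha s.1 s.2).1.add (ha s.2 s.1).1).div_const 2) contDiffOn_const

lemma norm_coefMat_le (ha : ∀ i j, C1NormLE U (a i j) M) (hy : y ∈ U) :
    ‖coefMat a y‖ ≤ (d + 1) ^ 2 * M := by
  refine (norm_sum_smul_le (N := M) (fun s => by simp) fun s => ?_).trans_eq ?_
  · have h := abs_add_le (a s.1 s.2 y) (a s.2 s.1 y)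
    have h₁ := ((ha s.1 s.2).2 y hy).1
    have h₂ := ((ha s.2 s.1).2 y hy).1
    rw [abs_div, abs_two]
    linarith
  · simp [sq]

lemma norm_fderiv_coefMat_le (hU : IsOpen U) (ha : ∀ i j, C1NormLE U (a i j) M) (hy : y ∈ U) :
    ‖fderiv ℝ (coefMat a) y‖ ≤ (d + 1) ^ 2 * M := by
  have hd : ∀ i j, DifferentiableAt ℝ (a i j) y := fun i j =>
    ((ha i j).1.differentiableOn one_ne_zero).differentiableAt (hU.mem_nhds hy)
  refine (norm_fderiv_sum_smul_le (N := M)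
    (f := fun (s : Fin (d + 1) × Fin (d + 1)) x => (a s.1 s.2 x + a s.2 s.1 x) / 2)
    (fun s => by simp) (fun s => by fun_prop)
    fun s => ?_).trans_eq (by simp [sq])
  have h : HasFDerivAt (fun x => (a s.1 s.2 x + a s.2 s.1 x) / 2)
      ((2 : ℝ)⁻¹ • (fderiv ℝ (a s.1 s.2) y + fderiv ℝ (a s.2 s.1) y)) y := by
    simp only [div_eq_mul_inv]
    exact ((hd _ _).hasFDerivAt.add (hd _ _).hasFDerivAt).mul_const _
  have h₁ := ((ha s.1 s.2).2 y hy).2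
  have h₂ := ((ha s.2 s.1).2 y hy).2
  rw [h.fderiv, norm_smul, Real.norm_of_nonneg (by norm_num)]
  linarith [norm_add_le (fderiv ℝ (a s.1 s.2) y) (fderiv ℝ (a s.2 s.1) y)]

end coefMat

/-- A smooth cutoff between `K` and the complement of `U` makes the product with `F` global. -/
lemma exists_contDiff_eventuallyEq {E V : Type*} [NormedAddCommGroup E] [NormedSpace ℝ E]
    [FiniteDimensional ℝ E] [NormedAddCommGroup V] [NormedSpace ℝ V] {U K : Set E}
    (hU : IsOpen U) (hK : IsClosed K) (hKU : K ⊆ U) {n : ℕ∞} {F : E → V}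
    (hF : ContDiffOn ℝ n F U) : ∃ G : E → V, ContDiff ℝ n G ∧ ∀ y ∈ K, G =ᶠ[nhds y] F := by
  obtain ⟨ζ, hζ₀, hζ₁, -⟩ := exists_contMDiffMap_zero_one_nhds_of_isClosed
    (modelWithCornersSelf ℝ E) (n := n) hU.isClosed_compl hK
    (Set.disjoint_left.2 fun x hx hxK => hx (hKU hxK))
  refine ⟨fun x => ζ x • F x, contDiff_iff_contDiffAt.2 fun x => ?_, fun y hy => ?_⟩
  · by_cases hx : x ∈ U
    · exact ζ.contMDiff.contDiff.contDiffAt.smul (hF.contDiffAt (hU.mem_nhds hx))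
    · refine (contDiffAt_const (c := 0)).congr_of_eventuallyEq ?_
      filter_upwards [eventually_nhdsSet_iff_forall.1 hζ₀ x hx] with z hz
      simp [hz]
  · filter_upwards [eventually_nhdsSet_iff_forall.1 hζ₁ y hy] with z hz
    simp [hz]

end coefficients

section equation

variable {d : ℕ} {U : Set (Rn d)} {θ M K S : ℝ} {a : Fin (d + 1) → Fin (d + 1) → Rn d → ℝ}
  {b : Fin (d + 1) → Rn d → ℝ} {c u G : Rn d → ℝ} {A : Rn d → Rn d →L[ℝ] Rn d} {y : Rn d}

/-- The function `u` solves `-a_{ij} D_{ij} u + b_i D_i u + c u = 0` in `U`, where the coefficients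
have the regularity and the bounds of the theorem. The parameter `S` stands for
`|α| + √|λ|`, so that `b` is of size `S` and `c` is of size `S²`. -/
structure IsEllipticSolution (U : Set (Rn d)) (θ M K S : ℝ)
    (a : Fin (d + 1) → Fin (d + 1) → Rn d → ℝ) (b : Fin (d + 1) → Rn d → ℝ) (c u : Rn d → ℝ) :
    Prop where
  one_le_S : 1 ≤ S
  elliptic : UniformlyElliptic U a θ
  leading : ∀ i j, C1NormLE U (a i j) M
  drift : ∀ i, W1InftyNormLE U (b i) (K * S)
  potential : W1InftyNormLE U c (K * S ^ 2)
  contDiffOn : ContDiffOn ℝ 2 u U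
  eq_zero : ∀ᵐ y ∂(volume.restrict U), ellipticOp a b c u y = 0

lemma inner_gradient_single (u : Rn d → ℝ) (y : Rn d) (i : Fin (d + 1)) :
    ⟪∇ u y, EuclideanSpace.single i 1⟫_ℝ = partialD i u y :=
  InnerProductSpace.toDual_symm_apply

lemma gradient_apply (u : Rn d → ℝ) (y : Rn d) (i : Fin (d + 1)) :
    (∇ u y) i = partialD i u y := by
  rw [← inner_gradient_single, EuclideanSpace.inner_single_right, one_mul, conj_trivial]

lemma partialD_partialD (hu : ContDiff ℝ 2 u) (i j : Fin (d + 1)) (y : Rn d) :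
    partialD i (partialD j u) y
      = ⟪hess u y (EuclideanSpace.single i 1), EuclideanSpace.single j 1⟫_ℝ := by
  rw [funext fun x => (inner_gradient_single u x j).symm, partialD,
    ((hasFDerivAt_gradient hu y).inner ℝ (hasFDerivAt_const _ y)).fderiv]
  simp

lemma ellipticOp_congr (h : G =ᶠ[nhds y] u) : ellipticOp a b c G y = ellipticOp a b c u y := by
  have hfst : ∀ i, partialD i G =ᶠ[nhds y] partialD i u := fun i => by
    filter_upwards [h.fderiv (𝕜 := ℝ)] with x hx
    rw [partialD, hx, partialD]
  have hsnd : ∀ i j, partialD i (partialD j G) y = partialD i (partialD j u) y := fun i j => by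
    rw [partialD, (hfst j).fderiv_eq, partialD]
  simp only [ellipticOp, hsnd, (hfst _).self_of_nhds, h.self_of_nhds]

lemma nondivOp_coefVec (hA : A y = coefMat a y) (hu : ContDiff ℝ 2 u) :
    nondivOp A (coefVec b) c u y = ellipticOp a b c u y := by
  simp only [nondivOp, ellipticOp, hA, traceL_coefMat_comp (isSymmetric_hess hu y), inner_coefVec,
    partialD_partialD hu, gradient_apply]

namespace IsEllipticSolution

lemma coeffBounds (h : IsEllipticSolution U θ M K S a b c u) (hU : IsOpen U) (hθ : 0 < θ)
    (hK : 0 ≤ K) (hA : A =ᶠ[nhds y] coefMat a) (φ : ContDiffBump (0 : Rn d))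
    (hy : Metric.closedBall y φ.rOut ⊆ U) :
    CoeffBounds θ (max 1 ((d + 1) ^ 2 * M)) ((d + 1) ^ 2 * K) S A
      (coefVec fun i => mollify φ (U.indicator (b i))) (mollify φ (U.indicator c)) y := by
  have hyU : y ∈ U := hy (Metric.mem_closedBall_self φ.rOut_pos.le)
  have hS := h.one_le_S
  have hb : 0 ≤ K * S := by positivity
  have hc : 0 ≤ K * S ^ 2 := by positivity
  have hd : (1 : ℝ) ≤ d + 1 := by simp
  have hd₂ : (d + 1 : ℝ) ≤ (d + 1) ^ 2 := le_self_pow₀ hd two_ne_zero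
  have hbl := fun i => (h.drift i).locallyIntegrable_indicator hU.measurableSet hb
  have hdrift := fun i => (h.drift i).ae_abs_indicator_le hU.measurableSet hb
  have hpotential := h.potential.ae_abs_indicator_le hU.measurableSet hc
  have hA₀ := hA.self_of_nhds
  refine ⟨hθ, le_max_left _ _, by positivity, hS, ?_, ?_, ?_, fun x => ?_, ?_, ?_, ?_, ?_⟩
  · rw [hA₀]
    exact (norm_coefMat_le h.leading hyU).trans (le_max_right _ _)
  · rw [hA.fderiv_eq]
    exact (norm_fderiv_coefMat_le hU h.leading hyU).trans (le_max_right _ _)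
  · rw [hA₀]
    exact isSymmetric_coefMat
  · rw [hA₀, inner_coefMat_self]
    exact h.elliptic y hyU x
  · refine (norm_coefVec_le fun i => abs_mollify_le φ (hdrift i) y).trans ?_
    rw [mul_assoc]
    gcongr
  · refine (norm_fderiv_coefVec_le
      (fun i => (contDiff_mollify φ (hbl i)).differentiable one_ne_zero y)
      fun i => (h.drift i).norm_fderiv_mollify_le hU.measurableSet hb φ hy).trans_eq (by ring)
  · refine (abs_mollify_le φ hpotential y).trans ?_
    rw [mul_assoc]
    exact le_mul_of_one_le_left hc (one_le_pow₀ hd)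
  · refine (h.potential.norm_fderiv_mollify_le hU.measurableSet hc φ hy).trans ?_
    rw [mul_assoc]
    gcongr

lemma ae_tendsto_ellipticOp_mollify (h : IsEllipticSolution U θ M K S a b c u) (hU : IsOpen U)
    (hK : 0 ≤ K) : ∀ᵐ y ∂(volume.restrict U), Filter.Tendsto (fun k =>
      ellipticOp a (fun i => mollify (bumpSeq d k) (U.indicator (b i)))
        (mollify (bumpSeq d k) (U.indicator c)) u y) Filter.atTop (nhds 0) := by
  have hS := h.one_le_S
  have hb := fun i => (h.drift i).locallyIntegrable_indicator hU.measurableSet (by positivity)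
  have hc := h.potential.locallyIntegrable_indicator hU.measurableSet (by positivity)
  filter_upwards [h.eq_zero, ae_restrict_mem hU.measurableSet,
    ae_restrict_of_ae (ae_all_iff.2 fun i => ae_tendsto_mollify (hb i)),
    ae_restrict_of_ae (ae_tendsto_mollify hc)] with y hzero hy hbt hct
  simp only [Set.indicator_of_mem hy] at hbt hct
  rw [← hzero]
  exact (tendsto_const_nhds.add (tendsto_finsetSum _ fun i _ =>
    (hbt i).mul tendsto_const_nhds)).add (hct.mul tendsto_const_nhds)

end IsEllipticSolution

lemma exists_abs_nondivOp_le {Q : Set (Rn d)} (hQ : IsCompact Q) (hA : Continuous A)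
    (hu : ContDiff ℝ 2 u) {β γ : ℝ} (hβ : 0 ≤ β) (hγ : 0 ≤ γ) :
    ∃ N, ∀ (b : Rn d → Rn d) (c : Rn d → ℝ), ∀ y ∈ Q, ‖b y‖ ≤ β → |c y| ≤ γ →
      |nondivOp A b c u y| ≤ N := by
  have hgrad : ContDiff ℝ 1 (∇ u) := contDiff_gradient hu (by norm_num)
  have htrace : Continuous fun y => traceL ((A y).comp (hess u y)) :=
    traceL.continuous.comp (hA.clm_comp (hgrad.continuous_fderiv one_ne_zero))
  obtain ⟨N₂, hN₂⟩ := hQ.exists_bound_of_continuousOn htrace.continuousOn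
  obtain ⟨N₁, hN₁⟩ := hQ.exists_bound_of_continuousOn hgrad.continuous.continuousOn
  obtain ⟨N₀, hN₀⟩ := hQ.exists_bound_of_continuousOn hu.continuous.continuousOn
  refine ⟨N₂ + β * N₁ + γ * N₀, fun b c y hy hb hc => ?_⟩
  have h₁ : |⟪b y, ∇ u y⟫_ℝ| ≤ β * N₁ :=
    (abs_real_inner_le_norm _ _).trans (mul_le_mul hb (hN₁ y hy) (norm_nonneg _) hβ)
  have h₀ : |c y * u y| ≤ γ * N₀ := by
    rw [abs_mul]
    exact mul_le_mul hc (hN₀ y hy) (abs_nonneg _) hγ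
  calc |nondivOp A b c u y|
      ≤ |-traceL ((A y).comp (hess u y))| + |⟪b y, ∇ u y⟫_ℝ| + |c y * u y| := abs_add_three _ _ _
    _ ≤ N₂ + β * N₁ + γ * N₀ := by
        rw [abs_neg]
        exact add_le_add_three (hN₂ y hy) h₁ h₀

lemma tendsto_setIntegral_nondivOp_sq {Q H : Set (Rn d)} (hQ : IsCompact Q)
    (hH : MeasurableSet H) (hHQ : H ⊆ Q) (hA : Continuous A) (hu : ContDiff ℝ 2 u) {β γ : ℝ}
    (hβ : 0 ≤ β) (hγ : 0 ≤ γ) {b : ℕ → Rn d → Rn d} {c : ℕ → Rn d → ℝ}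
    (hb : ∀ k, Continuous (b k)) (hc : ∀ k, Continuous (c k))
    (hbd : ∀ᶠ k in Filter.atTop, ∀ y ∈ Q, ‖b k y‖ ≤ β ∧ |c k y| ≤ γ)
    (hlim : ∀ᵐ y ∂(volume.restrict Q),
      Filter.Tendsto (fun k => nondivOp A (b k) (c k) u y) Filter.atTop (nhds 0)) :
    Filter.Tendsto (fun k => ∫ y in H, nondivOp A (b k) (c k) u y ^ 2) Filter.atTop (nhds 0) := by
  obtain ⟨N, hN⟩ := exists_abs_nondivOp_le hQ hA hu hβ hγ
  have hfin : volume H ≠ ⊤ := ((measure_mono hHQ).trans_lt hQ.measure_lt_top).ne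
  rw [← integral_zero (Rn d) ℝ (μ := volume.restrict H)]
  refine tendsto_integral_filter_of_dominated_convergence (fun _ => N ^ 2)
    (.of_forall fun k =>
      ((continuous_nondivOp hA (hb k) (hc k) hu).pow 2).aestronglyMeasurable)
    ?_ (integrableOn_const hfin) ?_
  · filter_upwards [hbd] with k hk
    filter_upwards [ae_restrict_mem hH] with y hy
    obtain ⟨hβy, hγy⟩ := hk y (hHQ hy)
    rw [Real.norm_eq_abs, abs_pow]
    gcongr
    exact hN _ _ y (hHQ hy) hβy hγy
  · filter_upwards [ae_restrict_of_ae_restrict_of_subset hHQ hlim] with y hy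
    simpa using hy.pow 2

lemma halfBall_subset_closedHalfBall {r s : ℝ} (h : r ≤ s) : halfBall d r ⊆ closedHalfBall d s :=
  fun _ hy => ⟨hy.1.le.trans h, hy.2.le⟩

lemma flatPoint_mem_closedHalfBall {r : ℝ} {y' : Rn' d} (hy' : y' ∈ Metric.ball 0 r) :
    flatPoint y' ∈ closedHalfBall d r :=
  ⟨(norm_flatPoint y').trans_le (mem_ball_zero_iff.1 hy').le, (flatPoint_last y').ge⟩

lemma isCompact_closedHalfBall (r : ℝ) : IsCompact (closedHalfBall d r) := by
  have h : closedHalfBall d r = Metric.closedBall 0 r ∩ {y | 0 ≤ y (Fin.last d)} := by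
    ext y
    simp [closedHalfBall]
  rw [h]
  exact (isCompact_closedBall _ _).inter_right (isClosed_le continuous_const (by fun_prop))

lemma setIntegral_halfBall_congr {r s : ℝ} (hrs : r ≤ s)
    (h : ∀ y ∈ closedHalfBall d s, G =ᶠ[nhds y] u) :
    ∫ y in halfBall d r, G y ^ 2 = ∫ y in halfBall d r, u y ^ 2 :=
  setIntegral_congr_fun (isOpen_halfBall d r).measurableSet fun y hy => by
    rw [(h y (halfBall_subset_closedHalfBall hrs hy)).self_of_nhds]

lemma flatData_congr (h : ∀ y ∈ closedHalfBall d (1 / 3), G =ᶠ[nhds y] u) :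
    flatData G = flatData u :=
  setIntegral_congr_fun measurableSet_ball fun y' hy' => by
    have hy := h _ (flatPoint_mem_closedHalfBall hy')
    simp only [hy.self_of_nhds, gradient, hy.fderiv_eq]

lemma IsEllipticSolution.exists_regularization (h : IsEllipticSolution U θ M K S a b c u)
    (hU : IsOpen U) (hθ : 0 < θ) (hK : 0 ≤ K) {Q : Set (Rn d)} (hQ : IsCompact Q) (hQU : Q ⊆ U) :
    ∃ (A : Rn d → Rn d →L[ℝ] Rn d) (bk : ℕ → Rn d → Rn d) (ck : ℕ → Rn d → ℝ),
      ContDiff ℝ 1 A ∧ (∀ k, ContDiff ℝ 1 (bk k)) ∧ (∀ k, ContDiff ℝ 1 (ck k)) ∧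
      (∀ᶠ k in Filter.atTop, ∀ y ∈ Q,
        CoeffBounds θ (max 1 ((d + 1) ^ 2 * M)) ((d + 1) ^ 2 * K) S A (bk k) (ck k) y) ∧
      ∀ G, ContDiff ℝ 2 G → (∀ y ∈ Q, G =ᶠ[nhds y] u) → ∀ᵐ y ∂(volume.restrict Q),
        Filter.Tendsto (fun k => nondivOp A (bk k) (ck k) G y) Filter.atTop (nhds 0) := by
  have hS := h.one_le_S
  obtain ⟨A, hA, hAa⟩ := exists_contDiff_eventuallyEq hU hQ.isClosed hQU (n := 1)
    (contDiffOn_coefMat h.leading)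
  obtain ⟨ε, hε, hεU⟩ := hQ.exists_cthickening_subset_open hU hQU
  refine ⟨A, fun k => coefVec fun i => mollify (bumpSeq d k) (U.indicator (b i)),
    fun k => mollify (bumpSeq d k) (U.indicator c), hA,
    fun k => contDiff_coefVec fun i => contDiff_mollify _
      ((h.drift i).locallyIntegrable_indicator hU.measurableSet (by positivity)),
    fun k => contDiff_mollify _
      (h.potential.locallyIntegrable_indicator hU.measurableSet (by positivity)), ?_,
    fun G hG hGu => ?_⟩
  · filter_upwards [(tendsto_bumpSeq_rOut (d := d)).eventually_lt_const hε] with k hk y hy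
    exact h.coeffBounds hU hθ hK (hAa y hy) _ ((Metric.closedBall_subset_closedBall hk.le).trans
      ((Metric.closedBall_subset_cthickening hy ε).trans hεU))
  · filter_upwards [ae_restrict_mem hQ.measurableSet,
      ae_restrict_of_ae_restrict_of_subset hQU (h.ae_tendsto_ellipticOp_mollify hU hK)]
      with y hy hlim
    simpa only [nondivOp_coefVec (hAa y hy).self_of_nhds hG, ellipticOp_congr (hGu y hy)]
      using hlim

/-- The equation only holds almost everywhere, and its lower order coefficients are only `W^{1,∞}`;
the estimate for `C¹` coefficients tolerates an error in the equation, which tends to zero as the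
coefficients are regularized. -/
theorem setIntegral_halfBall_le_of_closedHalfBall_subset {d : ℕ} {θ M K : ℝ} (hθ : 0 < θ)
    (hK : 0 ≤ K) : ∃ C g : ℝ, 0 < C ∧ 0 < g ∧
      ∀ (U : Set (Rn d)) (S : ℝ) (a : Fin (d + 1) → Fin (d + 1) → Rn d → ℝ)
        (b : Fin (d + 1) → Rn d → ℝ) (c u : Rn d → ℝ), IsOpen U →
      closedHalfBall d (1 / 3) ⊆ U → IsEllipticSolution U θ M K S a b c u → ∀ τ, C * S ≤ τ →
      ∫ y in halfBall d (1 / 256), u y ^ 2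
        ≤ C * (Real.exp (-g * τ) * (∫ y in halfBall d (1 / 3), u y ^ 2)
          + Real.exp (3 * τ) * flatData u) := by
  obtain ⟨C, g, hC, hg, hcarleman⟩ := carleman_caccioppoli_estimate (d := d) hθ
    (B := (d + 1) ^ 2 * K) (by positivity) (le_max_left 1 ((d + 1) ^ 2 * M))
  refine ⟨C, g, hC, hg, fun U S a b c u hU hQU h τ hτ => ?_⟩
  have hS := h.one_le_S
  have hQ := isCompact_closedHalfBall (d := d) (1 / 3)
  obtain ⟨G, hG, hGu⟩ := exists_contDiff_eventuallyEq hU hQ.isClosed hQU (n := 2) h.contDiffOn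
  obtain ⟨A, bk, ck, hA, hb, hc, hbounds, hzero⟩ := h.exists_regularization hU hθ hK hQ hQU
  have hsource : Filter.Tendsto (fun k => ∫ y in halfBall d (1 / 3),
      nondivOp A (bk k) (ck k) G y ^ 2) Filter.atTop (nhds 0) :=
    tendsto_setIntegral_nondivOp_sq hQ (isOpen_halfBall d _).measurableSet
      (halfBall_subset_closedHalfBall le_rfl) hA.continuous hG
      (β := (d + 1) ^ 2 * K * S) (γ := (d + 1) ^ 2 * K * S ^ 2) (by positivity) (by positivity)
      (fun k => (hb k).continuous) (fun k => (hc k).continuous)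
      (hbounds.mono fun k hk y hy => ⟨(hk y hy).norm_b_le, (hk y hy).abs_c_le⟩)
      (hzero G hG hGu)
  have hlimit := ge_of_tendsto (((hsource.add_const (flatData G)).const_mul (Real.exp (3 * τ))
    |>.const_add (Real.exp (-g * τ) * ∫ y in halfBall d (1 / 3), G y ^ 2)).const_mul C)
    (hbounds.mono fun k hk => hcarleman S A _ _ G hA (hb k) (hc k) hG hk τ hτ)
  rwa [zero_add, flatData_congr hGu, setIntegral_halfBall_congr le_rfl hGu,
    setIntegral_halfBall_congr (by norm_num) hGu] at hlimit

end equation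

section translation

variable {d : ℕ} {U : Set (Rn d)} {f g : Rn d → ℝ} {N : ℝ}

lemma partialD_comp_add_right (i : Fin (d + 1)) (f : Rn d → ℝ) (v y : Rn d) :
    partialD i (fun x => f (x + v)) y = partialD i f (y + v) := by
  rw [partialD, fderiv_comp_add_right, partialD]

lemma ellipticOp_comp_add_right (a : Fin (d + 1) → Fin (d + 1) → Rn d → ℝ)
    (b : Fin (d + 1) → Rn d → ℝ) (c u : Rn d → ℝ) (v y : Rn d) :
    ellipticOp (fun i j x => a i j (x + v)) (fun i x => b i (x + v)) (fun x => c (x + v))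
      (fun x => u (x + v)) y = ellipticOp a b c u (y + v) := by
  simp only [ellipticOp, funext (partialD_comp_add_right _ u v), partialD_comp_add_right]

lemma measurePreserving_restrict_add_right (U : Set (Rn d)) (v : Rn d) :
    MeasurePreserving (· + v) (volume.restrict ((· + v) ⁻¹' U)) (volume.restrict U) :=
  (measurePreserving_add_right volume v).restrict_preimage_emb (measurableEmbedding_addRight v) U

lemma setIntegral_comp_add_right (f : Rn d → ℝ) (U : Set (Rn d)) (v : Rn d) :
    ∫ y in (· + v) ⁻¹' U, f (y + v) = ∫ y in U, f y :=
  (measurePreserving_add_right volume v).setIntegral_preimage_emb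
    (measurableEmbedding_addRight v) f U

lemma C1NormLE.comp_add_right (h : C1NormLE U f N) (v : Rn d) :
    C1NormLE ((· + v) ⁻¹' U) (fun y => f (y + v)) N :=
  ⟨h.1.comp (by fun_prop) fun _ hy => hy, fun y hy => by
    rw [fderiv_comp_add_right]
    exact h.2 _ hy⟩

lemma IsWeakPartialD.comp_add_right {i : Fin (d + 1)} (h : IsWeakPartialD U i f g) (v : Rn d) :
    IsWeakPartialD ((· + v) ⁻¹' U) i (fun y => f (y + v)) (fun y => g (y + v)) := by
  intro φ hφ hφc hφU
  set ψ : Rn d → ℝ := fun x => φ (x + -v)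
  have hψφ (y : Rn d) : ψ (y + v) = φ y := by simp only [ψ, add_neg_cancel_right]
  have hψc : HasCompactSupport ψ := hφc.comp_homeomorph (Homeomorph.addRight (-v))
  have hψU : tsupport ψ ⊆ U := by
    have hsupp : tsupport ψ = (· + -v) ⁻¹' tsupport φ :=
      tsupport_comp_eq_preimage φ (Homeomorph.addRight (-v))
    intro x hx
    rw [hsupp] at hx
    simpa only [Set.mem_preimage, neg_add_cancel_right] using hφU hx
  have hweak := h ψ (hφ.comp (by fun_prop)) hψc hψU
  rw [← setIntegral_comp_add_right _ U v, ← setIntegral_comp_add_right _ U v] at hweak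
  simpa only [← partialD_comp_add_right, hψφ] using hweak

lemma W1InftyNormLE.comp_add_right (h : W1InftyNormLE U f N) (v : Rn d) :
    W1InftyNormLE ((· + v) ⁻¹' U) (fun y => f (y + v)) N := by
  have hm := measurePreserving_restrict_add_right U v
  refine ⟨h.1.comp_measurePreserving hm,
    (eLpNorm_comp_measurePreserving h.1.1 hm).trans_le h.2.1, fun i => ?_⟩
  obtain ⟨g, hweak, hg, hgN⟩ := h.2.2 i
  exact ⟨fun y => g (y + v), hweak.comp_add_right v, hg.comp_measurePreserving hm,
    (eLpNorm_comp_measurePreserving hg.1 hm).trans_le hgN⟩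

lemma W1InftyNormLE.mono {N' : ℝ} (h : W1InftyNormLE U f N) (hN : N ≤ N') :
    W1InftyNormLE U f N' :=
  ⟨h.1, h.2.1.trans (ENNReal.ofReal_le_ofReal hN), fun i =>
    let ⟨g, hweak, hg, hgN⟩ := h.2.2 i
    ⟨g, hweak, hg, hgN.trans (ENNReal.ofReal_le_ofReal hN)⟩⟩

lemma IsEllipticSolution.comp_add_right {θ M K S : ℝ} {a : Fin (d + 1) → Fin (d + 1) → Rn d → ℝ}
    {b : Fin (d + 1) → Rn d → ℝ} {c u : Rn d → ℝ} (h : IsEllipticSolution U θ M K S a b c u)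
    (v : Rn d) :
    IsEllipticSolution ((· + v) ⁻¹' U) θ M K S (fun i j y => a i j (y + v))
      (fun i y => b i (y + v)) (fun y => c (y + v)) (fun y => u (y + v)) where
  one_le_S := h.one_le_S
  elliptic _ hy := h.elliptic _ hy
  leading i j := (h.leading i j).comp_add_right v
  drift i := (h.drift i).comp_add_right v
  potential := h.potential.comp_add_right v
  contDiffOn := h.contDiffOn.comp (by fun_prop) fun _ hy => hy
  eq_zero := by
    simpa only [ellipticOp_comp_add_right] using
      (measurePreserving_restrict_add_right U v).quasiMeasurePreserving.ae h.eq_zero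

end translation

section flatFace

variable {d : ℕ}

lemma halfBall_subset_flatHalfBall (r : ℝ) : halfBall d r ⊆ flatHalfBall d r :=
  fun _ hy => ⟨hy.1, hy.2.le⟩

lemma closedHalfBall_subset_flatHalfBall {r s : ℝ} (h : r < s) :
    closedHalfBall d r ⊆ flatHalfBall d s :=
  fun _ hy => ⟨hy.1.trans_lt h, hy.2⟩

lemma flatHalfBall_mem_nhds {r : ℝ} {y : Rn d} (hy : y ∈ halfBall d r) :
    flatHalfBall d r ∈ nhds y :=
  Filter.mem_of_superset ((isOpen_halfBall d r).mem_nhds hy) (halfBall_subset_flatHalfBall r)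

lemma norm_smul_eN {δ : ℝ} (hδ : 0 ≤ δ) : ‖δ • eN d‖ = δ := by
  rw [norm_smul, norm_eN, mul_one, Real.norm_of_nonneg hδ]

lemma add_smul_eN_last (y : Rn d) (δ : ℝ) :
    (y + δ • eN d) (Fin.last d) = y (Fin.last d) + δ := by
  simp [eN]

lemma norm_add_smul_eN_le {r δ : ℝ} (hδ : 0 ≤ δ) {y : Rn d} (hy : y ∈ closedHalfBall d r) :
    ‖y + δ • eN d‖ ≤ r + δ :=
  (norm_add_le _ _).trans (add_le_add hy.1 (norm_smul_eN hδ).le)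

lemma add_smul_eN_mem_halfBall {r s δ : ℝ} (hδ : 0 < δ) (hδs : r + δ < s) {y : Rn d}
    (hy : y ∈ closedHalfBall d r) : y + δ • eN d ∈ halfBall d s :=
  ⟨(norm_add_smul_eN_le hδ.le hy).trans_lt hδs,
    (add_smul_eN_last y δ).symm ▸ add_pos_of_nonneg_of_pos hy.2 hδ⟩

lemma add_smul_eN_mem_closedHalfBall {r s δ : ℝ} (hδ : 0 ≤ δ) (hδs : r + δ ≤ s) {y : Rn d}
    (hy : y ∈ closedHalfBall d r) : y + δ • eN d ∈ closedHalfBall d s :=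
  ⟨(norm_add_smul_eN_le hδ hy).trans hδs, (add_smul_eN_last y δ).symm ▸ add_nonneg hy.2 hδ⟩

lemma uniqueDiffOn_flatHalfBall {r : ℝ} (hr : 0 < r) : UniqueDiffOn ℝ (flatHalfBall d r) := by
  have heq : flatHalfBall d r = Metric.ball 0 r ∩ {y | 0 ≤ y (Fin.last d)} := by
    ext y
    simp [flatHalfBall]
  have hconvex : Convex ℝ {y : Rn d | 0 ≤ y (Fin.last d)} :=
    convex_halfSpace_ge (f := fun y : Rn d => y (Fin.last d)) ⟨fun _ _ => rfl, fun _ _ => rfl⟩ 0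
  refine uniqueDiffOn_convex (heq ▸ (convex_ball _ _).inter hconvex) ⟨0 + (r / 2) • eN d, ?_⟩
  exact mem_interior_iff_mem_nhds.2 (flatHalfBall_mem_nhds (add_smul_eN_mem_halfBall (r := 0)
    (by positivity) (by linarith) ⟨norm_zero.le, le_rfl⟩))

lemma tendsto_setIntegral_add_smul_eN {X : Type*} [TopologicalSpace X] [MeasurableSpace X]
    [OpensMeasurableSpace X] {μ : Measure X} {s : Set X}
    (hs : MeasurableSet s) (hμ : μ s ≠ ⊤) {p : X → Rn d} (hp : Continuous p) {r R : ℝ}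
    (hrR : r < R) (hps : ∀ x ∈ s, p x ∈ closedHalfBall d r) {f : Rn d → ℝ}
    (hf : ContinuousOn f (flatHalfBall d R)) :
    Filter.Tendsto (fun δ : ℝ => ∫ x in s, f (p x + δ • eN d) ∂μ) (nhdsWithin 0 (Set.Ioi 0))
      (nhds (∫ x in s, f (p x) ∂μ)) := by
  obtain ⟨ρ, hrρ, hρR⟩ := exists_between hrR
  have hsub : closedHalfBall d ρ ⊆ flatHalfBall d R := closedHalfBall_subset_flatHalfBall hρR
  obtain ⟨N, hN⟩ :=
    (isCompact_closedHalfBall (d := d) ρ).exists_bound_of_continuousOn (hf.mono hsub)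
  have hmem : ∀ᶠ δ : ℝ in nhdsWithin 0 (Set.Ioi 0), ∀ x ∈ s,
      p x + δ • eN d ∈ closedHalfBall d ρ := by
    filter_upwards [Ioo_mem_nhdsGT (sub_pos.2 hrρ)] with δ hδ x hx
    exact add_smul_eN_mem_closedHalfBall hδ.1.le (by linarith [hδ.2]) (hps x hx)
  refine tendsto_integral_filter_of_dominated_convergence (fun _ => N) ?_ ?_
    (integrableOn_const hμ) ?_
  · filter_upwards [hmem] with δ hδ
    exact (hf.comp (by fun_prop) fun x hx => hsub (hδ x hx)).aestronglyMeasurable hs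
  · filter_upwards [hmem] with δ hδ
    filter_upwards [ae_restrict_mem hs] with x hx
    exact hN _ (hδ x hx)
  · filter_upwards [ae_restrict_mem hs] with x hx
    have hshift : Filter.Tendsto (fun δ : ℝ => p x + δ • eN d) (nhdsWithin 0 (Set.Ioi 0))
        (nhds (p x)) := by
      have hcont : Continuous fun δ : ℝ => p x + δ • eN d := by fun_prop
      simpa only [zero_smul, add_zero] using hcont.continuousWithinAt.tendsto (x := 0)
    exact (hf _ (closedHalfBall_subset_flatHalfBall hrR (hps x hx))).tendsto.comp
      (tendsto_nhdsWithin_iff.2 ⟨hshift, hmem.mono fun δ hδ => hsub (hδ x hx)⟩)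

/-- The analogue of `flatData` for a function on the half ball of radius `1/2` that is only
differentiable up to the flat face; it is comparable to the square of `cauchyData`. -/
noncomputable def faceData (u : Rn d → ℝ) : ℝ :=
  ∫ y' in Metric.ball (0 : Rn' d) (1 / 3),
    (u (flatPoint y') ^ 2 + ‖fderivWithin ℝ u (flatHalfBall d (1 / 2)) (flatPoint y')‖ ^ 2)

lemma faceData_nonneg (u : Rn d → ℝ) : 0 ≤ faceData u :=
  integral_nonneg fun y' => by positivity

lemma flatData_comp_add_smul_eN (u : Rn d → ℝ) {δ : ℝ} (hδ : 0 < δ) (hδ' : δ < 1 / 12) :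
    flatData (fun y => u (y + δ • eN d)) = ∫ y' in Metric.ball (0 : Rn' d) (1 / 3),
      (u (flatPoint y' + δ • eN d) ^ 2
        + ‖fderivWithin ℝ u (flatHalfBall d (1 / 2)) (flatPoint y' + δ • eN d)‖ ^ 2) :=
  setIntegral_congr_fun measurableSet_ball fun y' hy' => by
    have hmem : flatPoint y' + δ • eN d ∈ halfBall d (1 / 2) :=
      add_smul_eN_mem_halfBall hδ (by linarith) (flatPoint_mem_closedHalfBall hy')
    simp only [norm_gradient, fderiv_comp_add_right,
      fderivWithin_of_mem_nhds (flatHalfBall_mem_nhds hmem)]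

lemma setIntegral_halfBall_add_smul_eN_le {u : Rn d → ℝ}
    (hu : MemLp u 2 (volume.restrict (halfBall d (1 / 2)))) {δ : ℝ} (hδ : 0 < δ)
    (hδ' : δ < 1 / 12) :
    ∫ y in halfBall d (1 / 3), u (y + δ • eN d) ^ 2 ≤ ∫ y in halfBall d (1 / 2), u y ^ 2 := by
  rw [← setIntegral_comp_add_right (fun y => u y ^ 2) _ (δ • eN d)]
  refine setIntegral_mono_set
    (((measurePreserving_add_right volume (δ • eN d)).integrableOn_comp_preimage
      (measurableEmbedding_addRight _)).2 hu.integrable_sq) (.of_forall fun y => sq_nonneg _)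
    (LE.le.eventuallyLE fun y hy => ?_)
  exact add_smul_eN_mem_halfBall hδ (by linarith) (halfBall_subset_closedHalfBall le_rfl hy)

theorem IsEllipticSolution.setIntegral_halfBall_le_faceData {θ M K : ℝ} (hθ : 0 < θ)
    (hK : 0 ≤ K) : ∃ C g : ℝ, 0 < C ∧ 0 < g ∧
      ∀ (S : ℝ) (a : Fin (d + 1) → Fin (d + 1) → Rn d → ℝ) (b : Fin (d + 1) → Rn d → ℝ)
        (c u : Rn d → ℝ), IsEllipticSolution (halfBall d (1 / 2)) θ M K S a b c u →
      ContDiffOn ℝ 1 u (flatHalfBall d (1 / 2)) →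
      MemLp u 2 (volume.restrict (halfBall d (1 / 2))) → ∀ τ, C * S ≤ τ →
      ∫ y in halfBall d (1 / 256), u y ^ 2
        ≤ C * (Real.exp (-g * τ) * (∫ y in halfBall d (1 / 2), u y ^ 2)
          + Real.exp (3 * τ) * faceData u) := by
  obtain ⟨C, g, hC, hg, hinterior⟩ :=
    setIntegral_halfBall_le_of_closedHalfBall_subset (d := d) (M := M) hθ hK
  refine ⟨C, g, hC, hg, fun S a b c u h hu hu2 τ hτ => ?_⟩
  have hfderiv := hu.continuousOn_fderivWithin (uniqueDiffOn_flatHalfBall (by norm_num)) le_rfl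
  have hfinite : volume (halfBall d (1 / 256)) ≠ ⊤ :=
    ((measure_mono (halfBall_subset_closedHalfBall le_rfl)).trans_lt
      (isCompact_closedHalfBall _).measure_lt_top).ne
  have hleft := tendsto_setIntegral_add_smul_eN (isOpen_halfBall d (1 / 256)).measurableSet hfinite
    continuous_id (by norm_num) (fun y hy => halfBall_subset_closedHalfBall le_rfl hy)
    (hu.continuousOn.pow 2)
  have hright := tendsto_setIntegral_add_smul_eN (μ := volume) measurableSet_ball
    measure_ball_lt_top.ne isClosedEmbedding_flatPoint.continuous
    (show (1 / 3 : ℝ) < 1 / 2 by norm_num) (fun y' hy' => flatPoint_mem_closedHalfBall hy')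
    ((hu.continuousOn.pow 2).add (hfderiv.norm.pow 2))
  refine le_of_tendsto_of_tendsto hleft
    (((hright.const_mul (Real.exp (3 * τ))).const_add _).const_mul C) ?_
  filter_upwards [Ioo_mem_nhdsGT (show (0 : ℝ) < 1 / 12 by norm_num)] with δ hδ
  have hshifted := hinterior _ S _ _ _ _
    ((isOpen_halfBall d (1 / 2)).preimage (continuous_add_const (δ • eN d)))
    (fun y hy => add_smul_eN_mem_halfBall hδ.1 (by linarith [hδ.2]) hy)
    (h.comp_add_right (δ • eN d)) τ hτ
  rw [flatData_comp_add_smul_eN u hδ.1 hδ.2] at hshifted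
  refine hshifted.trans ?_
  gcongr C * (Real.exp _ * ?_ + ?_)
  · exact setIntegral_halfBall_add_smul_eN_le hu2 hδ.1 hδ.2
  · exact le_rfl

end flatFace

section cauchyData

variable {d : ℕ}

lemma inner_eq_inner_init (x : Rn d) (x' : Rn' d) :
    ⟪x, flatPoint x'⟫_ℝ = ⟪(WithLp.toLp 2 fun i => x i.castSucc : Rn' d), x'⟫_ℝ := by
  simp [PiLp.inner_apply, Fin.sum_univ_castSucc, flatPoint]

lemma sq_norm_eq_tangential_add_normal (L : Rn d →L[ℝ] ℝ) :
    ‖L‖ ^ 2 = ‖L.comp (flatEmb d).toContinuousLinearMap‖ ^ 2 + L (eN d) ^ 2 := by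
  obtain ⟨v, rfl⟩ := (InnerProductSpace.toDual ℝ (Rn d)).surjective L
  have htangential : (InnerProductSpace.toDual ℝ (Rn d) v).comp (flatEmb d).toContinuousLinearMap
      = InnerProductSpace.toDual ℝ (Rn' d) (WithLp.toLp 2 fun i => v i.castSucc) := by
    ext1 x'
    exact inner_eq_inner_init v x'
  have hnormal : InnerProductSpace.toDual ℝ (Rn d) v (eN d) = v (Fin.last d) := by
    simp [eN, EuclideanSpace.inner_single_right]
  rw [htangential, hnormal, LinearIsometryEquiv.norm_map, LinearIsometryEquiv.norm_map,
    EuclideanSpace.real_norm_sq_eq, EuclideanSpace.real_norm_sq_eq, Fin.sum_univ_castSucc]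

lemma flatPoint_mem_flatHalfBall {r : ℝ} {y' : Rn' d} (hy' : y' ∈ Metric.ball 0 r) :
    flatPoint y' ∈ flatHalfBall d r :=
  ⟨(norm_flatPoint y').trans_lt (mem_ball_zero_iff.1 hy'), (flatPoint_last y').ge⟩

lemma fderiv_comp_flatPoint {u : Rn d → ℝ} {r : ℝ}
    (hu : DifferentiableOn ℝ u (flatHalfBall d r)) {y' : Rn' d} (hy' : y' ∈ Metric.ball 0 r) :
    fderiv ℝ (fun x' => u (flatPoint x')) y'
      = (fderivWithin ℝ u (flatHalfBall d r) (flatPoint y')).comp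
        (flatEmb d).toContinuousLinearMap := by
  have hflat : HasFDerivWithinAt (flatPoint (d := d)) (flatEmb d).toContinuousLinearMap
      (Metric.ball 0 r) y' :=
    (flatEmb d).toContinuousLinearMap.hasFDerivAt.hasFDerivWithinAt
  have hcomp := (hu _ (flatPoint_mem_flatHalfBall hy')).hasFDerivWithinAt.comp y' hflat
    fun x' hx' => flatPoint_mem_flatHalfBall hx'
  exact (hcomp.hasFDerivAt (Metric.isOpen_ball.mem_nhds hy')).fderiv

lemma enorm_sq_add_sq_norm_fderivWithin {u : Rn d → ℝ} {r : ℝ}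
    (hu : DifferentiableOn ℝ u (flatHalfBall d r)) {y' : Rn' d} (hy' : y' ∈ Metric.ball 0 r) :
    ‖u (flatPoint y') ^ 2 + ‖fderivWithin ℝ u (flatHalfBall d r) (flatPoint y')‖ ^ 2‖ₑ
      = ‖u (flatPoint y')‖ₑ ^ 2 + ‖fderiv ℝ (fun x' => u (flatPoint x')) y'‖ₑ ^ 2
        + ‖normalD r u y'‖ₑ ^ 2 := by
  rw [sq_norm_eq_tangential_add_normal, ← fderiv_comp_flatPoint hu hy', normalD, enorm_neg, ← eN,
    Real.enorm_of_nonneg (by positivity), ENNReal.ofReal_add (by positivity) (by positivity),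
    ENNReal.ofReal_add (by positivity) (by positivity), ← add_assoc,
    ENNReal.ofReal_pow (norm_nonneg _), ofReal_norm]
  simp only [← Real.enorm_of_nonneg (sq_nonneg _), enorm_pow]

lemma eLpNorm_two_sq {X E : Type*} [MeasurableSpace X] [NormedAddCommGroup E] (f : X → E)
    (μ : Measure X) : eLpNorm f 2 μ ^ 2 = ∫⁻ x, ‖f x‖ₑ ^ 2 ∂μ := by
  simpa using eLpNorm_nnreal_pow_eq_lintegral (f := f) (μ := μ) (p := 2) two_ne_zero

lemma ballH1_sq (r : ℝ) (f : Rn' d → ℝ) : ballH1 r f ^ 2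
    = eLpNorm f 2 (volume.restrict (Metric.ball 0 r)) ^ 2
      + eLpNorm (fderiv ℝ f) 2 (volume.restrict (Metric.ball 0 r)) ^ 2 := by
  rw [ballH1, one_div]
  exact ENNReal.rpow_inv_natCast_pow two_ne_zero _

lemma ofReal_faceData_le {u : Rn d → ℝ} (hu : ContDiffOn ℝ 1 u (flatHalfBall d (1 / 2))) :
    ENNReal.ofReal (faceData u) ≤ cauchyData (1 / 2) (1 / 3) u ^ 2 := by
  set μ : Measure (Rn' d) := volume.restrict (Metric.ball 0 (1 / 3))
  set f : Rn' d → ℝ := fun y' => u (flatPoint y')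
  have hball : Metric.ball (0 : Rn' d) (1 / 3) ⊆ Metric.ball 0 (1 / 2) :=
    Metric.ball_subset_ball (by norm_num)
  have hf : AEMeasurable (fun y' => ‖f y'‖ₑ ^ 2) μ :=
    ((hu.continuousOn.comp isClosedEmbedding_flatPoint.continuous.continuousOn fun y' hy' =>
      flatPoint_mem_flatHalfBall (hball hy')).aestronglyMeasurable
        measurableSet_ball).enorm.pow_const 2
  have hff' : AEMeasurable (fun y' => ‖f y'‖ₑ ^ 2 + ‖fderiv ℝ f y'‖ₑ ^ 2) μ :=
    hf.add ((measurable_fderiv ℝ f).enorm.pow_const 2).aemeasurable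
  calc ENNReal.ofReal (faceData u) = ‖faceData u‖ₑ :=
        (Real.enorm_of_nonneg (faceData_nonneg u)).symm
    _ ≤ ∫⁻ y', ‖u (flatPoint y') ^ 2
        + ‖fderivWithin ℝ u (flatHalfBall d (1 / 2)) (flatPoint y')‖ ^ 2‖ₑ ∂μ :=
        enorm_integral_le_lintegral_enorm _
    _ = ∫⁻ y', (‖f y'‖ₑ ^ 2 + ‖fderiv ℝ f y'‖ₑ ^ 2 + ‖normalD (1 / 2) u y'‖ₑ ^ 2) ∂μ :=
        setLIntegral_congr_fun measurableSet_ball fun y' hy' =>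
          enorm_sq_add_sq_norm_fderivWithin (hu.differentiableOn one_ne_zero) (hball hy')
    _ = ballH1 (1 / 3) f ^ 2 + eLpNorm (normalD (1 / 2) u) 2 μ ^ 2 := by
        rw [lintegral_add_left' hff', lintegral_add_left' hf, ballH1_sq, eLpNorm_two_sq,
          eLpNorm_two_sq, eLpNorm_two_sq]
    _ ≤ cauchyData (1 / 2) (1 / 3) u ^ 2 := by
        rw [cauchyData, add_sq]
        gcongr
        exact le_self_add

lemma ofReal_sqrt_faceData_le {u : Rn d → ℝ} (hu : ContDiffOn ℝ 1 u (flatHalfBall d (1 / 2))) :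
    ENNReal.ofReal √(faceData u) ≤ cauchyData (1 / 2) (1 / 3) u := by
  rw [← ENNReal.pow_le_pow_left_iff two_ne_zero, ← ENNReal.ofReal_pow (Real.sqrt_nonneg _),
    Real.sq_sqrt (faceData_nonneg u)]
  exact ofReal_faceData_le hu

lemma halfBallL2_eq {u : Rn d → ℝ} {r : ℝ} (hu : MemLp u 2 (volume.restrict (halfBall d r))) :
    halfBallL2 r u = ENNReal.ofReal √(∫ y in halfBall d r, u y ^ 2) := by
  rw [halfBallL2, hu.eLpNorm_eq_integral_rpow_norm two_ne_zero ENNReal.ofNat_ne_top,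
    Real.sqrt_eq_rpow]
  simp

end cauchyData

section optimization

variable {I U D C a b T : ℝ}

lemma exists_exp_mul_eq_rpow_mul_rpow (hU : 0 < U) (hD : 0 < D) (hab : 0 < a + b) :
    ∃ s, Real.exp (-a * s) * U = U ^ (b / (a + b)) * D ^ (a / (a + b)) ∧
      Real.exp (b * s) * D = U ^ (b / (a + b)) * D ^ (a / (a + b)) := by
  rw [Real.rpow_def_of_pos hU, Real.rpow_def_of_pos hD, ← Real.exp_add]
  refine ⟨(Real.log U - Real.log D) / (a + b), ?_, ?_⟩
  · nth_rw 2 [← Real.exp_log hU]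
    rw [← Real.exp_add]
    congr 1
    field_simp
    ring
  · nth_rw 2 [← Real.exp_log hD]
    rw [← Real.exp_add]
    congr 1
    field_simp
    ring

lemma nonpos_of_forall_le_exp_neg (ha : 0 < a)
    (h : ∀ τ, T ≤ τ → I ≤ C * (Real.exp (-a * τ) * U)) : I ≤ 0 := by
  have hexp : Filter.Tendsto (fun τ : ℝ => Real.exp (-a * τ)) Filter.atTop (nhds 0) :=
    Real.tendsto_exp_atBot.comp (Filter.tendsto_id.const_mul_atTop_of_neg (neg_lt_zero.2 ha))
  have hlim := (hexp.mul_const U).const_mul C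
  rw [zero_mul, mul_zero] at hlim
  exact ge_of_tendsto hlim (Filter.eventually_atTop.2 ⟨T, h⟩)

lemma le_rpow_mul_rpow_of_forall_exp_of_pos (hU : 0 < U) (hD : 0 < D) (hC : 0 ≤ C) (ha : 0 < a)
    (hb : 0 < b) (hT : 0 ≤ T) (hIU : I ≤ U)
    (h : ∀ τ, T ≤ τ → I ≤ C * (Real.exp (-a * τ) * U + Real.exp (b * τ) * D)) :
    I ≤ (1 + 2 * C) * Real.exp (a * T) * (U ^ (b / (a + b)) * D ^ (a / (a + b))) := by
  obtain ⟨s, hsU, hsD⟩ := exists_exp_mul_eq_rpow_mul_rpow hU hD (add_pos ha hb)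
  set P := U ^ (b / (a + b)) * D ^ (a / (a + b))
  have hP : 0 ≤ P := by positivity
  rcases le_or_gt T s with hTs | hsT
  · calc I ≤ C * (P + P) := by simpa only [hsU, hsD] using h s hTs
      _ ≤ (1 + 2 * C) * 1 * P := by linarith
      _ ≤ (1 + 2 * C) * Real.exp (a * T) * P := by
        gcongr
        exact Real.one_le_exp (by positivity)
  · calc I ≤ U := hIU
      _ = Real.exp (a * s) * P := by
        rw [← hsU, ← mul_assoc, ← Real.exp_add, neg_mul, add_neg_cancel, Real.exp_zero, one_mul]
      _ ≤ 1 * Real.exp (a * T) * P := by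
        rw [one_mul]
        gcongr
      _ ≤ (1 + 2 * C) * Real.exp (a * T) * P := by
        gcongr
        linarith

lemma le_rpow_mul_rpow_of_forall_exp (hU : 0 ≤ U) (hD : 0 ≤ D) (hC : 0 ≤ C) (ha : 0 < a)
    (hb : 0 < b) (hT : 0 ≤ T) (hIU : I ≤ U)
    (h : ∀ τ, T ≤ τ → I ≤ C * (Real.exp (-a * τ) * U + Real.exp (b * τ) * D)) :
    I ≤ (1 + 2 * C) * Real.exp (a * T) * (U ^ (b / (a + b)) * D ^ (a / (a + b))) := by
  rcases hU.eq_or_lt with rfl | hU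
  · exact hIU.trans (by positivity)
  rcases hD.eq_or_lt with rfl | hD
  · exact (nonpos_of_forall_le_exp_neg (U := U) ha fun τ hτ => by
      simpa only [mul_zero, add_zero] using h τ hτ).trans (by positivity)
  exact le_rpow_mul_rpow_of_forall_exp_of_pos hU hD hC ha hb hT hIU h

lemma one_add_mul_exp_le_exp_sq {S : ℝ} (hC : 0 ≤ C) (hS : 1 ≤ S) :
    (1 + 2 * C) * Real.exp (a * (C * S)) ≤ Real.exp ((2 + a) * C / 2 * S) ^ 2 := by
  have hone : 1 + 2 * C ≤ Real.exp (2 * C * S) := by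
    have hCS : 2 * C * 1 ≤ 2 * C * S := by gcongr
    linarith [Real.add_one_le_exp (2 * C * S)]
  calc (1 + 2 * C) * Real.exp (a * (C * S)) ≤ Real.exp (2 * C * S) * Real.exp (a * (C * S)) := by
        gcongr
    _ = Real.exp ((2 + a) * C / 2 * S) ^ 2 := by
        rw [← Real.exp_add, ← Real.exp_nat_mul]
        congr 1
        push_cast
        ring

lemma sqrt_rpow_sq {x : ℝ} (hx : 0 ≤ x) (r : ℝ) : (√x ^ r) ^ 2 = x ^ r := by
  rw [← Real.rpow_mul_natCast (Real.sqrt_nonneg x), mul_comm, Real.rpow_natCast_mul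
    (Real.sqrt_nonneg x), Real.sq_sqrt hx]

lemma sqrt_le_exp_mul_rpow_mul_rpow {E κ κ' : ℝ} (hU : 0 ≤ U) (hD : 0 ≤ D) (hE : 0 ≤ E)
    (h : I ≤ E ^ 2 * (U ^ κ * D ^ κ')) : √I ≤ E * √U ^ κ * √D ^ κ' :=
  Real.sqrt_le_iff.2 ⟨by positivity, by
    rwa [mul_pow, mul_pow, sqrt_rpow_sq hU, sqrt_rpow_sq hD, mul_assoc]⟩

lemma ofReal_mul_rpow_mul_rpow {E x y κ κ' : ℝ} (hE : 0 ≤ E) (hx : 0 ≤ x) (hy : 0 ≤ y)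
    (hκ : 0 ≤ κ) (hκ' : 0 ≤ κ') : ENNReal.ofReal (E * x ^ κ * y ^ κ')
      = ENNReal.ofReal E * ENNReal.ofReal x ^ κ * ENNReal.ofReal y ^ κ' := by
  rw [ENNReal.ofReal_mul (by positivity), ENNReal.ofReal_mul hE,
    ENNReal.ofReal_rpow_of_nonneg hx hκ, ENNReal.ofReal_rpow_of_nonneg hy hκ']

end optimization

section conclusion

variable {d : ℕ}

theorem IsEllipticSolution.halfBallL2_le {θ M K : ℝ} (hθ : 0 < θ) (hK : 0 ≤ K) :
    ∃ C κ : ℝ, 0 < C ∧ 0 < κ ∧ κ < 1 ∧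
      ∀ (S : ℝ) (a : Fin (d + 1) → Fin (d + 1) → Rn d → ℝ) (b : Fin (d + 1) → Rn d → ℝ)
        (c u : Rn d → ℝ), IsEllipticSolution (halfBall d (1 / 2)) θ M K S a b c u →
      ContDiffOn ℝ 1 u (flatHalfBall d (1 / 2)) →
      MemLp u 2 (volume.restrict (halfBall d (1 / 2))) →
      halfBallL2 (1 / 256) u ≤ ENNReal.ofReal (Real.exp (C * S))
        * halfBallL2 (1 / 2) u ^ κ * cauchyData (1 / 2) (1 / 3) u ^ (1 - κ) := by
  obtain ⟨C, g, hC, hg, hestimate⟩ :=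
    IsEllipticSolution.setIntegral_halfBall_le_faceData (d := d) (M := M) hθ hK
  have hκ : 1 - 3 / (g + 3) = g / (g + 3) := by
    field_simp
    ring
  refine ⟨(2 + g) * C / 2, 3 / (g + 3), by positivity, by positivity,
    (div_lt_one (by positivity)).2 (by linarith), fun S a b c u h hu hu2 => ?_⟩
  have hS := h.one_le_S
  have hsub : halfBall d (1 / 256) ⊆ halfBall d (1 / 2) :=
    fun y hy => ⟨hy.1.trans (by norm_num), hy.2⟩
  set I := ∫ y in halfBall d (1 / 256), u y ^ 2
  set U := ∫ y in halfBall d (1 / 2), u y ^ 2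
  have hU : 0 ≤ U := integral_nonneg fun y => sq_nonneg _
  have hIU : I ≤ U := setIntegral_mono_set hu2.integrable_sq (.of_forall fun y => sq_nonneg _)
    hsub.eventuallyLE
  have hD := faceData_nonneg u
  have hoptimized : I ≤ Real.exp ((2 + g) * C / 2 * S) ^ 2
      * (U ^ (3 / (g + 3)) * faceData u ^ (g / (g + 3))) :=
    (le_rpow_mul_rpow_of_forall_exp hU hD hC.le hg three_pos (by positivity) hIU
      (hestimate S a b c u h hu hu2)).trans
      (mul_le_mul_of_nonneg_right (one_add_mul_exp_le_exp_sq hC.le hS) (by positivity))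
  rw [hκ, halfBallL2_eq (hu2.mono_measure (Measure.restrict_mono hsub le_rfl)), halfBallL2_eq hu2]
  calc ENNReal.ofReal √I
      ≤ ENNReal.ofReal (Real.exp ((2 + g) * C / 2 * S) * √U ^ (3 / (g + 3))
        * √(faceData u) ^ (g / (g + 3))) :=
        ENNReal.ofReal_le_ofReal
          (sqrt_le_exp_mul_rpow_mul_rpow hU hD (Real.exp_nonneg _) hoptimized)
    _ = ENNReal.ofReal (Real.exp ((2 + g) * C / 2 * S)) * ENNReal.ofReal √U ^ (3 / (g + 3))
        * ENNReal.ofReal √(faceData u) ^ (g / (g + 3)) :=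
        ofReal_mul_rpow_mul_rpow (Real.exp_nonneg _) (Real.sqrt_nonneg _) (Real.sqrt_nonneg _)
          (by positivity) (by positivity)
    _ ≤ _ := by
        gcongr
        exact ofReal_sqrt_faceData_le hu

lemma one_le_abs_add_sqrt {α lam : ℝ} (h : 1 ≤ |α| ∨ 1 ≤ |lam|) : 1 ≤ |α| + √|lam| := by
  rcases h with h | h
  · linarith [Real.sqrt_nonneg |lam|]
  · linarith [Real.one_le_sqrt.2 h, abs_nonneg α]

lemma sq_add_abs_le_sq (α lam : ℝ) : α ^ 2 + |lam| ≤ (|α| + √|lam|) ^ 2 := by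
  rw [add_sq, sq_abs, Real.sq_sqrt (abs_nonneg _)]
  linarith [mul_nonneg (abs_nonneg α) (Real.sqrt_nonneg |lam|)]

lemma IsEllipticSolution.of_abs_add_sqrt {U : Set (Rn d)} {θ M K α lam : ℝ}
    {a : Fin (d + 1) → Fin (d + 1) → Rn d → ℝ} {b : Fin (d + 1) → Rn d → ℝ} {c u : Rn d → ℝ}
    (hK : 0 ≤ K) (hα : 1 ≤ |α| ∨ 1 ≤ |lam|) (ha : UniformlyElliptic U a θ)
    (haM : ∀ i j, C1NormLE U (a i j) M) (hb : ∀ i, W1InftyNormLE U (b i) (K * (|α| + 1)))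
    (hc : W1InftyNormLE U c (K * (α ^ 2 + |lam|))) (hu : ContDiffOn ℝ 2 u U)
    (heq : ∀ᵐ y ∂(volume.restrict U), ellipticOp a b c u y = 0) :
    IsEllipticSolution U θ M (2 * K) (|α| + √|lam|) a b c u := by
  have hS := one_le_abs_add_sqrt hα
  refine ⟨hS, ha, haM, fun i => (hb i).mono ?_, hc.mono ?_, hu, heq⟩
  · rw [mul_right_comm, mul_comm _ K]
    gcongr
    linarith [Real.sqrt_nonneg |lam|]
  · gcongr
    · linarith
    · exact sq_add_abs_le_sq α lam

theorem lemma3_general (d : ℕ) (θ M K : ℝ) (hθ : 0 < θ) (hK : 0 ≤ K) :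
    ∃ C : ℝ, 0 < C ∧ ∃ β : ℝ, 0 < β ∧ ∃ κ : ℝ, 0 < κ ∧ κ < 1 ∧
      ∀ α lam : ℝ, (1 ≤ |α| ∨ 1 ≤ |lam|) →
      ∀ (a : Fin (d + 1) → Fin (d + 1) → Rn d → ℝ) (b : Fin (d + 1) → Rn d → ℝ)
        (c : Rn d → ℝ),
        UniformlyElliptic (halfBall d (1 / 2)) a θ →
        (∀ i j, C1NormLE (halfBall d (1 / 2)) (a i j) M) →
        (∀ i, W1InftyNormLE (halfBall d (1 / 2)) (b i) (K * (|α| + 1))) →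
        W1InftyNormLE (halfBall d (1 / 2)) c (K * (α ^ 2 + |lam|)) →
      ∀ u : Rn d → ℝ,
        ContDiffOn ℝ 2 u (halfBall d (1 / 2)) →
        ContDiffOn ℝ 1 u (flatHalfBall d (1 / 2)) →
        MemLp u 2 (volume.restrict (halfBall d (1 / 2))) →
        (∀ᵐ y ∂(volume.restrict (halfBall d (1 / 2))), ellipticOp a b c u y = 0) →
        (∀ ε : ℝ, 0 < ε → cauchyData (1 / 2) (1 / 3) u ≤ ENNReal.ofReal ε →
          halfBallL2 (1 / 2) u ≤ 1 →
          halfBallL2 (1 / 256) u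
            ≤ ENNReal.ofReal (Real.exp (C * (|α| + √|lam|)) * ε ^ β)) ∧
        halfBallL2 (1 / 256) u
          ≤ ENNReal.ofReal (Real.exp (C * (|α| + √|lam|)))
            * halfBallL2 (1 / 2) u ^ κ * cauchyData (1 / 2) (1 / 3) u ^ (1 - κ) := by
  obtain ⟨C, κ, hC, hκ, hκ1, hestimate⟩ :=
    IsEllipticSolution.halfBallL2_le (d := d) (M := M) (K := 2 * K) hθ (by positivity)
  have hβ : 0 < 1 - κ := sub_pos.2 hκ1
  refine ⟨C, hC, 1 - κ, hβ, κ, hκ, hκ1, ?_⟩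
  intro α lam hα a b c hell ha hb hc u hu2 hu1 huL heq
  have hle := hestimate (|α| + √|lam|) a b c u
    (.of_abs_add_sqrt hK hα hell ha hb hc hu2 heq) hu1 huL
  refine ⟨fun ε hε hdata hone => hle.trans ?_, hle⟩
  rw [ENNReal.ofReal_mul (Real.exp_nonneg _), ← ENNReal.ofReal_rpow_of_nonneg hε.le hβ.le]
  calc _ ≤ ENNReal.ofReal (Real.exp (C * (|α| + √|lam|))) * 1 ^ κ
        * ENNReal.ofReal ε ^ (1 - κ) := by gcongr
    _ = _ := by rw [ENNReal.one_rpow, mul_one]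

end conclusion

theorem lemma3 (d : ℕ) (hd : 1 ≤ d) (θ M K : ℝ) (hθ : 0 < θ) (hM : 0 < M) (hK : 0 < K) :
    ∃ C : ℝ, 0 < C ∧ ∃ β : ℝ, 0 < β ∧ ∃ κ : ℝ, 0 < κ ∧ κ < 1 ∧
      ∀ α lam : ℝ, (1 ≤ |α| ∨ 1 ≤ |lam|) →
      ∀ (a : Fin (d + 1) → Fin (d + 1) → Rn d → ℝ) (b : Fin (d + 1) → Rn d → ℝ)
        (c : Rn d → ℝ),
        UniformlyElliptic (halfBall d (1 / 2)) a θ →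
        (∀ i j, C1NormLE (halfBall d (1 / 2)) (a i j) M) →
        (∀ i, W1InftyNormLE (halfBall d (1 / 2)) (b i) (K * (|α| + 1))) →
        W1InftyNormLE (halfBall d (1 / 2)) c (K * (α ^ 2 + |lam|)) →
      ∀ u : Rn d → ℝ,
        ContDiffOn ℝ ∞ u (flatHalfBall d (1 / 2)) →
        MemLp u 2 (volume.restrict (halfBall d (1 / 2))) →
        (∀ᵐ y ∂(volume.restrict (halfBall d (1 / 2))), ellipticOp a b c u y = 0) →
        (∀ ε : ℝ, 0 < ε → cauchyData (1 / 2) (1 / 3) u ≤ ENNReal.ofReal ε →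
          halfBallL2 (1 / 2) u ≤ 1 →
          halfBallL2 (1 / 256) u
            ≤ ENNReal.ofReal (Real.exp (C * (|α| + √|lam|)) * ε ^ β)) ∧
        halfBallL2 (1 / 256) u
          ≤ ENNReal.ofReal (Real.exp (C * (|α| + √|lam|)))
            * halfBallL2 (1 / 2) u ^ κ * cauchyData (1 / 2) (1 / 3) u ^ (1 - κ) := by
  obtain ⟨C, hC, β, hβ, κ, hκ, hκ1, h⟩ := lemma3_general d θ M K hθ hK.le
  exact ⟨C, hC, β, hβ, κ, hκ, hκ1, fun α lam hα a b c hell ha hb hc u hu => h α lam hα a b c hell ha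
    hb hc u ((hu.of_le ENat.LEInfty.out).mono (halfBall_subset_flatHalfBall _))
    (hu.of_le ENat.LEInfty.out)⟩
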